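/- Let $n\ge 1$ be an integer and $1\le p<\infty$ a real number. Let $S^n\subset\mathbb R^{n+1}$ be the unit sphere with its round metric, and let $\operatorname{Diff}(S^n)$ be the group of smooth diffeomorphisms of $S^n$. For a real number $s=k+\sigma\ge 0$, with $k\in\mathbb N$ and $0\le\sigma<1$, and a smooth compactly supported map $f:\mathbb R^n\to\mathbb R^n$ put $$\|f\|_{W^{k,p}}=\sum_{j=0}^k\|D^jf\|_{L^p},\qquad \|f\|_{W^{s,p}}=\|f\|_{W^{k,p}}+\Big(\iint_{\mathbb R^n\times\mathbb R^n}\frac{|D^kf(x)-D^kf(y)|^p}{|x-y|^{n+\sigma p}}\,dx\,dy\Big)^{1/p}\quad\text{if }0<\sigma<1 .$$ Fix a finite cover of $S^n$ by open geodesic balls $B_{r_\alpha}(x_\alpha)$ with $0<r_\alpha\le\pi$, an orthonormal frame of each $T_{x_\alpha}S^n$, and a smooth partition of unity $(\rho_\alpha)$ subordinate to the cover. For a smooth vector field $u$ on $S^n$ put $\|u\|_{W^{s,p}}^2=\sum_\alpha\|u_\alpha\|^2_{W^{s,p}}$, where $u_\alpha:\mathbb R^n\to\mathbb R^n$ is the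 vector field $\rho_\alpha u$ written in the normal coordinates given by $\exp_{x_\alpha}$ on $\{|v|<r_\alpha\}$, extended by $0$. (Other choices of cover, frames and partition of unity give equivalent norms.) Define $$\operatorname{dist}_{s,p}(\varphi_0,\varphi_1)=\inf_{\varphi}\int_0^1\|\partial_t\varphi_t\circ\varphi_t^{-1}\|_{W^{s,p}}\,dt\in[0,\infty],$$ the infimum being over all smooth paths $\varphi:[0,1]\to\operatorname{Diff}(S^n)$ from $\varphi_0$ to $\varphi_1$ (smooth meaning that $(t,x)\mapsto\varphi_t(x)$ is smooth on $[0,1]\times S^n$; $\inf\emptyset=\infty$), and define the displacement energy of $A\subseteq S^n$ by $$E_{s,p}(A)=\inf\{\operatorname{dist}_{s,p}(\operatorname{Id},\varphi):\varphi\in\operatorname{Diff}(S^n),\ \varphi(A)\cap A=\emptyset\}.$$ Then the following hold, with constants that also depend on the fixed choice of the norm. 1. For every real $s>1+n/p$ there is a constant $c=c(s,p,n)>0$ such that for every $\delta\in(0,1)$ and every open geodesic ball $B_\delta\subset S^n$ of radius $\delta$, $$E_{s,p}(S^n\setminus B_\delta)>c\,|\log\delta|.$$ 2. For every integer $k\ge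 0$ with $k<1+n/p$ there is a constant $C=C(k,p,n)>0$ such that $$E_{k,p}(A)<C\quad\text{for every closed set }A\subsetneq S^n .$$ -/

import Mathlib

open scoped Manifold ContDiff ENNReal
open MeasureTheory

noncomputable section

namespace SphereDiff

/-- Euclidean space `ℝ^n`. -/
abbrev Euc (n : ℕ) : Type := EuclideanSpace ℝ (Fin n)

/-- The unit sphere `S^n ⊆ ℝ^{n+1}`, with Mathlib's smooth structure. -/
abbrev Sph (n : ℕ) : Type := Metric.sphere (0 : Euc (n + 1)) 1

/-- Open geodesic ball of the round metric: the great-circle distance is the angle. -/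
def geoBall {n : ℕ} (x : Sph n) (r : ℝ) : Set (Sph n) :=
  {y | InnerProductGeometry.angle (x : Euc (n + 1)) (y : Euc (n + 1)) < r}

/-- The group `Diff(S^n)` of smooth diffeomorphisms of the sphere. -/
abbrev DiffSph (n : ℕ) : Type := Diffeomorph (𝓡 n) (𝓡 n) (Sph n) (Sph n) ∞

/-! ### Sobolev–Slobodeckij norms of smooth maps on `ℝ^n`

They are only applied to smooth compactly supported maps, so that `D^j f` is the classical
derivative. -/

/-- `‖f‖_{W^{k,p}} = ∑_{j ≤ k} ‖D^j f‖_{L^p}`. -/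
def intSobolevNorm {n : ℕ} (k : ℕ) (p : ℝ) (f : Euc n → Euc n) : ℝ≥0∞ :=
  ∑ j ∈ Finset.range (k + 1), eLpNorm (iteratedFDeriv ℝ j f) (ENNReal.ofReal p) volume

/-- The Gagliardo seminorm
`(∬ |D^k f(x) - D^k f(y)|^p / |x - y|^{n + σ p} dx dy)^{1/p}`. -/
def gagliardoSeminorm {n : ℕ} (k : ℕ) (σ p : ℝ) (f : Euc n → Euc n) : ℝ≥0∞ :=
  (∫⁻ x : Euc n, ∫⁻ y : Euc n,
    ‖iteratedFDeriv ℝ k f x - iteratedFDeriv ℝ k f y‖ₑ ^ p / ‖x - y‖ₑ ^ ((n : ℝ) + σ * p)) ^ (1 / p)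

open Classical in
/-- The `W^{s,p}` norm, `s ≥ 0`: for `s = k + σ` with `0 < σ < 1` it is the `W^{k,p}` norm plus
the Gagliardo seminorm of order `σ` of `D^k f`; for an integer `s = k` it is the `W^{k,p}` norm. -/
def sobolevNorm {n : ℕ} (s p : ℝ) (f : Euc n → Euc n) : ℝ≥0∞ :=
  if s = (⌊s⌋₊ : ℝ) then intSobolevNorm ⌊s⌋₊ p f
  else intSobolevNorm ⌊s⌋₊ p f + gagliardoSeminorm ⌊s⌋₊ (s - (⌊s⌋₊ : ℝ)) p f

/-! ### Normal coordinates and the Sobolev norm of a vector field on the sphere -/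

/-- The Riemannian exponential map of the round sphere at `x`, in the coordinates on `T_x S^n = x^⊥`
given by an orthonormal frame `F`: `v ↦ cos |v| x + (sin |v| / |v|) F v`. -/
def expAmbient {n : ℕ} (x : Sph n)
    (F : Euc n ≃ₗᵢ[ℝ] (Submodule.span ℝ {(x : Euc (n + 1))})ᗮ) (v : Euc n) : Euc (n + 1) :=
  Real.cos ‖v‖ • (x : Euc (n + 1)) + Real.sinc ‖v‖ • (F v : Euc (n + 1))

theorem expAmbient_mem {n : ℕ} (x : Sph n)
    (F : Euc n ≃ₗᵢ[ℝ] (Submodule.span ℝ {(x : Euc (n + 1))})ᗮ) (v : Euc n) :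
    expAmbient x F v ∈ Metric.sphere (0 : Euc (n + 1)) 1 := by
  have hx : ‖(x : Euc (n + 1))‖ = 1 := by simp
  have hF : ‖(F v : Euc (n + 1))‖ = ‖v‖ := by
    rw [← F.norm_map v, Submodule.coe_norm]
  have ho : inner ℝ (x : Euc (n + 1)) (F v : Euc (n + 1)) = 0 :=
    Submodule.mem_orthogonal_singleton_iff_inner_right.1 (F v).2
  have hs : Real.sinc ‖v‖ * ‖v‖ = Real.sin ‖v‖ := by
    by_cases h : ‖v‖ = 0
    · simp [h]
    · rw [Real.sinc_of_ne_zero h]; field_simp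
  have h2 : ‖expAmbient x F v‖ ^ 2 = 1 := by
    rw [expAmbient, norm_add_sq_real, norm_smul, norm_smul, inner_smul_left, inner_smul_right, ho,
      hx, hF, mul_pow, mul_pow, Real.norm_eq_abs, Real.norm_eq_abs, sq_abs, sq_abs,
      ← mul_pow (Real.sinc _), hs]
    simp
  rw [mem_sphere_zero_iff_norm]
  exact (pow_eq_one_iff_of_nonneg (norm_nonneg _) two_ne_zero).1 h2

/-- The exponential map as a map into the sphere. -/
def expSph {n : ℕ} (x : Sph n)
    (F : Euc n ≃ₗᵢ[ℝ] (Submodule.span ℝ {(x : Euc (n + 1))})ᗮ) (v : Euc n) : Sph n :=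
  ⟨expAmbient x F v, expAmbient_mem x F v⟩

/-- The data in the definition of the Sobolev norm on `S^n`: finitely many geodesic balls on which
normal coordinates are defined (the injectivity radius of `S^n` is `π`), an orthonormal frame at
each center, and a smooth partition of unity on `S^n` subordinate to the balls
(so that the balls cover `S^n`). -/
structure NormalCover (n : ℕ) where
  /-- number of balls -/
  m : ℕ
  /-- centers of the balls -/
  center : Fin m → Sph n
  /-- radii of the balls -/
  radius : Fin m → ℝ
  radius_pos : ∀ a, 0 < radius a
  radius_le : ∀ a, radius a ≤ Real.pi
  /-- orthonormal frames of the tangent spaces at the centers -/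
  frame : ∀ a, Euc n ≃ₗᵢ[ℝ] (Submodule.span ℝ {(center a : Euc (n + 1))})ᗮ
  /-- partition of unity -/
  ρ : SmoothPartitionOfUnity (Fin m) (𝓡 n) (Sph n)
  subordinate : ρ.IsSubordinate (fun a => geoBall (center a) (radius a))

open Classical in
/-- For a tangent vector field `u` on `S^n` (with values `u x ∈ x^⊥ ⊆ ℝ^{n+1}`), the expression of
`ρ_a u` in normal coordinates on the `a`-th ball, extended by zero. For `|v| < π` the differential
of the exponential map at `v` is a linear isomorphism onto the tangent space at `exp v`, so the
inverse below is applied to an element of the range of an injective map. -/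
def NormalCover.localRep {n : ℕ} (𝒰 : NormalCover n) (u : Sph n → Euc (n + 1)) (a : Fin 𝒰.m)
    (v : Euc n) : Euc n :=
  if ‖v‖ < 𝒰.radius a then
    𝒰.ρ a (expSph (𝒰.center a) (𝒰.frame a) v) •
      Function.invFun (fderiv ℝ (expAmbient (𝒰.center a) (𝒰.frame a)) v)
        (u (expSph (𝒰.center a) (𝒰.frame a) v))
  else 0

/-- The `W^{s,p}` norm of a tangent vector field on `S^n`:
`‖u‖² = ∑_a ‖(ρ_a u) in normal coordinates‖²_{W^{s,p}(ℝ^n)}`. -/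
def NormalCover.vfNorm {n : ℕ} (𝒰 : NormalCover n) (s p : ℝ) (u : Sph n → Euc (n + 1)) : ℝ≥0∞ :=
  (∑ a, sobolevNorm s p (𝒰.localRep u a) ^ 2) ^ (1 / 2 : ℝ)

/-! ### Geodesic distance and displacement energy -/

/-- `φ` restricts to a smooth path `[0,1] → Diff(S^n)` from `φ₀` to `φ₁`, i.e. `(t,x) ↦ φ_t(x)` is
smooth on `[0,1] × S^n`. The values of `φ` outside `[0,1]` are irrelevant. -/
def IsSmoothPath {n : ℕ} (φ₀ φ₁ : DiffSph n) (φ : ℝ → DiffSph n) : Prop :=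
  ContMDiffOn (𝓘(ℝ, ℝ).prod (𝓡 n)) (𝓡 n) ∞ (fun q : ℝ × Sph n => φ q.1 q.2)
    (Set.Icc (0 : ℝ) 1 ×ˢ Set.univ) ∧ φ 0 = φ₀ ∧ φ 1 = φ₁

/-- The Eulerian velocity `∂_t φ_t ∘ φ_t⁻¹`, a tangent vector field on `S^n ⊆ ℝ^{n+1}`. -/
def velocity {n : ℕ} (φ : ℝ → DiffSph n) (t : ℝ) (x : Sph n) : Euc (n + 1) :=
  derivWithin (fun τ => (φ τ ((φ t).symm x) : Euc (n + 1))) (Set.Icc (0 : ℝ) 1) t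

/-- The length `∫_0^1 ‖∂_t φ_t ∘ φ_t⁻¹‖_{W^{s,p}} dt` of a path. -/
def NormalCover.pathLength {n : ℕ} (𝒰 : NormalCover n) (s p : ℝ) (φ : ℝ → DiffSph n) : ℝ≥0∞ :=
  ∫⁻ t in Set.Icc (0 : ℝ) 1, 𝒰.vfNorm s p (velocity φ t)

/-- The geodesic distance of the right-invariant `W^{s,p}` metric: the infimum of the lengths of
smooth paths. It is `∞` for diffeomorphisms in different path components. -/
def NormalCover.geoDist {n : ℕ} (𝒰 : NormalCover n) (s p : ℝ) (φ₀ φ₁ : DiffSph n) : ℝ≥0∞ :=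
  ⨅ (φ : ℝ → DiffSph n) (_ : IsSmoothPath φ₀ φ₁ φ), 𝒰.pathLength s p φ

/-- The displacement energy
`E_{s,p}(A) = inf {dist_{s,p}(Id, φ) : φ ∈ Diff(S^n), φ(A) ∩ A = ∅}`. -/
def NormalCover.displacementEnergy {n : ℕ} (𝒰 : NormalCover n) (s p : ℝ) (A : Set (Sph n)) :
    ℝ≥0∞ :=
  ⨅ (φ : DiffSph n) (_ : φ '' A ∩ A = ∅),
    𝒰.geoDist s p (Diffeomorph.refl (𝓡 n) (Sph n) ∞) φ

end SphereDiff

end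

open scoped Manifold ContDiff ENNReal
open MeasureTheory

noncomputable section

namespace SphereDiff

/-! ### Growth lemmas on `(0, 1]` -/

section Growth

variable {W : Type*} [NormedAddCommGroup W] [NormedSpace ℝ W]

/-! The threshold `1 + n / p` is the one above which `W^{s,p}` controls the Lipschitz constant of a
vector field.

Lower bound. If `s > 1 + n / p`, the Lipschitz constant of the velocity is at most `C` times its
norm, so the logarithm of the distance between two trajectories changes by at most `C` times the
length of the path (`exists_log_sub_log_le_pathLength`). A map that displaces the complement of a
`δ`-ball sends this complement into the ball. The complement contains an antipodal pair orthogonal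
to the center, whose chord shrinks from `2` to less than `2δ`; this costs `log 2 - log (2δ) = |log
δ|`. The embedding behind it comes from means over balls of radius `t` around a point. The
`t`-derivative of the mean of order `j` (`rayMean`) is the mean of order `j + 1`. Hölder and scaling
bound these means by `t^{-n/p}`; the Gagliardo seminorm bounds the change of the top one between `t`
and `t/2` by `t^{σ-n/p}`. Integrating down from `t = 1` recovers the value at the point.

Upper bound. A closed `A` missing a point `y` lies in `{height ≤ h₀}` with `h₀ < 1`, the height
being the inner product with `y`. It is enough to push `A` into `{height < -h₀}` and to apply a half
turn exchanging `y` and `-y`. The conformal dilations do this, but in a time that is unbounded as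
`h₀ → 1`, because their generator vanishes linearly at the poles. The polar field divides that
generator by `poleD`, so that for `η → 0` its size at distance `d` from a pole is of order
`d^{1-2γ}`: trajectories cross between the poles in finite time. Its `j`-th derivatives are of order
`d^{1-2γ-j}`, and the ones up to order `k` are in `L^p` for some small `γ > 0` exactly when `k < 1 +
n / p`. The parameter `η` makes the field smooth. The time needed for rapidity `a` is `η^γ a` up to
an error of at most `6`, so time `8` gives rapidity at least `2 η^{-γ}`, as large as desired for
small `η`, while the jet bounds (`exists_jetBound_polarField`) do not depend on `η`. Rotations carry
polar fields to polar fields, so at every time the path has velocity a rotation field minus `8`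
times a polar field, with a uniform Sobolev bound. -/

theorem norm_le_of_hasDerivAt_rpow_bound [CompleteSpace W] {f f' : ℝ → W} {K β t : ℝ}
    (hf : ∀ t, HasDerivAt f (f' t) t) (hf' : Continuous f') (hβ : β ≠ 1)
    (h1 : ‖f 1‖ ≤ K) (hb : ∀ t ∈ Set.Ioc (0 : ℝ) 1, ‖f' t‖ ≤ K * t ^ (-β))
    (ht : t ∈ Set.Ioc (0 : ℝ) 1) :
    ‖f t‖ ≤ K + K * ((1 - t ^ (1 - β)) / (1 - β)) := by
  have hint : ∫ s in t..1, f' s = f 1 - f t :=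
    intervalIntegral.integral_eq_sub_of_hasDerivAt (fun s _ => hf s) (hf'.intervalIntegrable _ _)
  have h0 : (0 : ℝ) ∉ Set.uIcc t 1 := by
    rw [Set.uIcc_of_le ht.2]; exact fun h => absurd h.1 (not_le.2 ht.1)
  have hle : ‖∫ s in t..1, f' s‖ ≤ ∫ s in t..1, K * s ^ (-β) := by
    apply intervalIntegral.norm_integral_le_of_norm_le ht.2
    · exact Filter.Eventually.of_forall fun s hs => hb s ⟨ht.1.trans hs.1, hs.2⟩
    · exact (intervalIntegral.intervalIntegrable_rpow (Or.inr h0)).const_mul K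
  rw [intervalIntegral.integral_const_mul,
    integral_rpow (Or.inr ⟨by intro h; apply hβ; linarith, h0⟩), hint,
    show -β + 1 = 1 - β by ring, Real.one_rpow] at hle
  calc ‖f t‖ = ‖f 1 - (f 1 - f t)‖ := by rw [sub_sub_cancel]
    _ ≤ ‖f 1‖ + ‖f 1 - f t‖ := norm_sub_le _ _
    _ ≤ _ := add_le_add h1 hle

/-- If the `m`-th derivative is `O(t^{-β})` with `β < m`, the function is controlled at `0`. -/
theorem exists_norm_zero_le_of_iterated_deriv [CompleteSpace W] (m : ℕ) :
    ∀ β : ℝ, (β < m ∨ β = 0) → ∃ C : ℝ, 0 < C ∧ ∀ (M : ℕ → ℝ → W) (K : ℝ), 0 ≤ K →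
      (∀ j t, HasDerivAt (M j) (M (j + 1) t) t) → (∀ j < m, ‖M j 1‖ ≤ K) →
      (∀ t ∈ Set.Ioc (0 : ℝ) 1, ‖M m t‖ ≤ K * t ^ (-β)) → ‖M 0 0‖ ≤ C * K := by
  -- The alternative `β = 0` is for the induction: one integration of an exponent below `1` gives a
  -- bounded function, and if no integrations remain then `0 < m` is not available.
  induction m with
  | zero =>
    intro β hβ
    refine ⟨1, one_pos, fun M K hK hM _ hb => ?_⟩
    have hβ0 : β ≤ 0 := by
      rcases hβ with h | h
      · exact_mod_cast h.le
      · exact h.le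
    have hc : Filter.Tendsto (fun t => ‖M 0 t‖) (nhdsWithin 0 (Set.Ioi 0)) (nhds ‖M 0 0‖) :=
      ((hM 0 0).continuousAt.norm.tendsto).mono_left nhdsWithin_le_nhds
    rw [one_mul]
    refine le_of_tendsto hc ?_
    filter_upwards [Ioc_mem_nhdsGT (zero_lt_one (α := ℝ))] with t ht
    refine (hb t ht).trans (mul_le_of_le_one_right hK ?_)
    exact Real.rpow_le_one ht.1.le ht.2 (by linarith)
  | succ m ih =>
    intro β hβ
    have hβ1 : β < m + 1 := by
      rcases hβ with h | h
      · exact_mod_cast h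
      · rw [h]; positivity
    by_cases h1 : β < 1
    · obtain ⟨C, hC, H⟩ := ih 0 (Or.inr rfl)
      have h1' : 0 < 1 - β := by linarith
      refine ⟨C * (1 + 1 / (1 - β)), by positivity, fun M K hK hM hj hb => ?_⟩
      rw [mul_assoc]
      have hKK : K ≤ (1 + 1 / (1 - β)) * K := by
        have : 0 ≤ 1 / (1 - β) * K := by positivity
        linarith
      refine H M _ (by positivity) hM (fun j hj' => (hj j (by omega)).trans hKK) fun t ht => ?_
      have := norm_le_of_hasDerivAt_rpow_bound (hM m)
        (continuous_iff_continuousAt.2 fun t => (hM (m + 1) t).continuousAt) h1.ne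
        (hj m (by omega)) hb ht
      refine this.trans ?_
      rw [neg_zero, Real.rpow_zero, mul_one, add_mul, one_mul, mul_comm (1 / (1 - β))]
      gcongr
      linarith [Real.rpow_nonneg ht.1.le (1 - β)]
    -- The exponent is enlarged to the midpoint of `β` and `m + 1`. This avoids the logarithm that
    -- arises at exponent `1`, and `b - 1 < m` keeps the induction going.
    · set b := (β + (m + 1)) / 2 with hb
      have hb1 : 1 < b := by linarith
      have hbm : b - 1 < m := by linarith
      have hbβ : β ≤ b := by linarith
      obtain ⟨C, hC, H⟩ := ih (b - 1) (Or.inl hbm)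
      have h1' : 0 < b - 1 := by linarith
      refine ⟨C * (1 + 1 / (b - 1)), by positivity, fun M K hK hM hj hb => ?_⟩
      rw [mul_assoc]
      have hKK : K ≤ (1 + 1 / (b - 1)) * K := by
        have : 0 ≤ 1 / (b - 1) * K := by positivity
        linarith
      refine H M _ (by positivity) hM (fun j hj' => (hj j (by omega)).trans hKK) fun t ht => ?_
      have := norm_le_of_hasDerivAt_rpow_bound (β := b) (hM m)
        (continuous_iff_continuousAt.2 fun t => (hM (m + 1) t).continuousAt) hb1.ne'
        (hj m (by omega)) (fun t ht => (hb t ht).trans (by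
          gcongr K * ?_
          exact Real.rpow_le_rpow_of_exponent_ge ht.1 ht.2 (by linarith))) ht
      refine this.trans ?_
      have e : (1 - t ^ (1 - b)) / (1 - b) = (t ^ (1 - b) - 1) / (b - 1) := by
        rw [← neg_div_neg_eq]; ring_nf
      rw [e, show -(b - 1) = 1 - b by ring]
      have h2 : 1 ≤ t ^ (1 - b) := Real.one_le_rpow_of_pos_of_le_one_of_nonpos ht.1 ht.2 (by linarith)
      calc K + K * ((t ^ (1 - b) - 1) / (b - 1))
          ≤ K * t ^ (1 - b) + K * (t ^ (1 - b) / (b - 1)) := by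
            gcongr
            · exact le_mul_of_one_le_right hK h2
            · linarith
        _ = _ := by field_simp

/-- The increments along `1, 1/2, 1/4, …` grow geometrically, so their sum is comparable to the last
one. The constant is chosen to satisfy `C + 1 ≤ C * 2 ^ β`, which is the induction step. -/
theorem le_rpow_of_dyadic_step {g : ℝ → ℝ} {K β : ℝ} (hK : 0 ≤ K) (hβ : 0 < β)
    (h1 : ∀ t ∈ Set.Icc (1 / 2 : ℝ) 1, g t ≤ K)
    (hs : ∀ t ∈ Set.Ioc (0 : ℝ) 1, g (t / 2) ≤ g t + K * t ^ (-β)) {t : ℝ}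
    (ht : t ∈ Set.Ioc (0 : ℝ) 1) : g t ≤ (1 + 1 / (2 ^ β - 1)) * K * t ^ (-β) := by
  have h2 : (1 : ℝ) < 2 ^ β := Real.one_lt_rpow (by norm_num) hβ
  have h3 : (0 : ℝ) < 2 ^ β - 1 := by linarith
  set C := 1 + 1 / ((2 : ℝ) ^ β - 1) with hC
  have hCpos : 1 ≤ C := by
    have : 0 < 1 / ((2 : ℝ) ^ β - 1) := by positivity
    linarith
  have hC2 : C + 1 ≤ C * 2 ^ β := by
    have : C * (2 ^ β - 1) = 2 ^ β - 1 + 1 := by rw [hC]; field_simp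
    nlinarith
  have key : ∀ i : ℕ, ∀ t : ℝ, (1 / 2 : ℝ) ^ (i + 1) ≤ t → t ≤ 1 → g t ≤ C * K * t ^ (-β) := by
    have base : ∀ t : ℝ, (1 / 2 : ℝ) ≤ t → t ≤ 1 → g t ≤ C * K * t ^ (-β) := by
      intro t ht ht1
      have : 1 ≤ t ^ (-β) :=
        Real.one_le_rpow_of_pos_of_le_one_of_nonpos (by linarith) ht1 (by linarith)
      calc g t ≤ K := h1 t ⟨ht, ht1⟩
        _ ≤ C * K := le_mul_of_one_le_left hK hCpos
        _ ≤ _ := le_mul_of_one_le_right (by positivity) this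
    intro i
    induction i with
    | zero => intro t ht ht1; exact base t (by simpa using ht) ht1
    | succ i ih =>
      intro t ht ht1
      by_cases h : 1 / 2 ≤ t
      · exact base t h ht1
      · have htp : 0 < t := lt_of_lt_of_le (by positivity) ht
        have h' := ih (2 * t) (by rw [pow_succ] at ht; linarith) (by linarith)
        have h'' := hs (2 * t) ⟨by linarith, by linarith⟩
        rw [mul_div_cancel_left₀ _ (two_ne_zero)] at h''
        have e : (2 * t) ^ (-β) * 2 ^ β = t ^ (-β) := by
          rw [Real.mul_rpow (by norm_num) htp.le, mul_right_comm, ← Real.rpow_add (by norm_num)]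
          simp
        have hp : 0 ≤ (2 * t) ^ (-β) := by positivity
        calc g t ≤ C * K * (2 * t) ^ (-β) + K * (2 * t) ^ (-β) := by linarith
          _ = (C + 1) * (K * (2 * t) ^ (-β)) := by ring
          _ ≤ (C * 2 ^ β) * (K * (2 * t) ^ (-β)) := by gcongr
          _ = C * K * ((2 * t) ^ (-β) * 2 ^ β) := by ring
          _ = _ := by rw [e]
  obtain ⟨i, hi⟩ := exists_pow_lt_of_lt_one ht.1 (show (1 / 2 : ℝ) < 1 by norm_num)
  exact key i t ((pow_le_pow_of_le_one (by norm_num) (by norm_num) (Nat.le_succ i)).trans hi.le) ht.2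

/-- With a positive power of `t` the increments form a convergent geometric series of ratio
`(1/2)^β`, hence the bound is uniform in `i`. -/
theorem le_of_dyadic_step {g : ℝ → ℝ} {K β : ℝ} (hK : 0 ≤ K) (hβ : 0 < β) (h1 : g 1 ≤ K)
    (hs : ∀ t ∈ Set.Ioc (0 : ℝ) 1, g (t / 2) ≤ g t + K * t ^ β) (i : ℕ) :
    g ((1 / 2) ^ i) ≤ (1 + 1 / (1 - (1 / 2) ^ β)) * K := by
  set r : ℝ := (1 / 2) ^ β with hr
  have hr0 : 0 < r := by positivity
  have hr1 : r < 1 := Real.rpow_lt_one (by norm_num) (by norm_num) hβ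
  have h1r : 0 < 1 - r := by linarith
  have key : g ((1 / 2) ^ i) ≤ K + K * ((1 - r ^ i) / (1 - r)) := by
    induction i with
    | zero => simpa using h1
    | succ i ih =>
      have h := hs ((1 / 2) ^ i) ⟨by positivity, pow_le_one₀ (by norm_num) (by norm_num)⟩
      have e : ((1 / 2 : ℝ) ^ i) ^ β = r ^ i := by
        rw [hr, ← Real.rpow_natCast, ← Real.rpow_mul (by norm_num), mul_comm, Real.rpow_mul (by norm_num),
          Real.rpow_natCast]
      rw [e] at h
      rw [pow_succ, show (1 / 2 : ℝ) ^ i * (1 / 2) = (1 / 2) ^ i / 2 by ring]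
      refine h.trans ?_
      have : (1 - r ^ (i + 1)) / (1 - r) = (1 - r ^ i) / (1 - r) + r ^ i := by
        field_simp; ring
      rw [this]; linarith
  refine key.trans ?_
  rw [add_mul, one_mul, mul_comm (1 / (1 - r))]
  gcongr
  linarith [pow_pos hr0 i]

end Growth

/-! ### Scaling and Hölder inequalities -/

section Scaling

variable {n : ℕ}

theorem lintegral_comp_add_smul (x : Euc n) {t : ℝ} (ht : 0 < t) (F : Euc n → ℝ≥0∞) :
    ∫⁻ z, F (x + t • z) = ENNReal.ofReal (t ^ (-(n : ℝ))) * ∫⁻ y, F y := by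
  have e : MeasurableEmbedding (fun z : Euc n => t • z) :=
    (Homeomorph.smulOfNeZero t ht.ne').measurableEmbedding
  have h := e.lintegral_map (μ := volume) (fun y => F (x + y))
  rw [Measure.map_addHaar_smul volume ht.ne', lintegral_smul_measure,
    lintegral_add_left_eq_self] at h
  rw [← h, smul_eq_mul]
  congr 2
  rw [abs_of_pos (by positivity), finrank_euclideanSpace_fin, Real.rpow_neg ht.le, Real.rpow_natCast]

theorem setLIntegral_comp_add_smul_le (x : Euc n) {t : ℝ} (ht : 0 < t) (s : Set (Euc n))
    (F : Euc n → ℝ≥0∞) :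
    ∫⁻ z in s, F (x + t • z) ≤ ENNReal.ofReal (t ^ (-(n : ℝ))) * ∫⁻ y, F y :=
  (setLIntegral_le_lintegral _ _).trans (lintegral_comp_add_smul x ht F).le

theorem setLIntegral_le_rpow_mul {p : ℝ} (hp : 1 ≤ p) (s : Set (Euc n)) {f : Euc n → ℝ≥0∞}
    (hf : Measurable f) :
    ∫⁻ z in s, f z ≤ (∫⁻ z in s, f z ^ p) ^ (1 / p) * volume s ^ (1 - 1 / p) := by
  rcases hp.eq_or_lt with rfl | hp1
  · simp
  · have hpq : p.HolderConjugate (p.conjExponent) := Real.HolderConjugate.conjExponent hp1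
    have h := ENNReal.lintegral_mul_le_Lp_mul_Lq (volume.restrict s) hpq hf.aemeasurable
      (g := fun _ => 1) aemeasurable_const
    simp only [Pi.mul_apply, mul_one, ENNReal.one_rpow, lintegral_const, one_mul,
      Measure.restrict_apply_univ] at h
    rwa [one_div (p.conjExponent), ← hpq.one_sub_inv, ← one_div] at h

end Scaling

/-! ### The Sobolev embedding `W^{s,p} ⊆ C^1` for `s > 1 + n / p` -/

section Sobolev

variable {n : ℕ} {W : Type*} [NormedAddCommGroup W] [NormedSpace ℝ W]

/-- The `j`-th derivative in `t` of the integral of `f (x + t z)` over the unit ball in `z`. -/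
def rayMean (f : Euc n → W) (x : Euc n) (j : ℕ) (t : ℝ) : W :=
  ∫ z in Metric.ball (0 : Euc n) 1, iteratedFDeriv ℝ j f (x + t • z) (fun _ => z)

theorem continuous_iteratedFDeriv_ray {f : Euc n → W} (hf : ContDiff ℝ ∞ f) (x : Euc n) (j : ℕ)
    (t : ℝ) : Continuous fun z : Euc n => iteratedFDeriv ℝ j f (x + t • z) (fun _ => z) := by
  have h1 : Continuous fun z : Euc n => iteratedFDeriv ℝ j f (x + t • z) :=
    (hf.continuous_iteratedFDeriv (by exact_mod_cast le_top)).comp (by fun_prop)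
  exact h1.eval (continuous_pi fun _ => continuous_id)

theorem norm_apply_const_le {j : ℕ} {z : Euc n}
    (hz : z ∈ Metric.ball (0 : Euc n) 1) (T : ContinuousMultilinearMap ℝ (fun _ : Fin j => Euc n) W) :
    ‖T (fun _ => z)‖ ≤ ‖T‖ := by
  refine (T.le_opNorm _).trans (mul_le_of_le_one_right (norm_nonneg _) ?_)
  rw [Finset.prod_const]
  exact pow_le_one₀ (norm_nonneg _) (mem_ball_zero_iff.1 hz).le

theorem integrableOn_iteratedFDeriv_ray {f : Euc n → W} (hf : ContDiff ℝ ∞ f) (x : Euc n) (j : ℕ)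
    (t : ℝ) : IntegrableOn (fun z : Euc n => iteratedFDeriv ℝ j f (x + t • z) (fun _ => z))
      (Metric.ball 0 1) :=
  ((continuous_iteratedFDeriv_ray hf x j t).continuousOn.integrableOn_compact
    (isCompact_closedBall 0 1)).mono_set Metric.ball_subset_closedBall

/-- Differentiating along the ray inserts one more copy of its direction `z`. On a unit interval
around `t` the integrand is dominated by the supremum of the next derivative over a ball of radius
`|t| + 1`. -/
theorem hasDerivAt_rayMean {f : Euc n → W} (hf : ContDiff ℝ ∞ f) (x : Euc n) (j : ℕ) (t : ℝ) :
    HasDerivAt (rayMean f x j) (rayMean f x (j + 1) t) t := by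
  have hcont : Continuous (iteratedFDeriv ℝ (j + 1) f) :=
    hf.continuous_iteratedFDeriv (by exact_mod_cast le_top)
  obtain ⟨C, hC⟩ := (isCompact_closedBall x (|t| + 1)).exists_bound_of_continuousOn
    hcont.continuousOn
  refine (hasDerivAt_integral_of_dominated_loc_of_deriv_le (μ := volume.restrict (Metric.ball 0 1))
    (F := fun t z => iteratedFDeriv ℝ j f (x + t • z) (fun _ => z))
    (F' := fun t z => iteratedFDeriv ℝ (j + 1) f (x + t • z) (fun _ => z))
    (bound := fun _ => C) (Metric.ball_mem_nhds t one_pos) ?_ ?_ ?_ ?_ ?_ ?_).2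
  · exact Filter.Eventually.of_forall fun s =>
      (continuous_iteratedFDeriv_ray hf x j s).aestronglyMeasurable
  · exact integrableOn_iteratedFDeriv_ray hf x j t
  · exact (continuous_iteratedFDeriv_ray hf x (j + 1) t).aestronglyMeasurable
  · refine (ae_restrict_iff' measurableSet_ball).2 (Filter.Eventually.of_forall fun z hz s hs => ?_)
    refine (norm_apply_const_le hz _).trans (hC _ ?_)
    rw [mem_closedBall_iff_norm, add_sub_cancel_left, norm_smul]
    have h1 : ‖s‖ ≤ |t| + 1 := by
      have := norm_sub_norm_le s t
      have h3 := (mem_ball_iff_norm.1 hs).le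
      rw [Real.norm_eq_abs t] at this
      linarith
    calc ‖s‖ * ‖z‖ ≤ (|t| + 1) * 1 :=
          mul_le_mul h1 (mem_ball_zero_iff.1 hz).le (norm_nonneg _) (by positivity)
      _ = _ := mul_one _
  · exact integrableOn_const (measure_ball_lt_top.ne)
  · refine Filter.Eventually.of_forall fun z s _ => ?_
    have hd : HasFDerivAt (iteratedFDeriv ℝ j f) (fderiv ℝ (iteratedFDeriv ℝ j f) (x + s • z))
        (x + s • z) :=
      ((hf.differentiable_iteratedFDeriv (m := j) (by exact_mod_cast ENat.natCast_lt_top j)) _).hasFDerivAt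
    have hl : HasDerivAt (fun s : ℝ => x + s • z) z s := by
      simpa using ((hasDerivAt_id s).smul_const z).const_add x
    have h := hd.comp_hasDerivAt s hl
    have h2 := ((ContinuousMultilinearMap.apply ℝ (fun _ : Fin j => Euc n) W
      (fun _ => z)).hasFDerivAt).comp_hasDerivAt s h
    exact h2

theorem rayMean_zero_zero (f : Euc n → W) (x : Euc n) [CompleteSpace W] :
    rayMean f x 0 0 = (volume.real (Metric.ball (0 : Euc n) 1)) • f x := by
  simp [rayMean]

theorem enorm_rayMean_le {f : Euc n → W} (x : Euc n) (j : ℕ)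
    (t : ℝ) : ‖rayMean f x j t‖ₑ ≤
      ∫⁻ z in Metric.ball (0 : Euc n) 1, ‖iteratedFDeriv ℝ j f (x + t • z)‖ₑ := by
  refine (enorm_integral_le_lintegral_enorm _).trans ?_
  refine setLIntegral_mono' measurableSet_ball fun z hz => ?_
  exact enorm_le_iff_norm_le.2 (norm_apply_const_le hz _)

/-- A constant bounding powers of the volume of the unit ball. -/
theorem exists_ball_volume_rpow_le (n : ℕ) (p : ℝ) (hp : 1 ≤ p) : ∃ V : ℝ, 0 < V ∧
    volume (Metric.ball (0 : Euc n) 1) ^ (1 - 1 / p) = ENNReal.ofReal V := by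
  have h0 : volume (Metric.ball (0 : Euc n) 1) ≠ 0 := (Metric.measure_ball_pos _ _ one_pos).ne'
  have h1 : volume (Metric.ball (0 : Euc n) 1) ≠ ⊤ := measure_ball_lt_top.ne
  have hexp : 0 ≤ 1 - 1 / p := by
    rw [sub_nonneg, div_le_one (by linarith)]; exact hp
  refine ⟨(volume (Metric.ball (0 : Euc n) 1) ^ (1 - 1 / p)).toReal, ?_, ?_⟩
  · exact ENNReal.toReal_pos (by simp [ENNReal.rpow_eq_zero_iff, h0, h1])
      (ENNReal.rpow_ne_top_of_nonneg hexp h1)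
  · rw [ENNReal.ofReal_toReal (ENNReal.rpow_ne_top_of_nonneg hexp h1)]

/-- Hölder on the unit ball costs a power `V` of its volume; the substitution `y = x + t z` has
Jacobian `t^{-n}`, whose `p`-th root is the factor `t^{-n/p}`. -/
theorem exists_norm_rayMean_le (n : ℕ) {p : ℝ} (hp : 1 ≤ p) : ∃ V : ℝ, 0 < V ∧
    ∀ {W : Type} [NormedAddCommGroup W] [NormedSpace ℝ W] {f : Euc n → W}, ContDiff ℝ ∞ f →
    ∀ (x : Euc n) (j : ℕ) (K : ℝ), 0 ≤ K →
      eLpNorm (iteratedFDeriv ℝ j f) (ENNReal.ofReal p) volume ≤ ENNReal.ofReal K →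
      ∀ t, 0 < t → ‖rayMean f x j t‖ ≤ V * K * t ^ (-(n / p : ℝ)) := by
  obtain ⟨V, hV, hVe⟩ := exists_ball_volume_rpow_le n p hp
  refine ⟨V, hV, fun {W} _ _ {f} hf x j K hK hle t ht => ?_⟩
  have hp0 : 0 < p := by linarith
  have hc : Continuous (iteratedFDeriv ℝ j f) :=
    hf.continuous_iteratedFDeriv (by exact_mod_cast le_top)
  rw [eLpNorm_eq_lintegral_rpow_enorm_toReal (by simpa using hp0) ENNReal.ofReal_ne_top,
    ENNReal.toReal_ofReal hp0.le] at hle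
  have h : ‖rayMean f x j t‖ₑ ≤ ENNReal.ofReal (V * K * t ^ (-(n / p : ℝ))) := by
    calc ‖rayMean f x j t‖ₑ ≤ ∫⁻ z in Metric.ball (0 : Euc n) 1,
          ‖iteratedFDeriv ℝ j f (x + t • z)‖ₑ := enorm_rayMean_le x j t
      _ ≤ (∫⁻ z in Metric.ball (0 : Euc n) 1, ‖iteratedFDeriv ℝ j f (x + t • z)‖ₑ ^ p) ^ (1 / p) *
          volume (Metric.ball (0 : Euc n) 1) ^ (1 - 1 / p) :=
        setLIntegral_le_rpow_mul hp _ (by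
          exact (hc.comp (by fun_prop : Continuous fun z : Euc n => x + t • z)).enorm.measurable)
      _ ≤ (ENNReal.ofReal (t ^ (-(n : ℝ))) * ∫⁻ y, ‖iteratedFDeriv ℝ j f y‖ₑ ^ p) ^ (1 / p) *
          ENNReal.ofReal V := by
        rw [hVe]
        gcongr
        exact setLIntegral_comp_add_smul_le x ht _ (fun y => ‖iteratedFDeriv ℝ j f y‖ₑ ^ p)
      _ = ENNReal.ofReal (t ^ (-(n / p : ℝ))) * (∫⁻ y, ‖iteratedFDeriv ℝ j f y‖ₑ ^ p) ^ (1 / p) *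
          ENNReal.ofReal V := by
        rw [ENNReal.mul_rpow_of_nonneg _ _ (by positivity),
          ENNReal.ofReal_rpow_of_pos (by positivity), ← Real.rpow_mul ht.le]
        congr 4; ring
      _ ≤ ENNReal.ofReal (t ^ (-(n / p : ℝ))) * ENNReal.ofReal K * ENNReal.ofReal V := by gcongr
      _ = _ := by
        rw [← ENNReal.ofReal_mul (by positivity), ← ENNReal.ofReal_mul (by positivity)]
        congr 1; ring
  rwa [← ofReal_norm, ENNReal.ofReal_le_ofReal_iff (by positivity)] at h

theorem ofReal_mul_rpow_mul_mul {p c₁ c₂ c₃ : ℝ} (hp : 0 < p) (h₁ : 0 < c₁) (h₂ : 0 < c₂)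
    (h₃ : 0 < c₃) (X v : ℝ≥0∞) :
    (ENNReal.ofReal c₁ * (ENNReal.ofReal c₂ * (ENNReal.ofReal c₃ * X))) ^ (1 / p) * v * v =
      ENNReal.ofReal ((c₁ * c₂ * c₃) ^ (1 / p)) * v ^ 2 * X ^ (1 / p) := by
  rw [← mul_assoc, ← mul_assoc, ENNReal.mul_rpow_of_nonneg _ _ (by positivity),
    ← ENNReal.ofReal_mul h₁.le, ← ENNReal.ofReal_mul (by positivity),
    ENNReal.ofReal_rpow_of_pos (by positivity)]
  ring

/-- Differences of a function over two concentric balls are controlled by its Gagliardo seminorm. -/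
theorem lintegral_lintegral_enorm_sub_le {W : Type*} [NormedAddCommGroup W] {p σ : ℝ} (hp : 1 ≤ p) (hσ : 0 < σ) {G : Euc n → W}
    (hG : Continuous G) (x : Euc n) {a b : ℝ} (ha : 0 < a) (hb : 0 < b) :
    ∫⁻ z in Metric.ball (0 : Euc n) 1, ∫⁻ w in Metric.ball (0 : Euc n) 1,
      ‖G (x + a • z) - G (x + b • w)‖ₑ ≤
    ENNReal.ofReal ((a * b) ^ (-(n / p : ℝ)) * (a + b) ^ ((n + σ * p) / p)) *
      (volume (Metric.ball (0 : Euc n) 1) ^ (1 - 1 / p)) ^ 2 *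
      (∫⁻ x : Euc n, ∫⁻ y : Euc n, ‖G x - G y‖ₑ ^ p / ‖x - y‖ₑ ^ ((n : ℝ) + σ * p)) ^ (1 / p) := by
  have hp0 : 0 < p := by linarith
  have hs0 : 0 < (n : ℝ) + σ * p := by positivity
  set B := Metric.ball (0 : Euc n) 1
  have hB : MeasurableSet B := measurableSet_ball
  set v := volume B ^ (1 - 1 / p)
  set k : Euc n → Euc n → ℝ≥0∞ := fun x y => ‖G x - G y‖ₑ ^ p / ‖x - y‖ₑ ^ ((n : ℝ) + σ * p)
  have hm : Measurable fun q : Euc n × Euc n => ‖G (x + a • q.1) - G (x + b • q.2)‖ₑ :=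
    ((hG.comp (by fun_prop)).sub (hG.comp (by fun_prop))).enorm.measurable
  -- The two points are at distance at most `a + b`, so inserting the Gagliardo kernel costs `(a +
  -- b)^{n+σp}`; if they coincide the left side vanishes.
  have hpt : ∀ z ∈ B, ∀ w ∈ B, ‖G (x + a • z) - G (x + b • w)‖ₑ ^ p ≤
      ENNReal.ofReal ((a + b) ^ ((n : ℝ) + σ * p)) * k (x + a • z) (x + b • w) := by
    intro z hz w hw
    by_cases h0 : x + a • z = x + b • w
    · rw [h0]; simp [hp0]
    have hd : ‖(x + a • z) - (x + b • w)‖ ≤ a + b := by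
      rw [add_sub_add_left_eq_sub]
      refine (norm_sub_le _ _).trans ?_
      rw [norm_smul, norm_smul, Real.norm_of_nonneg ha.le, Real.norm_of_nonneg hb.le]
      exact add_le_add (mul_le_of_le_one_right ha.le (mem_ball_zero_iff.1 hz).le)
        (mul_le_of_le_one_right hb.le (mem_ball_zero_iff.1 hw).le)
    have hpos : 0 < ‖(x + a • z) - (x + b • w)‖ := norm_pos_iff.2 (sub_ne_zero.2 h0)
    simp only [k]
    rw [← ofReal_norm ((x + a • z) - (x + b • w)), ENNReal.ofReal_rpow_of_pos hpos,
      ← ENNReal.mul_comm_div, ← ENNReal.ofReal_div_of_pos (by positivity)]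
    suffices h1 : (1 : ℝ≥0∞) ≤ ENNReal.ofReal ((a + b) ^ ((n : ℝ) + σ * p) /
        ‖(x + a • z) - (x + b • w)‖ ^ ((n : ℝ) + σ * p)) from by
      simpa using mul_le_mul_left h1 _
    rw [ENNReal.one_le_ofReal, one_le_div (by positivity)]
    exact Real.rpow_le_rpow hpos.le hd hs0.le
  have hin : ∀ z, ∫⁻ w in B, ‖G (x + a • z) - G (x + b • w)‖ₑ ≤
      (∫⁻ w in B, ‖G (x + a • z) - G (x + b • w)‖ₑ ^ p) ^ (1 / p) * v := fun z =>
    setLIntegral_le_rpow_mul hp _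
      ((hG.comp (by fun_prop)).sub (hG.comp (by fun_prop))).enorm.measurable
  calc ∫⁻ z in B, ∫⁻ w in B, ‖G (x + a • z) - G (x + b • w)‖ₑ
      ≤ ∫⁻ z in B, (∫⁻ w in B, ‖G (x + a • z) - G (x + b • w)‖ₑ ^ p) ^ (1 / p) * v :=
        lintegral_mono hin
    _ ≤ (∫⁻ z in B, ((∫⁻ w in B, ‖G (x + a • z) - G (x + b • w)‖ₑ ^ p) ^ (1 / p)) ^ p) ^ (1 / p) *
          v * v := by
        have hmm : Measurable fun z =>
            (∫⁻ w in B, ‖G (x + a • z) - G (x + b • w)‖ₑ ^ p) ^ (1 / p) :=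
          (Measurable.lintegral_prod_right' (hm.pow_const p)).pow_const _
        rw [lintegral_mul_const _ hmm]
        gcongr
        exact setLIntegral_le_rpow_mul hp _ hmm
    _ = (∫⁻ z in B, ∫⁻ w in B, ‖G (x + a • z) - G (x + b • w)‖ₑ ^ p) ^ (1 / p) * v * v := by
        simp_rw [← ENNReal.rpow_mul, one_div, inv_mul_cancel₀ hp0.ne', ENNReal.rpow_one]
    _ ≤ (∫⁻ z in B, ENNReal.ofReal ((a + b) ^ ((n : ℝ) + σ * p)) * (ENNReal.ofReal (b ^ (-(n : ℝ))) *
          ∫⁻ y, k (x + a • z) y)) ^ (1 / p) * v * v := by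
        gcongr ?_ ^ (1 / p) * v * v
        refine setLIntegral_mono' hB fun z hz => ?_
        have h1 : ∫⁻ w in B, ‖G (x + a • z) - G (x + b • w)‖ₑ ^ p ≤
            ∫⁻ w in B, ENNReal.ofReal ((a + b) ^ ((n : ℝ) + σ * p)) * k (x + a • z) (x + b • w) :=
          setLIntegral_mono' hB (hpt z hz)
        refine h1.trans ?_
        rw [lintegral_const_mul' _ _ ENNReal.ofReal_ne_top]
        gcongr
        exact setLIntegral_comp_add_smul_le x hb _ (fun y => k (x + a • z) y)
    _ ≤ (ENNReal.ofReal ((a + b) ^ ((n : ℝ) + σ * p)) * (ENNReal.ofReal (b ^ (-(n : ℝ))) *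
          (ENNReal.ofReal (a ^ (-(n : ℝ))) * ∫⁻ x, ∫⁻ y, k x y))) ^ (1 / p) * v * v := by
        rw [lintegral_const_mul' _ _ ENNReal.ofReal_ne_top,
          lintegral_const_mul' _ _ ENNReal.ofReal_ne_top]
        gcongr
        exact setLIntegral_comp_add_smul_le x ha _ (fun z => ∫⁻ y, k z y)
    _ = _ := by
        rw [ofReal_mul_rpow_mul_mul hp0 (by positivity) (by positivity) (by positivity)]
        congr 3
        rw [Real.mul_rpow (by positivity) (by positivity), Real.mul_rpow (by positivity) (by positivity),
          Real.mul_rpow ha.le hb.le, ← Real.rpow_mul (by positivity),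
          ← Real.rpow_mul (by positivity), ← Real.rpow_mul (by positivity),
          show -(n : ℝ) * (1 / p) = -(n / p) by ring,
          show ((n : ℝ) + σ * p) * (1 / p) = (n + σ * p) / p by ring]
        ring

end Sobolev

/-! ### Fractional increments of the means and the embedding theorems -/

section Sobolev


/-- The values at `x + (t/2) z` and `x + t z` are compared through a third point `x + t w`, with `w`
averaged over the unit ball independently of `z`. Each comparison is then a double integral
controlled by the Gagliardo seminorm. -/
theorem exists_norm_rayMean_half_le (n : ℕ) {p σ : ℝ} (hp : 1 ≤ p) (hσ : 0 < σ) :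
    ∃ C : ℝ, 0 < C ∧ ∀ {W : Type} [NormedAddCommGroup W] [NormedSpace ℝ W] {f : Euc n → W},
      ContDiff ℝ ∞ f → ∀ (x : Euc n) (m : ℕ) (K : ℝ), 0 ≤ K →
      (∫⁻ x : Euc n, ∫⁻ y : Euc n, ‖iteratedFDeriv ℝ m f x - iteratedFDeriv ℝ m f y‖ₑ ^ p /
        ‖x - y‖ₑ ^ ((n : ℝ) + σ * p)) ^ (1 / p) ≤ ENNReal.ofReal K →
      ∀ t, 0 < t → ‖rayMean f x m (t / 2)‖ ≤ ‖rayMean f x m t‖ + C * K * t ^ (σ - n / p) := by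
  obtain ⟨V, hV, hVe⟩ := exists_ball_volume_rpow_le n p hp
  have hp0 : 0 < p := by linarith
  set B := Metric.ball (0 : Euc n) 1 with hBdef
  have hB : MeasurableSet B := measurableSet_ball
  have hvol0 : 0 < volume.real B :=
    ENNReal.toReal_pos (Metric.measure_ball_pos _ _ one_pos).ne' measure_ball_lt_top.ne
  have hvol : volume B = ENNReal.ofReal (volume.real B) :=
    (ENNReal.ofReal_toReal measure_ball_lt_top.ne).symm
  set c : ℝ := 2 ^ (n / p : ℝ) * 2 ^ ((n + σ * p) / p) with hc
  have hc0 : 0 < c := by positivity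
  refine ⟨2 * (c * V ^ 2) / volume.real B, by positivity,
    fun {W} _ _ {f} hf x m K hK hle t ht => ?_⟩
  set G := iteratedFDeriv ℝ m f with hGdef
  have hG : Continuous G := hf.continuous_iteratedFDeriv (by exact_mod_cast le_top)
  have hI : ∀ a : ℝ, t / 2 ≤ a → a ≤ t → ∫⁻ z in B, ∫⁻ w in B, ‖G (x + a • z) - G (x + t • w)‖ₑ ≤
      ENNReal.ofReal (c * V ^ 2 * K * t ^ (σ - n / p)) := by
    intro a ha hat
    have ha0 : 0 < a := by linarith
    refine (lintegral_lintegral_enorm_sub_le hp hσ hG x ha0 ht).trans ?_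
    rw [hVe, ← ENNReal.ofReal_pow hV.le]
    have h1 : (a * t) ^ (-(n / p : ℝ)) * (a + t) ^ ((n + σ * p) / p) ≤ c * t ^ (σ - n / p) := by
      have e1 : (a * t) ^ (-(n / p : ℝ)) ≤ (t * t / 2) ^ (-(n / p : ℝ)) := by
        apply Real.rpow_le_rpow_of_nonpos (by positivity) (by nlinarith)
        simp only [Left.neg_nonpos_iff]; positivity
      have e2 : (a + t) ^ ((n + σ * p) / p) ≤ (2 * t) ^ ((n + σ * p) / p) :=
        Real.rpow_le_rpow (by positivity) (by linarith) (by positivity)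
      refine (mul_le_mul e1 e2 (by positivity) (by positivity)).trans_eq ?_
      rw [Real.div_rpow (by positivity) (by norm_num), Real.mul_rpow ht.le ht.le,
        Real.mul_rpow (by norm_num) ht.le, hc, Real.rpow_neg (by norm_num : (0 : ℝ) ≤ 2), div_inv_eq_mul,
        show σ - n / p = -(n / p) + -(n / p) + (n + σ * p) / p by field_simp; ring,
        Real.rpow_add ht, Real.rpow_add ht]
      ring
    calc _ ≤ ENNReal.ofReal (c * t ^ (σ - n / p)) * ENNReal.ofReal (V ^ 2) * ENNReal.ofReal K := by
          gcongr
      _ = _ := by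
          rw [← ENNReal.ofReal_mul (by positivity), ← ENNReal.ofReal_mul (by positivity)]
          congr 1; ring
  have hint : ∀ s, IntegrableOn (fun z : Euc n => G (x + s • z) (fun _ => z)) B := fun s =>
    integrableOn_iteratedFDeriv_ray hf x m s
  have hd : ‖rayMean f x m (t / 2) - rayMean f x m t‖ₑ ≤
      ∫⁻ z in B, ‖G (x + (t / 2) • z) - G (x + t • z)‖ₑ := by
    have e : rayMean f x m (t / 2) - rayMean f x m t =
        ∫ z in B, (G (x + (t / 2) • z) - G (x + t • z)) (fun _ => z) := by
      simp only [_root_.sub_apply]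
      rw [integral_sub (hint _) (hint _)]
      rfl
    rw [e]
    refine (enorm_integral_le_lintegral_enorm _).trans ?_
    refine setLIntegral_mono' hB fun z hz => ?_
    exact enorm_le_iff_norm_le.2 (norm_apply_const_le hz _)
  have hmeas : ∀ a b : ℝ, Measurable fun q : Euc n × Euc n => ‖G (x + a • q.1) - G (x + b • q.2)‖ₑ :=
    fun a b => ((hG.comp (by fun_prop)).sub (hG.comp (by fun_prop))).enorm.measurable
  have hmeas1 : ∀ a : ℝ, ∀ g : Euc n, Measurable fun w : Euc n => ‖G (x + a • g) - G (x + t • w)‖ₑ :=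
    fun a g => (continuous_const.sub (hG.comp (by fun_prop))).enorm.measurable
  have hv : volume B * ‖rayMean f x m (t / 2) - rayMean f x m t‖ₑ ≤
      ENNReal.ofReal (2 * (c * V ^ 2 * K * t ^ (σ - n / p))) := by
    calc volume B * ‖rayMean f x m (t / 2) - rayMean f x m t‖ₑ
        ≤ volume B * ∫⁻ z in B, ‖G (x + (t / 2) • z) - G (x + t • z)‖ₑ := by gcongr
      _ = ∫⁻ z in B, ∫⁻ w in B, ‖G (x + (t / 2) • z) - G (x + t • z)‖ₑ := by
          simp only [lintegral_const, Measure.restrict_apply_univ]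
          rw [lintegral_mul_const' _ _ measure_ball_lt_top.ne, mul_comm]
      _ ≤ ∫⁻ z in B, ((∫⁻ w in B, ‖G (x + (t / 2) • z) - G (x + t • w)‖ₑ) +
            ∫⁻ w in B, ‖G (x + t • z) - G (x + t • w)‖ₑ) := by
          refine lintegral_mono fun z => ?_
          rw [← lintegral_add_left (hmeas1 _ _)]
          refine lintegral_mono fun w => ?_
          have : G (x + (t / 2) • z) - G (x + t • z) =
            (G (x + (t / 2) • z) - G (x + t • w)) - (G (x + t • z) - G (x + t • w)) := by abel
          rw [this]
          exact enorm_sub_le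
      _ = (∫⁻ z in B, ∫⁻ w in B, ‖G (x + (t / 2) • z) - G (x + t • w)‖ₑ) +
            ∫⁻ z in B, ∫⁻ w in B, ‖G (x + t • z) - G (x + t • w)‖ₑ :=
          lintegral_add_left (Measurable.lintegral_prod_right' (hmeas _ _)) _
      _ ≤ ENNReal.ofReal (c * V ^ 2 * K * t ^ (σ - n / p)) +
            ENNReal.ofReal (c * V ^ 2 * K * t ^ (σ - n / p)) :=
          add_le_add (hI _ le_rfl (by linarith)) (hI _ (by linarith) le_rfl)
      _ = _ := by rw [← ENNReal.ofReal_add (by positivity) (by positivity), two_mul]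
  rw [hvol, ← ofReal_norm, ← ENNReal.ofReal_mul hvol0.le,
    ENNReal.ofReal_le_ofReal_iff (by positivity)] at hv
  have h3 : ‖rayMean f x m (t / 2) - rayMean f x m t‖ ≤
      2 * (c * V ^ 2) / volume.real B * K * t ^ (σ - n / p) := by
    rw [← mul_le_mul_iff_of_pos_left hvol0]
    refine hv.trans_eq ?_
    field_simp
  have := norm_le_norm_add_norm_sub' (rayMean f x m (t / 2)) (rayMean f x m t)
  linarith

variable (W : Type) [NormedAddCommGroup W] [NormedSpace ℝ W] [CompleteSpace W]

theorem exists_norm_le_of_eLpNorm_le (n m : ℕ) {p : ℝ} (hp : 1 ≤ p) (hm : (n : ℝ) / p < m) :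
    ∃ C : ℝ, 0 < C ∧ ∀ {f : Euc n → W}, ContDiff ℝ ∞ f → ∀ (x : Euc n) (K : ℝ), 0 ≤ K →
      (∀ j ≤ m, eLpNorm (iteratedFDeriv ℝ j f) (ENNReal.ofReal p) volume ≤ ENNReal.ofReal K) →
      ‖f x‖ ≤ C * K := by
  obtain ⟨V, hV, H⟩ := exists_norm_rayMean_le n hp
  obtain ⟨C, hC, H'⟩ := exists_norm_zero_le_of_iterated_deriv (W := W) m (n / p) (Or.inl hm)
  have hvol0 : 0 < volume.real (Metric.ball (0 : Euc n) 1) :=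
    ENNReal.toReal_pos (Metric.measure_ball_pos _ _ one_pos).ne' measure_ball_lt_top.ne
  refine ⟨C * V / volume.real (Metric.ball (0 : Euc n) 1), by positivity,
    fun {f} hf x K hK hle => ?_⟩
  have h := H' (rayMean f x) (V * K) (by positivity) (hasDerivAt_rayMean hf x)
    (fun j hj => by simpa using H hf x j K hK (hle j hj.le) 1 one_pos)
    (fun t ht => H hf x m K hK (hle m le_rfl) t ht.1)
  rw [rayMean_zero_zero, norm_smul, Real.norm_of_nonneg hvol0.le] at h
  rw [div_mul_eq_mul_div, le_div_iff₀ hvol0]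
  linarith

theorem exists_norm_le_of_gagliardo_le (n m : ℕ) {p σ : ℝ} (hp : 1 ≤ p) (hσ : 0 < σ)
    (hm : (n : ℝ) / p < m + σ) :
    ∃ C : ℝ, 0 < C ∧ ∀ {f : Euc n → W}, ContDiff ℝ ∞ f → ∀ (x : Euc n) (K : ℝ), 0 ≤ K →
      (∀ j ≤ m, eLpNorm (iteratedFDeriv ℝ j f) (ENNReal.ofReal p) volume ≤ ENNReal.ofReal K) →
      (∫⁻ x : Euc n, ∫⁻ y : Euc n, ‖iteratedFDeriv ℝ m f x - iteratedFDeriv ℝ m f y‖ₑ ^ p /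
        ‖x - y‖ₑ ^ ((n : ℝ) + σ * p)) ^ (1 / p) ≤ ENNReal.ofReal K →
      ‖f x‖ ≤ C * K := by
  have hp0 : 0 < p := by linarith
  have hq : 0 ≤ (n : ℝ) / p := by positivity
  obtain ⟨V, hV, H⟩ := exists_norm_rayMean_le n hp
  obtain ⟨D, hD, HD⟩ := exists_norm_rayMean_half_le n hp hσ
  have hvol0 : 0 < volume.real (Metric.ball (0 : Euc n) 1) :=
    ENNReal.toReal_pos (Metric.measure_ball_pos _ _ one_pos).ne' measure_ball_lt_top.ne
  suffices h : ∃ C : ℝ, 0 < C ∧ ∀ {f : Euc n → W}, ContDiff ℝ ∞ f → ∀ (x : Euc n) (K : ℝ), 0 ≤ K →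
      (∀ j ≤ m, eLpNorm (iteratedFDeriv ℝ j f) (ENNReal.ofReal p) volume ≤ ENNReal.ofReal K) →
      (∫⁻ x : Euc n, ∫⁻ y : Euc n, ‖iteratedFDeriv ℝ m f x - iteratedFDeriv ℝ m f y‖ₑ ^ p /
        ‖x - y‖ₑ ^ ((n : ℝ) + σ * p)) ^ (1 / p) ≤ ENNReal.ofReal K →
      ‖rayMean f x 0 0‖ ≤ C * K by
    obtain ⟨C, hC, h⟩ := h
    refine ⟨C / volume.real (Metric.ball (0 : Euc n) 1), by positivity,
      fun {f} hf x K hK hle hg => ?_⟩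
    have := h hf x K hK hle hg
    rw [rayMean_zero_zero, norm_smul, Real.norm_of_nonneg hvol0.le] at this
    rw [div_mul_eq_mul_div, le_div_iff₀ hvol0]
    linarith
  -- For `m = 0` the hypothesis reads `σ > n / p`, and the dyadic increments are summable. For `m >
  -- 0` they only give growth `t^{-β}` of the `m`-th mean, which the `m` integrations absorb.
  rcases Nat.eq_zero_or_pos m with rfl | hmpos
  · have hβ : 0 < σ - n / p := by
      rw [Nat.cast_zero, zero_add] at hm; linarith
    refine ⟨(1 + 1 / (1 - (1 / 2) ^ (σ - n / p))) * (V + D), ?_, fun {f} hf x K hK hle hg => ?_⟩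
    · have : (1 / 2 : ℝ) ^ (σ - n / p) < 1 := Real.rpow_lt_one (by norm_num) (by norm_num) hβ
      have : 0 < 1 - (1 / 2 : ℝ) ^ (σ - n / p) := by linarith
      positivity
    have key : ∀ i : ℕ, ‖rayMean f x 0 ((1 / 2) ^ i)‖ ≤
        (1 + 1 / (1 - (1 / 2) ^ (σ - n / p))) * ((V + D) * K) := by
      refine le_of_dyadic_step (g := fun t => ‖rayMean f x 0 t‖) (by positivity) hβ ?_ fun t ht => ?_
      · have := H hf x 0 K hK (hle 0 le_rfl) 1 one_pos
        rw [Real.one_rpow, mul_one] at this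
        nlinarith
      · refine (HD hf x 0 K hK hg t ht.1).trans ?_
        have h1 := ht.1.le
        gcongr
        linarith
    have hlim : Filter.Tendsto (fun i : ℕ => ‖rayMean f x 0 ((1 / 2) ^ i)‖) Filter.atTop
        (nhds ‖rayMean f x 0 0‖) :=
      ((hasDerivAt_rayMean hf x 0 0).continuousAt.norm.tendsto).comp
        (tendsto_pow_atTop_nhds_zero_of_lt_one (by norm_num) (by norm_num))
    rw [mul_assoc]
    exact le_of_tendsto' hlim key
  · have hm1 : (0 : ℝ) < m := by exact_mod_cast hmpos
    -- Three demands on `β`: positive for the geometric sum, above `n / p - σ` to dominate the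
    -- increments, below `m` for the integrations.
    obtain ⟨β, h1, h2⟩ : ∃ β : ℝ, max 0 (n / p - σ) < β ∧ β < m :=
      exists_between (max_lt hm1 (by linarith))
    have hβ0 : 0 < β := (le_max_left _ _).trans_lt h1
    have hβ1 : -β ≤ σ - n / p := by linarith [(le_max_right _ _).trans_lt h1]
    obtain ⟨C, hC, H'⟩ := exists_norm_zero_le_of_iterated_deriv (W := W) m β (Or.inl h2)
    have hE1 : (1 : ℝ) ≤ 2 ^ (n / p : ℝ) := Real.one_le_rpow (by norm_num) hq
    have hF : 0 < 1 / ((2 : ℝ) ^ β - 1) := by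
      have := Real.one_lt_rpow (show (1 : ℝ) < 2 by norm_num) hβ0
      have : 0 < (2 : ℝ) ^ β - 1 := by linarith
      positivity
    set F := 1 + 1 / ((2 : ℝ) ^ β - 1) with hFdef
    have hF1 : 1 ≤ F := by linarith
    set E := V * 2 ^ (n / p : ℝ) + D with hE
    have hVE : V ≤ E := by nlinarith
    refine ⟨C * (F * E), by positivity, fun {f} hf x K hK hle hg => ?_⟩
    rw [mul_assoc]
    refine H' (rayMean f x) (F * E * K) (by positivity) (hasDerivAt_rayMean hf x)
      (fun j hj => ?_) (fun t ht => ?_)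
    · have := H hf x j K hK (hle j hj.le) 1 one_pos
      rw [Real.one_rpow, mul_one] at this
      refine this.trans ?_
      gcongr
      nlinarith
    · have hKE : 0 ≤ E * K := by positivity
      have := le_rpow_of_dyadic_step (g := fun t => ‖rayMean f x m t‖) hKE hβ0
        (fun t ht => ?_) (fun t ht => ?_) ht
      · rwa [← hFdef, ← mul_assoc] at this
      · have ht0 : 0 < t := by linarith [ht.1]
        refine (H hf x m K hK (hle m le_rfl) t ht0).trans ?_
        have e : t ^ (-(n / p : ℝ)) ≤ 2 ^ (n / p : ℝ) := by
          refine (Real.rpow_le_rpow_of_nonpos (by norm_num : (0 : ℝ) < 1 / 2) ht.1 (by linarith)).trans_eq ?_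
          rw [one_div, Real.inv_rpow (by norm_num), Real.rpow_neg (by norm_num), inv_inv]
        calc V * K * t ^ (-(n / p : ℝ)) ≤ V * K * 2 ^ (n / p : ℝ) := by gcongr
          _ = V * 2 ^ (n / p : ℝ) * K := by ring
          _ ≤ E * K := by gcongr; linarith
      · refine (HD hf x m K hK hg t ht.1).trans ?_
        have ht0 := ht.1.le
        have e : t ^ (σ - n / p) ≤ t ^ (-β) := Real.rpow_le_rpow_of_exponent_ge ht.1 ht.2 hβ1
        have hDE : D ≤ E := by
          have : 0 ≤ V * 2 ^ (n / p : ℝ) := by positivity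
          linarith
        gcongr

omit [CompleteSpace W] in
theorem enorm_iteratedFDeriv_fderiv_sub {V : Type*} [NormedAddCommGroup V] [NormedSpace ℝ V]
    (g : V → W) (m : ℕ) (x y : V) :
    ‖iteratedFDeriv ℝ m (fderiv ℝ g) x - iteratedFDeriv ℝ m (fderiv ℝ g) y‖ₑ =
      ‖iteratedFDeriv ℝ (m + 1) g x - iteratedFDeriv ℝ (m + 1) g y‖ₑ := by
  have h : ∀ z, iteratedFDeriv ℝ (m + 1) g z =
      (continuousMultilinearCurryRightEquiv' ℝ m V W).symm (iteratedFDeriv ℝ m (fderiv ℝ g) z) :=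
    fun z => by rw [iteratedFDeriv_succ_eq_comp_right]; rfl
  rw [h x, h y, ← ofReal_norm, ← ofReal_norm,
    ← (continuousMultilinearCurryRightEquiv' ℝ m V W).symm.norm_map (_ - _),
    (continuousMultilinearCurryRightEquiv' ℝ m V W).symm.map_sub]

/-- The Sobolev embedding `W^{s,p} ⊆ C^{0,1}` for `s > 1 + n / p`. -/
theorem exists_enorm_fderiv_le_sobolevNorm (n : ℕ) {p s : ℝ} (hp : 1 ≤ p)
    (hs : 1 + (n : ℝ) / p < s) :
    ∃ C : ℝ, 0 < C ∧ ∀ g : Euc n → Euc n, ContDiff ℝ ∞ g → ∀ x,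
      ‖fderiv ℝ g x‖ₑ ≤ ENNReal.ofReal C * sobolevNorm s p g := by
  have hp0 : 0 < p := by linarith
  have hq : 0 ≤ (n : ℝ) / p := by positivity
  -- The sup bounds are applied to `fderiv ℝ g`, which has one derivative fewer; the condition `n /
  -- p < s - 1` is then the hypothesis on `s`.
  obtain ⟨m, hm⟩ : ∃ m, ⌊s⌋₊ = m + 1 :=
    Nat.exists_eq_succ_of_ne_zero (Nat.floor_pos.2 (by linarith)).ne'
  have hsf : (⌊s⌋₊ : ℝ) ≤ s := Nat.floor_le (by linarith)
  have hcast : (⌊s⌋₊ : ℝ) = m + 1 := by rw [hm]; push_cast; ring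
  have hint : ∀ g : Euc n → Euc n, ∀ j ≤ m,
      eLpNorm (iteratedFDeriv ℝ j (fderiv ℝ g)) (ENNReal.ofReal p) volume ≤
        intSobolevNorm ⌊s⌋₊ p g := by
    intro g j hj
    have : eLpNorm (iteratedFDeriv ℝ j (fderiv ℝ g)) (ENNReal.ofReal p) volume =
        eLpNorm (iteratedFDeriv ℝ (j + 1) g) (ENNReal.ofReal p) volume :=
      eLpNorm_congr_norm_ae (Filter.Eventually.of_forall fun x => norm_iteratedFDeriv_fderiv)
    rw [this, intSobolevNorm]
    exact Finset.single_le_sum (f := fun j => eLpNorm (iteratedFDeriv ℝ j g) (ENNReal.ofReal p) volume)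
      (fun _ _ => zero_le) (Finset.mem_range.2 (by omega))
  have hsm : ∀ g : Euc n → Euc n, ContDiff ℝ ∞ g → ContDiff ℝ ∞ (fderiv ℝ g) := fun g hg =>
    hg.fderiv_right (by norm_cast)
  by_cases h : s = (⌊s⌋₊ : ℝ)
  · obtain ⟨C, hC, H⟩ := exists_norm_le_of_eLpNorm_le (Euc n →L[ℝ] Euc n) n m hp (by linarith)
    refine ⟨C, hC, fun g hg x => ?_⟩
    rw [sobolevNorm, if_pos h]
    by_cases htop : intSobolevNorm ⌊s⌋₊ p g = ⊤
    · rw [htop, ENNReal.mul_top (by simpa using hC)]; exact le_top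
    · have := H (hsm g hg) x (intSobolevNorm ⌊s⌋₊ p g).toReal ENNReal.toReal_nonneg
        (fun j hj => by rw [ENNReal.ofReal_toReal htop]; exact hint g j hj)
      rw [← ofReal_norm, ← ENNReal.ofReal_toReal htop, ← ENNReal.ofReal_mul hC.le]
      exact ENNReal.ofReal_le_ofReal this
  · have hσ : 0 < s - ⌊s⌋₊ := by
      rw [sub_pos]; exact lt_of_le_of_ne hsf (Ne.symm h)
    obtain ⟨C, hC, H⟩ := exists_norm_le_of_gagliardo_le (Euc n →L[ℝ] Euc n) n m hp hσ (by linarith)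
    refine ⟨C, hC, fun g hg x => ?_⟩
    rw [sobolevNorm, if_neg h]
    set N := intSobolevNorm ⌊s⌋₊ p g + gagliardoSeminorm ⌊s⌋₊ (s - ⌊s⌋₊) p g with hN
    by_cases htop : N = ⊤
    · rw [htop, ENNReal.mul_top (by simpa using hC)]; exact le_top
    · have := H (hsm g hg) x N.toReal ENNReal.toReal_nonneg
        (fun j hj => by
          rw [ENNReal.ofReal_toReal htop]; exact (hint g j hj).trans le_self_add)
        (by
          rw [ENNReal.ofReal_toReal htop, hN]
          refine le_trans (le_of_eq ?_) le_add_self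
          simp only [gagliardoSeminorm, enorm_iteratedFDeriv_fderiv_sub]
          rw [hm])
      rw [← ofReal_norm, ← ENNReal.ofReal_toReal htop, ← ENNReal.ofReal_mul hC.le]
      exact ENNReal.ofReal_le_ofReal this

end Sobolev

/-! ### Smoothness of `cos ‖v‖` and `sinc ‖v‖` -/

theorem contDiff_ofScalarsSum {c : ℕ → ℝ} (hc : ∀ k, c k ≠ 0)
    (h : Filter.Tendsto (fun k => ‖c k.succ‖ / ‖c k‖) Filter.atTop (nhds 0)) :
    ContDiff ℝ ∞ (fun z : ℝ => ∑' k, c k * z ^ k) := by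
  have hr := FormalMultilinearSeries.ofScalars_radius_eq_top_of_tendsto ℝ c
    (Filter.Eventually.of_forall hc) h
  have hb := (FormalMultilinearSeries.ofScalars ℝ c).hasFPowerSeriesOnBall (by rw [hr]; simp)
  rw [hr] at hb
  have ha : AnalyticOnNhd ℝ (FormalMultilinearSeries.ofScalars ℝ c).sum Set.univ := by
    simpa using hb.analyticOnNhd
  have e : (fun z : ℝ => ∑' k, c k * z ^ k) = (FormalMultilinearSeries.ofScalars ℝ c).sum := by
    funext z
    exact (FormalMultilinearSeries.ofScalars_sum_eq c z).symm
  rw [e, ← contDiffOn_univ]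
  exact ha.contDiffOn uniqueDiffOn_univ

/-- The series of the even function `cos` is an entire series in `t ^ 2`. Composing it with the
smooth function `‖v‖ ^ 2` avoids the singularity of the norm at `0`. -/
theorem exists_contDiff_cos_sq : ∃ c : ℝ → ℝ, ContDiff ℝ ∞ c ∧ ∀ t, c (t ^ 2) = Real.cos t := by
  refine ⟨_, contDiff_ofScalarsSum (c := fun k => (-1) ^ k / ((2 * k).factorial : ℝ))
    (fun k => by positivity) ?_, fun t => ?_⟩
  · have : ∀ k : ℕ, ‖(-1 : ℝ) ^ k.succ / ((2 * k.succ).factorial : ℝ)‖ /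
        ‖(-1 : ℝ) ^ k / ((2 * k).factorial : ℝ)‖ = 1 / ((2 * k + 2) * (2 * k + 1)) := by
      intro k
      rw [show 2 * k.succ = 2 * k + 1 + 1 by omega, Nat.factorial_succ, Nat.factorial_succ]
      simp only [norm_div, norm_pow, norm_neg, norm_one, one_pow, RCLike.norm_natCast]
      push_cast
      field_simp
      ring
    simp only [this]
    refine squeeze_zero (fun k => by positivity) (fun k => ?_) tendsto_one_div_add_atTop_nhds_zero_nat
    apply one_div_le_one_div_of_le (by positivity)
    nlinarith [(Nat.cast_nonneg k : (0 : ℝ) ≤ k)]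
  · refine Eq.trans ?_ (Real.hasSum_cos t).tsum_eq
    congr 1; funext k
    rw [← pow_mul]; ring

theorem exists_contDiff_sinc_sq : ∃ c : ℝ → ℝ, ContDiff ℝ ∞ c ∧ ∀ t, c (t ^ 2) = Real.sinc t := by
  refine ⟨_, contDiff_ofScalarsSum (c := fun k => (-1) ^ k / ((2 * k + 1).factorial : ℝ))
    (fun k => by positivity) ?_, fun t => ?_⟩
  · have : ∀ k : ℕ, ‖(-1 : ℝ) ^ k.succ / ((2 * k.succ + 1).factorial : ℝ)‖ /
        ‖(-1 : ℝ) ^ k / ((2 * k + 1).factorial : ℝ)‖ = 1 / ((2 * k + 3) * (2 * k + 2)) := by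
      intro k
      rw [show 2 * k.succ + 1 = 2 * k + 1 + 1 + 1 by omega, Nat.factorial_succ, Nat.factorial_succ]
      simp only [norm_div, norm_pow, norm_neg, norm_one, one_pow, RCLike.norm_natCast]
      push_cast
      field_simp
      ring
    simp only [this]
    refine squeeze_zero (fun k => by positivity) (fun k => ?_) tendsto_one_div_add_atTop_nhds_zero_nat
    apply one_div_le_one_div_of_le (by positivity)
    nlinarith [(Nat.cast_nonneg k : (0 : ℝ) ≤ k)]
  · by_cases ht : t = 0
    · subst ht
      rw [Real.sinc_zero, tsum_eq_single 0]
      · simp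
      · intro k hk; simp [hk]
    · rw [Real.sinc_of_ne_zero ht]
      refine Eq.trans ?_ ((Real.hasSum_sin t).div_const t).tsum_eq
      congr 1; funext k
      rw [← pow_mul]; field_simp; ring

theorem sin_eq_mul_sinc (t : ℝ) : Real.sin t = t * Real.sinc t := by
  by_cases h : t = 0
  · simp [h]
  · rw [Real.sinc_of_ne_zero h]; field_simp

theorem exists_pos_le_sinc {r : ℝ} (hr : r < Real.pi) :
    ∃ m : ℝ, 0 < m ∧ m ≤ 1 ∧ ∀ t, 0 ≤ t → t ≤ r → m ≤ Real.sinc t := by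
  have hpos : ∀ t ∈ Set.Icc 0 r, 0 < Real.sinc t := by
    intro t ht
    rcases ht.1.eq_or_lt with rfl | h
    · simp
    · rw [Real.sinc_of_ne_zero h.ne']
      exact div_pos (Real.sin_pos_of_pos_of_lt_pi h (ht.2.trans_lt hr)) h
  by_cases hne : (Set.Icc 0 r).Nonempty
  · obtain ⟨t₀, ht₀, hmin⟩ := isCompact_Icc.exists_isMinOn hne Real.continuous_sinc.continuousOn
    exact ⟨Real.sinc t₀, hpos t₀ ht₀, Real.sinc_le_one _, fun t h0 h1 => hmin ⟨h0, h1⟩⟩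
  · exact ⟨1, one_pos, le_rfl, fun t h0 h1 => absurd ⟨t, h0, h1⟩ hne⟩

/-! ### The exponential map of the sphere -/

section Exponential

variable {n : ℕ} (x : Sph n) (F : Euc n ≃ₗᵢ[ℝ] (Submodule.span ℝ {(x : Euc (n + 1))})ᗮ)

theorem contDiff_expAmbient : ContDiff ℝ ∞ (expAmbient x F) := by
  obtain ⟨c, hc, hce⟩ := exists_contDiff_cos_sq
  obtain ⟨s, hs, hse⟩ := exists_contDiff_sinc_sq
  have e : expAmbient x F = fun v => c (‖v‖ ^ 2) • (x : Euc (n + 1)) +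
      s (‖v‖ ^ 2) • ((Submodule.subtypeL (Submodule.span ℝ {(x : Euc (n + 1))})ᗮ).comp
        F.toContinuousLinearEquiv.toContinuousLinearMap) v := by
    funext v
    rw [hce, hse]; rfl
  rw [e]
  have hn : ContDiff ℝ ∞ fun v : Euc n => ‖v‖ ^ 2 := contDiff_norm_sq ℝ
  exact ((hc.comp hn).smul contDiff_const).add ((hs.comp hn).smul (ContinuousLinearMap.contDiff _))

theorem norm_expAmbient (v : Euc n) : ‖expAmbient x F v‖ = 1 :=
  mem_sphere_zero_iff_norm.1 (expAmbient_mem x F v)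

theorem norm_coe_sph (x : Sph n) : ‖(x : Euc (n + 1))‖ = 1 := by simp

theorem inner_frame (v : Euc n) : inner ℝ (x : Euc (n + 1)) (F v : Euc (n + 1)) = 0 :=
  Submodule.mem_orthogonal_singleton_iff_inner_right.1 (F v).2

theorem inner_frame_frame (v w : Euc n) :
    inner ℝ (F v : Euc (n + 1)) (F w : Euc (n + 1)) = inner ℝ v w := by
  rw [← Submodule.coe_inner, F.inner_map_map]

theorem inner_expAmbient (v w : Euc n) : inner ℝ (expAmbient x F v) (expAmbient x F w) =
    Real.cos ‖v‖ * Real.cos ‖w‖ + Real.sinc ‖v‖ * Real.sinc ‖w‖ * inner ℝ v w := by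
  have h1 : inner ℝ (F v : Euc (n + 1)) (x : Euc (n + 1)) = 0 := by
    rw [real_inner_comm]; exact inner_frame x F v
  simp only [expAmbient, inner_add_left, inner_add_right, inner_smul_left, inner_smul_right,
    inner_frame, h1, inner_frame_frame, real_inner_self_eq_norm_sq, norm_coe_sph]
  simp
  ring

theorem inner_center_expAmbient (v : Euc n) :
    inner ℝ (x : Euc (n + 1)) (expAmbient x F v) = Real.cos ‖v‖ := by
  simp only [expAmbient, inner_add_right, inner_smul_right, inner_frame,
    real_inner_self_eq_norm_sq, norm_coe_sph]
  simp

theorem angle_expAmbient {v : Euc n} (hv : ‖v‖ ≤ Real.pi) :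
    InnerProductGeometry.angle (x : Euc (n + 1)) (expAmbient x F v) = ‖v‖ := by
  rw [InnerProductGeometry.angle, inner_center_expAmbient, norm_coe_sph, norm_expAmbient]
  simp [Real.arccos_cos (norm_nonneg v) hv]

/-- The square of `‖v - w‖` is a radial part `(‖v‖ - ‖w‖)²` plus twice an angular part `‖v‖‖w‖ - ⟪v,
w⟫`. The squared chord splits likewise, into `2 (1 - cos (‖v‖ - ‖w‖))` and the angular part weighted
by values of `sinc`, which stay positive below `π`. The parts are compared separately. -/
theorem exists_le_norm_expAmbient_sub {r : ℝ} (hr : r < Real.pi) :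
    ∃ c : ℝ, 0 < c ∧ ∀ v w : Euc n, ‖v‖ ≤ r → ‖w‖ ≤ r →
      c * ‖v - w‖ ≤ ‖expAmbient x F v - expAmbient x F w‖ := by
  obtain ⟨m, hm, hm1, hmin⟩ := exists_pos_le_sinc hr
  have hpi := Real.pi_pos
  refine ⟨min (2 / Real.pi) m, lt_min (by positivity) hm, fun v w hv hw => ?_⟩
  set c := min (2 / Real.pi) m
  have hc0 : 0 < c := lt_min (by positivity) hm
  have hc1 : c ^ 2 ≤ 4 / Real.pi ^ 2 := by
    calc c ^ 2 ≤ (2 / Real.pi) ^ 2 := pow_le_pow_left₀ hc0.le (min_le_left _ _) 2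
      _ = _ := by rw [div_pow]; norm_num
  have hc2 : c ^ 2 ≤ Real.sinc ‖v‖ * Real.sinc ‖w‖ := by
    have h1 := hmin ‖v‖ (norm_nonneg _) hv
    have h2 := hmin ‖w‖ (norm_nonneg _) hw
    have h3 : c ≤ m := min_le_right _ _
    rw [sq]
    exact mul_le_mul (h3.trans h1) (h3.trans h2) hc0.le (hm.le.trans h1)
  have hvw : ‖v - w‖ ^ 2 = (‖v‖ - ‖w‖) ^ 2 + 2 * (‖v‖ * ‖w‖ - inner ℝ v w) := by
    rw [norm_sub_sq_real]; ring
  have hcs : 0 ≤ ‖v‖ * ‖w‖ - inner ℝ v w := sub_nonneg.2 (real_inner_le_norm v w)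
  have hE : ‖expAmbient x F v - expAmbient x F w‖ ^ 2 = 2 * (1 - Real.cos (‖v‖ - ‖w‖)) +
      2 * (Real.sinc ‖v‖ * Real.sinc ‖w‖) * (‖v‖ * ‖w‖ - inner ℝ v w) := by
    rw [norm_sub_sq_real, norm_expAmbient, norm_expAmbient, inner_expAmbient, Real.cos_sub,
      sin_eq_mul_sinc, sin_eq_mul_sinc]
    ring
  have hcos : 2 / Real.pi ^ 2 * (‖v‖ - ‖w‖) ^ 2 ≤ 1 - Real.cos (‖v‖ - ‖w‖) := by
    have : |‖v‖ - ‖w‖| ≤ Real.pi := by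
      rw [abs_le]; constructor <;> linarith [norm_nonneg v, norm_nonneg w]
    linarith [Real.cos_le_one_sub_mul_cos_sq this]
  refine (sq_le_sq₀ (by positivity) (norm_nonneg _)).1 ?_
  rw [mul_pow, hvw, hE, mul_add]
  have h1 : c ^ 2 * (‖v‖ - ‖w‖) ^ 2 ≤ 4 / Real.pi ^ 2 * (‖v‖ - ‖w‖) ^ 2 := by gcongr
  have h2 : c ^ 2 * (‖v‖ * ‖w‖ - inner ℝ v w) ≤
      (Real.sinc ‖v‖ * Real.sinc ‖w‖) * (‖v‖ * ‖w‖ - inner ℝ v w) := by gcongr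
  have h3 : 4 / Real.pi ^ 2 * (‖v‖ - ‖w‖) ^ 2 = 2 * (2 / Real.pi ^ 2 * (‖v‖ - ‖w‖) ^ 2) := by ring
  linarith

/-- The preimage is the component of `y` orthogonal to `x`, read in the frame and rescaled from
length `sin θ` to `θ`. -/
theorem exists_expSph_eq {y : Sph n}
    (hy : InnerProductGeometry.angle (x : Euc (n + 1)) (y : Euc (n + 1)) < Real.pi) :
    ∃ v : Euc n, ‖v‖ = InnerProductGeometry.angle (x : Euc (n + 1)) (y : Euc (n + 1)) ∧
      expSph x F v = y := by
  set θ := InnerProductGeometry.angle (x : Euc (n + 1)) (y : Euc (n + 1)) with hθ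
  have hθ0 : 0 ≤ θ := InnerProductGeometry.angle_nonneg _ _
  have hcos : Real.cos θ = inner ℝ (x : Euc (n + 1)) (y : Euc (n + 1)) := by
    rw [hθ, InnerProductGeometry.cos_angle, norm_coe_sph, norm_coe_sph]; simp
  rcases hθ0.eq_or_lt with h0 | hpos
  · refine ⟨0, by rw [norm_zero]; exact h0, ?_⟩
    apply Subtype.ext
    have : (x : Euc (n + 1)) = y := by
      rw [← h0, Real.cos_zero] at hcos
      exact (inner_eq_one_iff_of_norm_eq_one (norm_coe_sph x) (norm_coe_sph y)).1 hcos.symm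
    simp [expSph, expAmbient, this]
  · have hsin : 0 < Real.sin θ := Real.sin_pos_of_pos_of_lt_pi hpos hy
    have hmem : (y : Euc (n + 1)) - Real.cos θ • (x : Euc (n + 1)) ∈
        (Submodule.span ℝ {(x : Euc (n + 1))})ᗮ := by
      rw [Submodule.mem_orthogonal_singleton_iff_inner_right, inner_sub_right, inner_smul_right,
        real_inner_self_eq_norm_sq, norm_coe_sph, hcos]
      ring
    set d : (Submodule.span ℝ {(x : Euc (n + 1))})ᗮ := ⟨_, hmem⟩ with hd
    have hdn : ‖d‖ = Real.sin θ := by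
      refine (pow_left_inj₀ (norm_nonneg _) hsin.le two_ne_zero).1 ?_
      rw [Submodule.coe_norm, hd]
      simp only
      rw [norm_sub_sq_real, norm_smul, inner_smul_right, real_inner_comm, ← hcos, norm_coe_sph,
        norm_coe_sph, Real.sin_sq, Real.norm_eq_abs, mul_one, sq_abs]
      ring
    have hn : ‖(θ / Real.sin θ) • F.symm d‖ = θ := by
      rw [norm_smul, F.symm.norm_map, hdn, Real.norm_of_nonneg (by positivity)]
      field_simp
    refine ⟨(θ / Real.sin θ) • F.symm d, hn, ?_⟩
    apply Subtype.ext
    simp only [expSph, expAmbient]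
    rw [hn, map_smul, F.apply_symm_apply, Submodule.coe_smul, smul_smul, Real.sinc_of_ne_zero hpos.ne']
    have : Real.sin θ / θ * (θ / Real.sin θ) = 1 := by field_simp
    rw [this, one_smul, hd]
    simp

/-! ### The differential of the exponential map -/

theorem hasFDerivAt_expAmbient (v : Euc n) :
    HasFDerivAt (expAmbient x F) (fderiv ℝ (expAmbient x F) v) v :=
  ((contDiff_expAmbient x F).differentiable (by simp) v).hasFDerivAt

/-- The lower Lipschitz bound passes to the limit in the difference quotients, so that the
differential need not be computed. -/
theorem exists_le_norm_fderiv_expAmbient {r : ℝ} (hr : r < Real.pi) :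
    ∃ c : ℝ, 0 < c ∧ ∀ v h : Euc n, ‖v‖ < r → c * ‖h‖ ≤ ‖fderiv ℝ (expAmbient x F) v h‖ := by
  obtain ⟨c, hc, H⟩ := exists_le_norm_expAmbient_sub x F hr
  refine ⟨c, hc, fun v h hv => ?_⟩
  have hl : HasDerivAt (fun t : ℝ => v + t • h) h 0 := by
    simpa using ((hasDerivAt_id (0 : ℝ)).smul_const h).const_add v
  have hd : HasDerivAt (fun t : ℝ => expAmbient x F (v + t • h)) (fderiv ℝ (expAmbient x F) v h) 0 := by
    have h0 : HasFDerivAt (expAmbient x F) (fderiv ℝ (expAmbient x F) v) (v + (0 : ℝ) • h) := by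
      simpa using hasFDerivAt_expAmbient x F v
    exact h0.comp_hasDerivAt (0 : ℝ) hl
  have ht := hd.tendsto_slope_zero.norm
  refine ge_of_tendsto ht ?_
  have hmem : ∀ᶠ t : ℝ in nhds 0, ‖v + t • h‖ < r := by
    have : Filter.Tendsto (fun t : ℝ => ‖v + t • h‖) (nhds 0) (nhds ‖v‖) := by
      simpa using hl.continuousAt.norm.tendsto
    exact this.eventually (gt_mem_nhds hv)
  filter_upwards [nhdsWithin_le_nhds hmem, self_mem_nhdsWithin] with t ht1 ht2
  have ht0 : 0 < ‖t‖ := norm_pos_iff.2 ht2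
  have h3 := H (v + t • h) v ht1.le hv.le
  rw [add_sub_cancel_left, norm_smul] at h3
  rw [norm_smul, norm_inv, zero_add, zero_smul, add_zero, inv_mul_eq_div, le_div_iff₀ ht0]
  linarith

theorem fderiv_expAmbient_injective {v : Euc n} (hv : ‖v‖ < Real.pi) :
    Function.Injective (fderiv ℝ (expAmbient x F) v) := by
  obtain ⟨r, h1, h2⟩ := exists_between hv
  obtain ⟨c, hc, H⟩ := exists_le_norm_fderiv_expAmbient x F h2
  rw [injective_iff_map_eq_zero]
  intro h hh
  have := H v h h1
  rw [hh, norm_zero] at this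
  exact norm_le_zero_iff.1 (by nlinarith [norm_nonneg h])

theorem inner_expAmbient_fderiv (v h : Euc n) :
    inner ℝ (expAmbient x F v) (fderiv ℝ (expAmbient x F) v h) = 0 := by
  have hd := (hasFDerivAt_expAmbient x F v).norm_sq
  have hc : (fun v => ‖expAmbient x F v‖ ^ 2) = fun _ => (1 : ℝ) := by
    funext v; rw [norm_expAmbient]; norm_num
  rw [hc] at hd
  have := hd.unique (hasFDerivAt_const (1 : ℝ) v)
  have := congrArg (fun T : Euc n →L[ℝ] ℝ => T h) this
  simpa using this

theorem exists_fderiv_expAmbient_eq {v : Euc n} (hv : ‖v‖ < Real.pi) {u : Euc (n + 1)}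
    (hu : inner ℝ (expAmbient x F v) u = 0) : ∃ h, fderiv ℝ (expAmbient x F) v h = u := by
  set P := (Submodule.span ℝ {expAmbient x F v})ᗮ with hP
  have hmem : ∀ h, fderiv ℝ (expAmbient x F) v h ∈ P := fun h =>
    Submodule.mem_orthogonal_singleton_iff_inner_right.2 (inner_expAmbient_fderiv x F v h)
  set L : Euc n →ₗ[ℝ] P := LinearMap.codRestrict P (fderiv ℝ (expAmbient x F) v : Euc n →ₗ[ℝ] _) hmem
  have hinj : Function.Injective L := by
    intro a b hab
    exact fderiv_expAmbient_injective x F hv (congrArg Subtype.val hab)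
  have hne : expAmbient x F v ≠ 0 := by
    rw [← norm_ne_zero_iff, norm_expAmbient]; exact one_ne_zero
  have : Fact (Module.finrank ℝ (Euc (n + 1)) = n + 1) := ⟨finrank_euclideanSpace_fin⟩
  have hdim : Module.finrank ℝ (Euc n) = Module.finrank ℝ P := by
    rw [finrank_euclideanSpace_fin, hP, Submodule.finrank_orthogonal_span_singleton (n := n) hne]
  obtain ⟨h, hh⟩ := (LinearMap.injective_iff_surjective_of_finrank_eq_finrank hdim).1 hinj
    ⟨u, Submodule.mem_orthogonal_singleton_iff_inner_right.2 hu⟩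
  exact ⟨h, congrArg Subtype.val hh⟩

/-- A left inverse of the differential of the exponential map. -/
def logDeriv (v : Euc n) : Euc (n + 1) →L[ℝ] Euc n :=
  (ContinuousLinearMap.inverse ((ContinuousLinearMap.adjoint (fderiv ℝ (expAmbient x F) v)).comp
    (fderiv ℝ (expAmbient x F) v))).comp (ContinuousLinearMap.adjoint (fderiv ℝ (expAmbient x F) v))

theorem isInvertible_adjoint_comp_fderiv {v : Euc n} (hv : ‖v‖ < Real.pi) :
    ((ContinuousLinearMap.adjoint (fderiv ℝ (expAmbient x F) v)).comp
      (fderiv ℝ (expAmbient x F) v)).IsInvertible := by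
  set J := fderiv ℝ (expAmbient x F) v
  set T := (ContinuousLinearMap.adjoint J).comp J
  have hinj : Function.Injective (T : Euc n →ₗ[ℝ] Euc n) := by
    rw [← LinearMap.ker_eq_bot, LinearMap.ker_eq_bot']
    intro h hh
    have h1 : inner ℝ (T h) h = 0 := by
      have : T h = 0 := hh
      rw [this, inner_zero_left]
    have h2 : inner ℝ (T h) h = ‖J h‖ ^ 2 := by
      rw [ContinuousLinearMap.comp_apply, ContinuousLinearMap.adjoint_inner_left,
        real_inner_self_eq_norm_sq]
    have h3 : J h = 0 := by
      rw [h2] at h1; exact norm_eq_zero.1 (pow_eq_zero_iff two_ne_zero |>.1 h1)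
    exact fderiv_expAmbient_injective x F hv (h3.trans (map_zero _).symm)
  refine ⟨(LinearEquiv.ofInjectiveEndo _ hinj).toContinuousLinearEquiv, ?_⟩
  ext h
  rfl

theorem logDeriv_fderiv {v : Euc n} (hv : ‖v‖ < Real.pi) (h : Euc n) :
    logDeriv x F v (fderiv ℝ (expAmbient x F) v h) = h := by
  have hi := isInvertible_adjoint_comp_fderiv x F hv
  rw [logDeriv, ContinuousLinearMap.comp_apply, ← ContinuousLinearMap.comp_apply
    (ContinuousLinearMap.adjoint _), ← ContinuousLinearMap.comp_apply, hi.inverse_comp_self]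
  rfl

/-- With `J` the differential, `(J* J)⁻¹ J*` is a left inverse given by a formula, and inversion is
smooth at invertible operators. The choice made pointwise by `Function.invFun` in `localRep` shows
no such regularity. -/
theorem contDiffAt_logDeriv {v : Euc n} (hv : ‖v‖ < Real.pi) :
    ContDiffAt ℝ ∞ (logDeriv x F) v := by
  have hJ : ContDiff ℝ ∞ (fderiv ℝ (expAmbient x F)) :=
    (contDiff_expAmbient x F).fderiv_right (by norm_cast)
  have hA : ContDiff ℝ ∞ fun v => ContinuousLinearMap.adjoint (fderiv ℝ (expAmbient x F) v) :=
    (ContinuousLinearMap.adjoint (𝕜 := ℝ) (E := Euc n)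
      (F := Euc (n + 1))).toContinuousLinearEquiv.contDiff.comp hJ
  have hAJ := hA.clm_comp hJ
  have hi := isInvertible_adjoint_comp_fderiv x F hv
  exact ((hi.contDiffAt_map_inverse (n := ∞)).comp v hAJ.contDiffAt).clm_comp hA.contDiffAt

end Exponential

/-! ### Localization of vector fields -/

section Localization

variable {n : ℕ}

theorem contMDiff_coe_sph :
    ContMDiff (𝓡 n) 𝓘(ℝ, Euc (n + 1)) ∞ (fun y : Sph n => (y : Euc (n + 1))) := by
  have : Fact (Module.finrank ℝ (Euc (n + 1)) = n + 1) := ⟨finrank_euclideanSpace_fin⟩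
  exact contMDiff_coe_sphere

theorem contMDiff_codRestrict_sph {E H M : Type*} [NormedAddCommGroup E] [NormedSpace ℝ E]
    [TopologicalSpace H] {I : ModelWithCorners ℝ E H} [TopologicalSpace M] [ChartedSpace H M]
    [IsManifold I ∞ M]
    {f : M → Euc (n + 1)} (hf : ContMDiff I 𝓘(ℝ, Euc (n + 1)) ∞ f)
    (hf' : ∀ x, f x ∈ Metric.sphere (0 : Euc (n + 1)) 1) :
    ContMDiff I (𝓡 n) ∞ (fun x => (⟨f x, hf' x⟩ : Sph n)) := by
  have : Fact (Module.finrank ℝ (Euc (n + 1)) = n + 1) := ⟨finrank_euclideanSpace_fin⟩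
  exact hf.codRestrict_sphere hf'

theorem contMDiff_expSph (x : Sph n) (F : Euc n ≃ₗᵢ[ℝ] (Submodule.span ℝ {(x : Euc (n + 1))})ᗮ) :
    ContMDiff 𝓘(ℝ, Euc n) (𝓡 n) ∞ (expSph x F) :=
  contMDiff_codRestrict_sph (contDiff_expAmbient x F).contMDiff (expAmbient_mem x F)

variable (𝒰 : NormalCover n) (a : Fin 𝒰.m)

/-- The support of `ρ a` is compact in an open ball, so the angle has a maximum there, below the
radius. The gap makes the extension by zero smooth, and `r < π` keeps the support away from the cut
locus. -/
theorem NormalCover.exists_supportRadius : ∃ r : ℝ, 0 ≤ r ∧ r < 𝒰.radius a ∧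
    ∀ y : Sph n, 𝒰.ρ a y ≠ 0 →
      InnerProductGeometry.angle (𝒰.center a : Euc (n + 1)) (y : Euc (n + 1)) ≤ r := by
  have hc : Continuous fun y : Sph n =>
      InnerProductGeometry.angle (𝒰.center a : Euc (n + 1)) (y : Euc (n + 1)) := by
    rw [continuous_iff_continuousAt]
    intro y
    have h1 : (𝒰.center a : Euc (n + 1)) ≠ 0 := by
      rw [← norm_ne_zero_iff, norm_coe_sph]; exact one_ne_zero
    have h2 : (y : Euc (n + 1)) ≠ 0 := by
      rw [← norm_ne_zero_iff, norm_coe_sph]; exact one_ne_zero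
    exact (InnerProductGeometry.continuousAt_angle (x := ((𝒰.center a : Euc (n + 1)), (y : Euc (n + 1))))
      h1 h2).comp (f := fun y : Sph n => ((𝒰.center a : Euc (n + 1)), (y : Euc (n + 1))))
        (by fun_prop)
  have hK : IsCompact (tsupport (𝒰.ρ a)) := (isClosed_tsupport _).isCompact
  by_cases hne : (tsupport (𝒰.ρ a)).Nonempty
  · obtain ⟨y₀, hy₀, hmax⟩ := hK.exists_isMaxOn hne hc.continuousOn
    exact ⟨_, InnerProductGeometry.angle_nonneg _ _, 𝒰.subordinate a hy₀,
      fun y hy => hmax (subset_tsupport _ hy)⟩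
  · exact ⟨0, le_rfl, 𝒰.radius_pos a, fun y hy => absurd ⟨y, subset_tsupport _ hy⟩ hne⟩

open Classical in
/-- The linear map expressing `ρ_a u` in normal coordinates. -/
def NormalCover.chartMap (v : Euc n) : Euc (n + 1) →L[ℝ] Euc n :=
  if ‖v‖ < 𝒰.radius a then
    𝒰.ρ a (expSph (𝒰.center a) (𝒰.frame a) v) • logDeriv (𝒰.center a) (𝒰.frame a) v
  else 0

theorem NormalCover.chartMap_eq_zero {r : ℝ}
    (hρ : ∀ y : Sph n, 𝒰.ρ a y ≠ 0 →
      InnerProductGeometry.angle (𝒰.center a : Euc (n + 1)) (y : Euc (n + 1)) ≤ r)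
    {v : Euc n} (hv : r < ‖v‖) : 𝒰.chartMap a v = 0 := by
  rw [NormalCover.chartMap]
  split_ifs with h
  · have : 𝒰.ρ a (expSph (𝒰.center a) (𝒰.frame a) v) = 0 := by
      by_contra hne
      have h1 := hρ _ hne
      have h2 := angle_expAmbient (𝒰.center a) (𝒰.frame a) (h.le.trans (𝒰.radius_le a))
      exact absurd (h2.symm.le.trans h1) (not_le.2 hv)
    rw [this]
    exact zero_smul ℝ (logDeriv (𝒰.center a) (𝒰.frame a) v)
  · rfl

theorem NormalCover.contDiff_chartMap : ContDiff ℝ ∞ (𝒰.chartMap a) := by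
  obtain ⟨r, _, hr1, hρ⟩ := 𝒰.exists_supportRadius a
  rw [contDiff_iff_contDiffAt]
  intro v
  by_cases hv : ‖v‖ < 𝒰.radius a
  · have he : 𝒰.chartMap a =ᶠ[nhds v] fun v =>
        𝒰.ρ a (expSph (𝒰.center a) (𝒰.frame a) v) • logDeriv (𝒰.center a) (𝒰.frame a) v := by
      filter_upwards [(continuous_norm.tendsto v).eventually (gt_mem_nhds hv)] with w hw
      rw [NormalCover.chartMap, if_pos hw]
    refine ContDiffAt.congr_of_eventuallyEq ?_ he
    have h1 : ContDiff ℝ ∞ fun v => 𝒰.ρ a (expSph (𝒰.center a) (𝒰.frame a) v) :=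
      contMDiff_iff_contDiff.1
        ((𝒰.ρ a).contMDiff.comp (contMDiff_expSph (𝒰.center a) (𝒰.frame a)))
    exact h1.contDiffAt.smul (contDiffAt_logDeriv _ _ (hv.trans_le (𝒰.radius_le a)))
  · have hv' : r < ‖v‖ := hr1.trans_le (not_lt.1 hv)
    have he : 𝒰.chartMap a =ᶠ[nhds v] fun _ => 0 := by
      filter_upwards [(continuous_norm.tendsto v).eventually (lt_mem_nhds hv')] with w hw
      exact 𝒰.chartMap_eq_zero a hρ hw
    exact contDiffAt_const.congr_of_eventuallyEq he

variable {𝒰 a} {u : Sph n → Euc (n + 1)}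

/-- A tangent vector has exactly one preimage under the differential, so the arbitrary preimage and
the smooth left inverse agree. Tangency of `u` is essential here. -/
theorem NormalCover.localRep_eq_chartMap
    (hu : ∀ y : Sph n, inner ℝ (y : Euc (n + 1)) (u y) = 0) (v : Euc n) :
    𝒰.localRep u a v = 𝒰.chartMap a v (u (expSph (𝒰.center a) (𝒰.frame a) v)) := by
  rw [NormalCover.localRep, NormalCover.chartMap]
  split_ifs with h
  · have hv := h.trans_le (𝒰.radius_le a)
    obtain ⟨w, hw⟩ := exists_fderiv_expAmbient_eq (𝒰.center a) (𝒰.frame a) hv (hu (expSph _ _ v))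
    rw [_root_.smul_apply, ← hw, logDeriv_fderiv _ _ hv,
      Function.leftInverse_invFun (fderiv_expAmbient_injective _ _ hv)]
  · rfl

theorem NormalCover.fderiv_localRep
    (hu : ∀ y : Sph n, inner ℝ (y : Euc (n + 1)) (u y) = 0) {v : Euc n} (hv : ‖v‖ < 𝒰.radius a) :
    fderiv ℝ (expAmbient (𝒰.center a) (𝒰.frame a)) v (𝒰.localRep u a v) =
      𝒰.ρ a (expSph (𝒰.center a) (𝒰.frame a) v) • u (expSph (𝒰.center a) (𝒰.frame a) v) := by
  rw [NormalCover.localRep, if_pos hv, map_smul]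
  obtain ⟨w, hw⟩ := exists_fderiv_expAmbient_eq (𝒰.center a) (𝒰.frame a)
    (hv.trans_le (𝒰.radius_le a)) (hu (expSph _ _ v))
  rw [Function.invFun_eq ⟨w, hw⟩]

theorem cos_angle_sph (x y : Sph n) :
    Real.cos (InnerProductGeometry.angle (x : Euc (n + 1)) (y : Euc (n + 1))) =
      inner ℝ (x : Euc (n + 1)) (y : Euc (n + 1)) := by
  rw [InnerProductGeometry.cos_angle, norm_coe_sph, norm_coe_sph]; simp

theorem exists_norm_gt (hn : 1 ≤ n) (R : ℝ) : ∃ v : Euc n, ‖v‖ = |R| := by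
  refine ⟨EuclideanSpace.single ⟨0, hn⟩ R, by simp⟩

variable (𝒰 a) in
/-- The field `ρ_a u` is Lipschitz on the sphere, with constant controlled by the derivative of its
coordinate expression. -/
theorem NormalCover.exists_norm_smul_sub_le (hn : 1 ≤ n) : ∃ C : ℝ, 0 < C ∧
    ∀ u : Sph n → Euc (n + 1), (∀ y : Sph n, inner ℝ (y : Euc (n + 1)) (u y) = 0) →
      Differentiable ℝ (𝒰.localRep u a) → ∀ L : ℝ, 0 ≤ L →
      (∀ v, ‖fderiv ℝ (𝒰.localRep u a) v‖ ≤ L) → ∀ y z : Sph n,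
      ‖𝒰.ρ a y • u y - 𝒰.ρ a z • u z‖ ≤ C * L * ‖(y : Euc (n + 1)) - z‖ := by
  obtain ⟨r, hr0, hr1, hρ⟩ := 𝒰.exists_supportRadius a
  -- A margin around the support radius `r`: inside `R` the chart is bi-Lipschitz, and points beyond
  -- `R` are at distance at least `cos r - cos R` from the points where `ρ a ≠ 0`.
  obtain ⟨R, hrR, hR1⟩ := exists_between hr1
  have hRpi : R < Real.pi := hR1.trans_le (𝒰.radius_le a)
  set x := 𝒰.center a with hx
  set F := 𝒰.frame a with hF
  set E := expAmbient x F with hE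
  obtain ⟨c, hc, hbi⟩ := exists_le_norm_expAmbient_sub x F hRpi
  have hJ : ContDiff ℝ ∞ (fderiv ℝ E) := (contDiff_expAmbient x F).fderiv_right (by norm_cast)
  obtain ⟨M, hM⟩ := (isCompact_closedBall (0 : Euc n) R).exists_bound_of_continuousOn
    hJ.continuous.continuousOn
  obtain ⟨M₂, hM₂⟩ := (isCompact_closedBall (0 : Euc n) R).exists_bound_of_continuousOn
    (hJ.continuous_fderiv (by simp)).continuousOn
  have hR0 : 0 ≤ R := hr0.trans hrR.le
  have h00 : (0 : Euc n) ∈ Metric.closedBall (0 : Euc n) R := by simpa using hR0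
  have hM0 : 0 ≤ M := (norm_nonneg _).trans (hM 0 h00)
  have hM₂0 : 0 ≤ M₂ := (norm_nonneg _).trans (hM₂ 0 h00)
  have hJlip : ∀ v w : Euc n, ‖v‖ ≤ R → ‖w‖ ≤ R → ‖fderiv ℝ E v - fderiv ℝ E w‖ ≤ M₂ * ‖v - w‖ := by
    intro v w hv hw
    exact (convex_closedBall (0 : Euc n) R).norm_image_sub_le_of_norm_fderiv_le
      (fun v _ => hJ.differentiable (by simp) v) hM₂ (mem_closedBall_zero_iff.2 hw)
      (mem_closedBall_zero_iff.2 hv)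
  have hcos : 0 < Real.cos r - Real.cos R :=
    sub_pos.2 (Real.cos_lt_cos_of_nonneg_of_le_pi hr0 hRpi.le hrR)
  set d := Real.cos r - Real.cos R with hd
  refine ⟨(8 * M₂ + M) / c + 8 * M / d + 1, by positivity, fun u hu hdiff L hL hLb => ?_⟩
  set g := 𝒰.localRep u a with hg
  have hg0 : ∀ v, r < ‖v‖ → g v = 0 := by
    intro v hv
    rw [hg, NormalCover.localRep_eq_chartMap hu, 𝒰.chartMap_eq_zero a hρ hv]; rfl
  have hglip : ∀ v w, ‖g v - g w‖ ≤ L * ‖v - w‖ := fun v w =>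
    Convex.norm_image_sub_le_of_norm_fderiv_le (fun v _ => hdiff v) (fun v _ => hLb v) convex_univ
      (Set.mem_univ w) (Set.mem_univ v)
  have hgsup : ∀ v, ‖v‖ ≤ R → ‖g v‖ ≤ 8 * L := by
    intro v hv
    -- Since `4 ≥ π > R`, the field `g` vanishes at `w`; its Lipschitz bound over a distance of at
    -- most `8` then bounds its supremum. Such a `w` exists because `n ≥ 1`.
    obtain ⟨w, hw⟩ := exists_norm_gt hn 4
    rw [abs_of_pos (by norm_num : (0 : ℝ) < 4)] at hw
    have hpi4 : R < 4 := hRpi.trans_le Real.pi_le_four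
    have h1 := hglip v w
    rw [hg0 w (by linarith), sub_zero] at h1
    have h2 : ‖v - w‖ ≤ 8 := (norm_sub_le _ _).trans (by linarith)
    nlinarith
  have hpt : ∀ y : Sph n, InnerProductGeometry.angle (x : Euc (n + 1)) (y : Euc (n + 1)) ≤ R →
      ∃ v : Euc n, ‖v‖ ≤ R ∧ (y : Euc (n + 1)) = E v ∧ 𝒰.ρ a y • u y = fderiv ℝ E v (g v) := by
    intro y hy
    obtain ⟨v, hv, hve⟩ := exists_expSph_eq x F (hy.trans_lt hRpi)
    refine ⟨v, hv.trans_le hy, by rw [← hve]; rfl, ?_⟩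
    rw [NormalCover.fderiv_localRep hu ((hv.trans_le hy).trans_lt hR1), hve]
  have key : ∀ y z : Sph n, 𝒰.ρ a y ≠ 0 → ‖𝒰.ρ a y • u y - 𝒰.ρ a z • u z‖ ≤
      ((8 * M₂ + M) / c + 8 * M / d + 1) * L * ‖(y : Euc (n + 1)) - z‖ := by
    intro y z hy
    have hyr := hρ y hy
    obtain ⟨v, hv, hyv, hyu⟩ := hpt y (hyr.trans hrR.le)
    have hJg : ∀ v w, ‖v‖ ≤ R → ‖fderiv ℝ E v w‖ ≤ M * ‖w‖ := fun v w hv =>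
      (ContinuousLinearMap.le_opNorm _ _).trans
        (mul_le_mul_of_nonneg_right (hM v (mem_closedBall_zero_iff.2 hv)) (norm_nonneg _))
    by_cases hz : InnerProductGeometry.angle (x : Euc (n + 1)) (z : Euc (n + 1)) ≤ R
    · obtain ⟨w, hw, hzw, hzu⟩ := hpt z hz
      rw [hyu, hzu]
      have hvw : ‖v - w‖ ≤ ‖(y : Euc (n + 1)) - z‖ / c := by
        rw [le_div_iff₀ hc, hyv, hzw]; linarith [hbi v w hv hw]
      calc ‖fderiv ℝ E v (g v) - fderiv ℝ E w (g w)‖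
          = ‖(fderiv ℝ E v - fderiv ℝ E w) (g v) + fderiv ℝ E w (g v - g w)‖ := by
            rw [_root_.sub_apply, map_sub]; congr 1; abel
        _ ≤ M₂ * ‖v - w‖ * (8 * L) + M * (L * ‖v - w‖) := by
            refine (norm_add_le _ _).trans (add_le_add ?_ ?_)
            · refine (ContinuousLinearMap.le_opNorm _ _).trans ?_
              exact mul_le_mul (hJlip v w hv hw) (hgsup v hv) (norm_nonneg _) (by positivity)
            · exact (hJg w _ hw).trans (mul_le_mul_of_nonneg_left (hglip v w) hM0)
        _ = (8 * M₂ + M) * L * ‖v - w‖ := by ring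
        _ ≤ (8 * M₂ + M) * L * (‖(y : Euc (n + 1)) - z‖ / c) := by gcongr
        _ = (8 * M₂ + M) / c * (L * ‖(y : Euc (n + 1)) - z‖) := by ring
        _ ≤ ((8 * M₂ + M) / c + 8 * M / d + 1) * (L * ‖(y : Euc (n + 1)) - z‖) := by
            gcongr
            have : 0 ≤ 8 * M / d := by positivity
            linarith
        _ = _ := by ring
    · have hz0 : 𝒰.ρ a z = 0 := by
        by_contra h
        exact hz ((hρ z h).trans hrR.le)
      rw [hz0, zero_smul, sub_zero, hyu]
      have h1 : d ≤ ‖(y : Euc (n + 1)) - z‖ := by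
        have e1 : Real.cos r ≤ inner ℝ (x : Euc (n + 1)) (y : Euc (n + 1)) := by
          rw [← cos_angle_sph]
          exact Real.cos_le_cos_of_nonneg_of_le_pi (InnerProductGeometry.angle_nonneg _ _)
            (hrR.le.trans hRpi.le) hyr
        have e2 : inner ℝ (x : Euc (n + 1)) (z : Euc (n + 1)) ≤ Real.cos R := by
          rw [← cos_angle_sph]
          exact Real.cos_le_cos_of_nonneg_of_le_pi hR0 (InnerProductGeometry.angle_le_pi _ _)
            (not_le.1 hz).le
        have e3 := real_inner_le_norm (x : Euc (n + 1)) ((y : Euc (n + 1)) - z)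
        rw [norm_coe_sph, one_mul, inner_sub_right] at e3
        linarith
      calc ‖fderiv ℝ E v (g v)‖ ≤ M * (8 * L) :=
            (hJg v _ hv).trans (mul_le_mul_of_nonneg_left (hgsup v hv) hM0)
        _ = 8 * M / d * L * d := by field_simp
        _ ≤ 8 * M / d * L * ‖(y : Euc (n + 1)) - z‖ := by gcongr
        _ ≤ _ := by
            gcongr
            have : 0 ≤ (8 * M₂ + M) / c := by positivity
            linarith
  intro y z
  by_cases hy : 𝒰.ρ a y = 0
  · by_cases hz : 𝒰.ρ a z = 0
    · rw [hy, hz, zero_smul, zero_smul, sub_zero, norm_zero]; positivity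
    · rw [norm_sub_rev, norm_sub_rev (y : Euc (n + 1))]
      exact key z y hz
  · exact key y z hy

theorem NormalCover.sobolevNorm_localRep_le_vfNorm (𝒰 : NormalCover n) (s p : ℝ)
    (u : Sph n → Euc (n + 1)) (a : Fin 𝒰.m) :
    sobolevNorm s p (𝒰.localRep u a) ≤ 𝒰.vfNorm s p u := by
  rw [NormalCover.vfNorm, one_div, ENNReal.le_rpow_inv_iff (by norm_num), ENNReal.rpow_two]
  exact Finset.single_le_sum (f := fun a => sobolevNorm s p (𝒰.localRep u a) ^ 2)
    (fun _ _ => zero_le) (Finset.mem_univ a)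

/-- Smooth vector fields are Lipschitz, with constant controlled by the `W^{s,p}` norm. -/
theorem NormalCover.exists_enorm_sub_le_vfNorm (𝒰 : NormalCover n) (hn : 1 ≤ n) {p s : ℝ}
    (hp : 1 ≤ p) (hs : 1 + (n : ℝ) / p < s) : ∃ C : ℝ, 0 < C ∧
    ∀ u : Sph n → Euc (n + 1), (∀ y : Sph n, inner ℝ (y : Euc (n + 1)) (u y) = 0) →
      (∀ a, ContDiff ℝ ∞ (𝒰.localRep u a)) → ∀ y z : Sph n,
      ‖u y - u z‖ₑ ≤ ENNReal.ofReal (C * ‖(y : Euc (n + 1)) - z‖) * 𝒰.vfNorm s p u := by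
  obtain ⟨S, hS, hSob⟩ := exists_enorm_fderiv_le_sobolevNorm n hp hs
  choose D hD HD using fun a => 𝒰.exists_norm_smul_sub_le a hn
  have hDs : 0 ≤ ∑ a, D a := Finset.sum_nonneg fun a _ => (hD a).le
  refine ⟨(∑ a, D a + 1) * S, by positivity, fun u hu hsm y z => ?_⟩
  by_cases hyz : y = z
  · subst hyz; simp
  have hpos : 0 < ‖(y : Euc (n + 1)) - z‖ :=
    norm_pos_iff.2 (sub_ne_zero.2 fun h => hyz (Subtype.ext h))
  by_cases htop : 𝒰.vfNorm s p u = ⊤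
  · rw [htop, ENNReal.mul_top]
    · exact le_top
    · rw [Ne, ENNReal.ofReal_eq_zero, not_le]; positivity
  set N := (𝒰.vfNorm s p u).toReal with hN
  have hN0 : 0 ≤ N := ENNReal.toReal_nonneg
  have hfd : ∀ a v, ‖fderiv ℝ (𝒰.localRep u a) v‖ ≤ S * N := by
    intro a v
    have h1 := (hSob _ (hsm a) v).trans
      (mul_le_mul_right (𝒰.sobolevNorm_localRep_le_vfNorm s p u a) _)
    rw [← ENNReal.ofReal_toReal htop, ← ENNReal.ofReal_mul hS.le, ← ofReal_norm,
      ENNReal.ofReal_le_ofReal_iff (by positivity)] at h1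
    exact h1
  have hsum : ∀ y, u y = ∑ a, 𝒰.ρ a y • u y := by
    intro y
    rw [← Finset.sum_smul, ← finsum_eq_sum_of_fintype, 𝒰.ρ.sum_eq_one (Set.mem_univ y), one_smul]
  have hmain : ‖u y - u z‖ ≤ (∑ a, D a + 1) * S * ‖(y : Euc (n + 1)) - z‖ * N := by
    calc ‖u y - u z‖ = ‖∑ a, (𝒰.ρ a y • u y - 𝒰.ρ a z • u z)‖ := by
          rw [Finset.sum_sub_distrib, ← hsum, ← hsum]
      _ ≤ ∑ a, D a * (S * N) * ‖(y : Euc (n + 1)) - z‖ := by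
          refine norm_sum_le_of_le _ fun a _ => ?_
          exact HD a u hu ((hsm a).differentiable (by simp)) (S * N) (by positivity) (hfd a) y z
      _ = (∑ a, D a) * (S * N * ‖(y : Euc (n + 1)) - z‖) := by
          rw [Finset.sum_mul]; exact Finset.sum_congr rfl fun a _ => by ring
      _ ≤ (∑ a, D a + 1) * (S * N * ‖(y : Euc (n + 1)) - z‖) := by gcongr; linarith
      _ = _ := by ring
  rw [← ENNReal.ofReal_toReal htop, ← ENNReal.ofReal_mul (by positivity), ← ofReal_norm]
  exact ENNReal.ofReal_le_ofReal hmain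

end Localization

/-! ### Velocity fields of smooth paths -/

section Velocity

variable {n : ℕ} {φ₀ φ₁ : DiffSph n} {φ : ℝ → DiffSph n}

theorem uniqueDiffOn_Icc_prod_univ : UniqueDiffOn ℝ
    (Set.Icc (0 : ℝ) 1 ×ˢ (Set.univ : Set (Euc n))) :=
  (uniqueDiffOn_Icc zero_lt_one).prod uniqueDiffOn_univ

theorem IsSmoothPath.contDiffOn_comp (hφ : IsSmoothPath φ₀ φ₁ φ) {g : Euc n → Sph n}
    (hg : ContMDiff 𝓘(ℝ, Euc n) (𝓡 n) ∞ g) :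
    ContDiffOn ℝ ∞ (fun q : ℝ × Euc n => (φ q.1 (g q.2) : Euc (n + 1)))
      (Set.Icc (0 : ℝ) 1 ×ˢ Set.univ) := by
  have h1 : ContMDiff (𝓘(ℝ, ℝ).prod 𝓘(ℝ, Euc n)) (𝓘(ℝ, ℝ).prod (𝓡 n)) ∞
      (fun q : ℝ × Euc n => (q.1, g q.2)) :=
    contMDiff_fst.prodMk (hg.comp contMDiff_snd)
  have h2 := contMDiff_coe_sph.comp_contMDiffOn (hφ.1.comp h1.contMDiffOn
    (s := Set.Icc (0 : ℝ) 1 ×ˢ Set.univ) (fun q hq => ⟨hq.1, Set.mem_univ _⟩))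
  rw [← modelWithCornersSelf_prod, chartedSpaceSelf_prod] at h2
  exact contMDiffOn_iff_contDiffOn.1 h2

theorem IsSmoothPath.contDiffOn_apply (hφ : IsSmoothPath φ₀ φ₁ φ) (y : Sph n) :
    ContDiffOn ℝ ∞ (fun t => (φ t y : Euc (n + 1))) (Set.Icc (0 : ℝ) 1) :=
  (hφ.contDiffOn_comp (g := fun _ => y) contMDiff_const).comp
    (f := fun t : ℝ => (t, (0 : Euc n))) (by fun_prop) (fun t ht => ⟨ht, Set.mem_univ _⟩)

theorem IsSmoothPath.hasDerivWithinAt (hφ : IsSmoothPath φ₀ φ₁ φ) (y : Sph n) {t : ℝ}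
    (ht : t ∈ Set.Icc (0 : ℝ) 1) :
    HasDerivWithinAt (fun t => (φ t y : Euc (n + 1))) (velocity φ t (φ t y)) (Set.Icc (0 : ℝ) 1) t := by
  have h := ((hφ.contDiffOn_apply y).differentiableOn (by simp) t ht).hasDerivWithinAt
  rw [velocity, Diffeomorph.symm_apply_apply]
  exact h

theorem IsSmoothPath.inner_velocity (hφ : IsSmoothPath φ₀ φ₁ φ) {t : ℝ}
    (ht : t ∈ Set.Icc (0 : ℝ) 1) (y : Sph n) : inner ℝ (y : Euc (n + 1)) (velocity φ t y) = 0 := by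
  have h := (hφ.hasDerivWithinAt ((φ t).symm y) ht)
  rw [Diffeomorph.apply_symm_apply] at h
  have h2 := h.norm_sq
  simp only [norm_coe_sph, Diffeomorph.apply_symm_apply] at h2
  have := (uniqueDiffOn_Icc zero_lt_one t ht).eq_deriv _ h2 (hasDerivWithinAt_const _ _ _)
  linarith

/-- The velocity is the time component, at time `t`, of the derivative of the jointly smooth map
`(s, v) ↦ φ_s (φ_t⁻¹ (g v))` on `[0,1] × ℝⁿ`. -/
theorem IsSmoothPath.contDiff_velocity_comp (hφ : IsSmoothPath φ₀ φ₁ φ) {t : ℝ}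
    (ht : t ∈ Set.Icc (0 : ℝ) 1) {g : Euc n → Sph n} (hg : ContMDiff 𝓘(ℝ, Euc n) (𝓡 n) ∞ g) :
    ContDiff ℝ ∞ fun v => velocity φ t (g v) := by
  have h1 := hφ.contDiffOn_comp ((φ t).symm.contMDiff.comp hg)
  set Ψ : ℝ × Euc n → Euc (n + 1) := fun q => (φ q.1 (((φ t).symm ∘ g) q.2) : Euc (n + 1)) with hΨ
  have h2 := h1.fderivWithin uniqueDiffOn_Icc_prod_univ (m := ∞) (by norm_cast)
  have h3 : ContDiff ℝ ∞ fun v : Euc n =>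
      fderivWithin ℝ Ψ (Set.Icc (0 : ℝ) 1 ×ˢ Set.univ) (t, v) := by
    rw [← contDiffOn_univ]
    exact h2.comp (f := fun v : Euc n => (t, v)) (by fun_prop) (fun v _ => Set.mk_mem_prod ht (Set.mem_univ _))
  have h4 : (fun v => velocity φ t (g v)) = fun v =>
      fderivWithin ℝ Ψ (Set.Icc (0 : ℝ) 1 ×ˢ Set.univ) (t, v) (1, 0) := by
    funext v
    have h5 : HasFDerivWithinAt Ψ (fderivWithin ℝ Ψ (Set.Icc (0 : ℝ) 1 ×ˢ Set.univ) (t, v))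
        (Set.Icc (0 : ℝ) 1 ×ˢ Set.univ) (t, v) :=
      (h1.differentiableOn (by simp) (t, v) ⟨ht, Set.mem_univ _⟩).hasFDerivWithinAt
    have h6 : HasDerivWithinAt (fun s : ℝ => (s, v)) ((1 : ℝ), (0 : Euc n)) (Set.Icc (0 : ℝ) 1) t :=
      (hasDerivWithinAt_id t _).prodMk (hasDerivWithinAt_const t _ v)
    have h7 := h5.comp_hasDerivWithinAt t h6 (fun s hs => Set.mk_mem_prod hs (Set.mem_univ v))
    exact h7.derivWithin (uniqueDiffOn_Icc zero_lt_one t ht)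
  rw [h4]
  exact h3.clm_apply contDiff_const

theorem IsSmoothPath.contDiff_localRep_velocity (hφ : IsSmoothPath φ₀ φ₁ φ) {t : ℝ}
    (ht : t ∈ Set.Icc (0 : ℝ) 1) (𝒰 : NormalCover n) (a : Fin 𝒰.m) :
    ContDiff ℝ ∞ (𝒰.localRep (velocity φ t) a) := by
  have : 𝒰.localRep (velocity φ t) a = fun v =>
      𝒰.chartMap a v (velocity φ t (expSph (𝒰.center a) (𝒰.frame a) v)) := by
    funext v
    exact NormalCover.localRep_eq_chartMap (hφ.inner_velocity ht) v
  rw [this]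
  exact (𝒰.contDiff_chartMap a).clm_apply (hφ.contDiff_velocity_comp ht (contMDiff_expSph _ _))

end Velocity

/-! ### The lower bound -/

section LowerBound

variable {n : ℕ}

theorem exists_inner_eq_zero (hn : 1 ≤ n) (x : Sph n) :
    ∃ e : Sph n, inner ℝ (x : Euc (n + 1)) (e : Euc (n + 1)) = 0 := by
  have hne : (x : Euc (n + 1)) ≠ 0 := by
    rw [← norm_ne_zero_iff, norm_coe_sph]; exact one_ne_zero
  have : Fact (Module.finrank ℝ (Euc (n + 1)) = n + 1) := ⟨finrank_euclideanSpace_fin⟩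
  have hdim := Submodule.finrank_orthogonal_span_singleton (𝕜 := ℝ) (n := n) hne
  have : Nontrivial (Submodule.span ℝ {(x : Euc (n + 1))})ᗮ :=
    Module.nontrivial_of_finrank_pos (R := ℝ) (by omega)
  obtain ⟨d, hd⟩ := exists_norm_eq (Submodule.span ℝ {(x : Euc (n + 1))})ᗮ (zero_le_one (α := ℝ))
  exact ⟨⟨d, by simpa using hd⟩, Submodule.mem_orthogonal_singleton_iff_inner_right.1 d.2⟩

theorem norm_sub_lt_of_mem_geoBall {x y : Sph n} {δ : ℝ} (hy : y ∈ geoBall x δ) :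
    ‖(y : Euc (n + 1)) - x‖ < δ := by
  have hy' : InnerProductGeometry.angle (x : Euc (n + 1)) (y : Euc (n + 1)) < δ := hy
  refine lt_of_le_of_lt ?_ hy'
  refine (sq_le_sq₀ (norm_nonneg _) (InnerProductGeometry.angle_nonneg _ _)).1 ?_
  rw [norm_sub_sq_real, norm_coe_sph, norm_coe_sph, real_inner_comm, ← cos_angle_sph]
  linarith [Real.one_sub_sq_div_two_le_cos
    (x := InnerProductGeometry.angle (x : Euc (n + 1)) (y : Euc (n + 1)))]

/-- Along a smooth path the logarithm of the distance between two trajectories changes at most by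
the length of the path. -/
theorem NormalCover.exists_log_sub_log_le_pathLength (𝒰 : NormalCover n) (hn : 1 ≤ n) {p s : ℝ}
    (hp : 1 ≤ p) (hs : 1 + (n : ℝ) / p < s) : ∃ C : ℝ, 0 < C ∧
    ∀ (φ₀ φ₁ : DiffSph n) (φ : ℝ → DiffSph n), IsSmoothPath φ₀ φ₁ φ → ∀ y z : Sph n, y ≠ z →
      ENNReal.ofReal (Real.log ‖(φ₀ y : Euc (n + 1)) - φ₀ z‖ -
        Real.log ‖(φ₁ y : Euc (n + 1)) - φ₁ z‖) ≤ ENNReal.ofReal C * 𝒰.pathLength s p φ := by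
  obtain ⟨C, hC, H⟩ := 𝒰.exists_enorm_sub_le_vfNorm hn hp hs
  refine ⟨C, hC, fun φ₀ φ₁ φ hφ y z hyz => ?_⟩
  set d : ℝ → Euc (n + 1) := fun t => (φ t y : Euc (n + 1)) - φ t z with hd
  have hd0 : ∀ t, d t ≠ 0 := fun t h =>
    hyz ((φ t).injective (Subtype.ext (sub_eq_zero.1 h)))
  have hdpos : ∀ t, 0 < ‖d t‖ := fun t => norm_pos_iff.2 (hd0 t)
  have hdc : ContDiffOn ℝ ∞ d (Set.Icc 0 1) := (hφ.contDiffOn_apply y).sub (hφ.contDiffOn_apply z)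
  have hFc : ContDiffOn ℝ ∞ (fun t => Real.log ‖d t‖) (Set.Icc 0 1) :=
    (hdc.norm ℝ fun t _ => hd0 t).log fun t _ => (hdpos t).ne'
  have hle := enorm_sub_le_lintegral_derivWithin_Icc_of_contDiffOn_Icc (hFc.of_le (by norm_cast))
    zero_le_one
  have hdd : ∀ t ∈ Set.Icc (0 : ℝ) 1, ‖derivWithin (fun t => Real.log ‖d t‖) (Set.Icc 0 1) t‖ₑ ≤
      ENNReal.ofReal C * 𝒰.vfNorm s p (velocity φ t) := by
    intro t ht
    set w := velocity φ t (φ t y) - velocity φ t (φ t z) with hw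
    have h1 : HasDerivWithinAt d w (Set.Icc 0 1) t :=
      (hφ.hasDerivWithinAt y ht).sub (hφ.hasDerivWithinAt z ht)
    have h2 := (h1.norm_sq.log (by positivity [hdpos t])).const_mul (1 / 2 : ℝ)
    have he : (fun t => Real.log ‖d t‖) = fun t => 1 / 2 * Real.log (‖d t‖ ^ 2) := by
      funext t; rw [Real.log_pow]; push_cast; ring
    rw [he, h2.derivWithin (uniqueDiffOn_Icc zero_lt_one t ht)]
    have h3 : ‖1 / 2 * (2 * inner ℝ (d t) w / ‖d t‖ ^ 2)‖ₑ ≤ ENNReal.ofReal (‖d t‖⁻¹) * ‖w‖ₑ := by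
      rw [← ofReal_norm, ← ofReal_norm, ← ENNReal.ofReal_mul (by positivity)]
      apply ENNReal.ofReal_le_ofReal
      have e : 1 / 2 * (2 * inner ℝ (d t) w / ‖d t‖ ^ 2) = inner ℝ (d t) w / ‖d t‖ ^ 2 := by ring
      rw [e, norm_div, norm_pow, norm_norm, div_le_iff₀ (by positivity [hdpos t])]
      refine (norm_inner_le_norm _ _).trans_eq ?_
      have := (hdpos t).ne'
      field_simp
    refine h3.trans ((mul_le_mul_right (H _ (hφ.inner_velocity ht)
      (fun a => hφ.contDiff_localRep_velocity ht 𝒰 a) _ _) _).trans_eq ?_)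
    rw [← mul_assoc, ← ENNReal.ofReal_mul (by positivity)]
    congr 2
    have := (hdpos t).ne'
    change ‖d t‖⁻¹ * (C * ‖d t‖) = C
    field_simp
  have hfin : ‖Real.log ‖d 1‖ - Real.log ‖d 0‖‖ₑ ≤ ENNReal.ofReal C * 𝒰.pathLength s p φ := by
    refine hle.trans ((setLIntegral_mono' measurableSet_Icc hdd).trans_eq ?_)
    rw [lintegral_const_mul' _ _ ENNReal.ofReal_ne_top]; rfl
  have h0 : φ 0 = φ₀ := hφ.2.1
  have h1 : φ 1 = φ₁ := hφ.2.2
  simp only [hd, h0, h1] at hfin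
  refine le_trans ?_ hfin
  rw [← ofReal_norm, norm_sub_rev (Real.log _)]
  exact ENNReal.ofReal_le_ofReal (Real.le_norm_self _)

theorem NormalCover.exists_lt_displacementEnergy (𝒰 : NormalCover n) (hn : 1 ≤ n) {p s : ℝ}
    (hp : 1 ≤ p) (hs : 1 + (n : ℝ) / p < s) :
    ∃ c : ℝ, 0 < c ∧ ∀ (x : Sph n) (δ : ℝ), 0 < δ → δ < 1 →
      ENNReal.ofReal (c * |Real.log δ|) < 𝒰.displacementEnergy s p (geoBall x δ)ᶜ := by
  obtain ⟨C, hC, H⟩ := 𝒰.exists_log_sub_log_le_pathLength hn hp hs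
  -- The estimate holds with `1 / C`; halving it makes the inequality strict, as `|log δ| > 0`.
  refine ⟨1 / (2 * C), by positivity, fun x δ hδ0 hδ1 => ?_⟩
  have hlog : 0 < |Real.log δ| := abs_pos.2 (Real.log_neg hδ0 hδ1).ne
  have hmain : ENNReal.ofReal (1 / C * |Real.log δ|) ≤
      𝒰.displacementEnergy s p (geoBall x δ)ᶜ := by
    refine le_iInf₂ fun ψ hψ => le_iInf₂ fun φ hφ => ?_
    obtain ⟨e, he⟩ := exists_inner_eq_zero hn x
    -- Points orthogonal to the center are outside the ball because `δ < 1 < π / 2`, so displacement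
    -- forces their images into it.
    have hmem : ∀ y : Sph n, inner ℝ (x : Euc (n + 1)) (y : Euc (n + 1)) = 0 →
        ψ y ∈ geoBall x δ := by
      intro y hy
      by_contra hn
      have hyA : y ∈ (geoBall x δ)ᶜ := by
        intro h
        have h' : InnerProductGeometry.angle (x : Euc (n + 1)) (y : Euc (n + 1)) < δ := h
        rw [InnerProductGeometry.inner_eq_zero_iff_angle_eq_pi_div_two] at hy
        rw [hy] at h'
        linarith [Real.pi_gt_three]
      have : ψ y ∈ ψ '' (geoBall x δ)ᶜ ∩ (geoBall x δ)ᶜ := ⟨⟨y, hyA, rfl⟩, hn⟩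
      rw [hψ] at this
      exact this
    have h1 := norm_sub_lt_of_mem_geoBall (hmem e he)
    have h2 := norm_sub_lt_of_mem_geoBall (hmem (-e) (by simp [he]))
    have hne : e ≠ -e := by
      intro h
      have h3 : (e : Euc (n + 1)) = -e := congrArg Subtype.val h
      have h4 := norm_coe_sph e
      have h5 : (2 : ℝ) • (e : Euc (n + 1)) = 0 := by
        rw [two_smul]; nth_rewrite 2 [h3]; exact add_neg_cancel _
      rw [(smul_eq_zero.1 h5).resolve_left two_ne_zero, norm_zero] at h4
      exact zero_ne_one h4
    have h3 := H _ _ φ hφ e (-e) hne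
    have h4 : ‖(ψ e : Euc (n + 1)) - ψ (-e)‖ < 2 * δ := by
      have := norm_sub_le_norm_sub_add_norm_sub (ψ e : Euc (n + 1)) x (ψ (-e))
      rw [norm_sub_rev (x : Euc (n + 1))] at this
      linarith
    have h5 : 0 < ‖(ψ e : Euc (n + 1)) - ψ (-e)‖ :=
      norm_pos_iff.2 (sub_ne_zero.2 fun h => hne (ψ.injective (Subtype.ext h)))
    have h6 : ‖((Diffeomorph.refl (𝓡 n) (Sph n) ∞) e : Euc (n + 1)) -
        (Diffeomorph.refl (𝓡 n) (Sph n) ∞) (-e)‖ = 2 := by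
      have : ((Diffeomorph.refl (𝓡 n) (Sph n) ∞) e : Euc (n + 1)) -
        (Diffeomorph.refl (𝓡 n) (Sph n) ∞) (-e) = (2 : ℝ) • (e : Euc (n + 1)) := by
        simp [two_smul]
      rw [this, norm_smul, norm_coe_sph]; simp
    have h7 : |Real.log δ| ≤ Real.log 2 - Real.log ‖(ψ e : Euc (n + 1)) - ψ (-e)‖ := by
      have h8 := Real.log_le_log h5 h4.le
      rw [Real.log_mul two_ne_zero hδ0.ne'] at h8
      rw [abs_of_neg (Real.log_neg hδ0 hδ1)]
      linarith
    rw [h6] at h3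
    have h9 := (ENNReal.ofReal_le_ofReal h7).trans h3
    calc ENNReal.ofReal (1 / C * |Real.log δ|)
        = ENNReal.ofReal (1 / C) * ENNReal.ofReal |Real.log δ| := ENNReal.ofReal_mul (by positivity)
      _ ≤ ENNReal.ofReal (1 / C) * (ENNReal.ofReal C * 𝒰.pathLength s p φ) := by gcongr
      _ = 𝒰.pathLength s p φ := by
          rw [← mul_assoc, ← ENNReal.ofReal_mul (by positivity), one_div_mul_cancel hC.ne',
            ENNReal.ofReal_one, one_mul]
  refine lt_of_lt_of_le ?_ hmain
  rw [ENNReal.ofReal_lt_ofReal_iff (by positivity)]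
  have : 1 / (2 * C) = 1 / C / 2 := by field_simp
  rw [this]
  have : 0 < 1 / C * |Real.log δ| := by positivity
  linarith

end LowerBound

/-! ### A family of flows on the interval `[-1, 1]` -/

section HeightFlow

/-- The action of the conformal dilation of rapidity `a` on the height coordinate. -/
def boost (a h : ℝ) : ℝ := (h * Real.cosh a + Real.sinh a) / (Real.cosh a + h * Real.sinh a)

/-- The denominator is the convex combination of `exp a` and `exp (-a)` with weights `(1 + h) / 2`
and `(1 - h) / 2`. -/
theorem boost_denom_pos {h : ℝ} (hh : h ∈ Set.Icc (-1 : ℝ) 1) (a : ℝ) :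
    0 < Real.cosh a + h * Real.sinh a := by
  have h1 : 0 < Real.exp a := Real.exp_pos a
  have h2 : 0 < Real.exp (-a) := Real.exp_pos (-a)
  rw [Real.cosh_eq, Real.sinh_eq]
  by_cases h0 : h < 1
  · nlinarith [hh.1, hh.2, mul_nonneg (by linarith [hh.1] : 0 ≤ 1 + h) h1.le,
      mul_pos (by linarith : 0 < 1 - h) h2]
  · have : h = 1 := le_antisymm hh.2 (not_lt.1 h0)
    subst this; linarith

theorem one_sub_boost_sq {h : ℝ} (hh : h ∈ Set.Icc (-1 : ℝ) 1) (a : ℝ) :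
    1 - boost a h ^ 2 = (1 - h ^ 2) / (Real.cosh a + h * Real.sinh a) ^ 2 := by
  have hq := (boost_denom_pos hh a).ne'
  rw [boost]
  field_simp
  linear_combination (1 - h ^ 2) * Real.cosh_sq_sub_sinh_sq a

theorem boost_mem {h : ℝ} (hh : h ∈ Set.Icc (-1 : ℝ) 1) (a : ℝ) :
    boost a h ∈ Set.Icc (-1 : ℝ) 1 := by
  have h1 : 0 ≤ 1 - boost a h ^ 2 := by
    rw [one_sub_boost_sq hh]
    have : 0 ≤ 1 - h ^ 2 := by nlinarith [hh.1, hh.2]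
    positivity
  exact abs_le.1 ((sq_le_one_iff_abs_le_one _).1 (by linarith))

theorem boost_zero (h : ℝ) : boost 0 h = h := by simp [boost]

/-- This cocycle identity of the conformal factors is what makes rapidities add, for heights and for
the dilations of the sphere. -/
theorem boost_denom_add {h : ℝ} (hh : h ∈ Set.Icc (-1 : ℝ) 1) (a b : ℝ) :
    Real.cosh (a + b) + h * Real.sinh (a + b) =
      (Real.cosh b + h * Real.sinh b) * (Real.cosh a + boost b h * Real.sinh a) := by
  have hb : (Real.cosh b + h * Real.sinh b) * boost b h = h * Real.cosh b + Real.sinh b :=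
    mul_div_cancel₀ _ (boost_denom_pos hh b).ne'
  rw [Real.cosh_add, Real.sinh_add]
  linear_combination (-Real.sinh a) * hb

theorem boost_add {h : ℝ} (hh : h ∈ Set.Icc (-1 : ℝ) 1) (a b : ℝ) :
    boost (a + b) h = boost a (boost b h) := by
  have hq := (boost_denom_pos hh b).ne'
  have hq' := (boost_denom_pos (boost_mem hh b) a).ne'
  rw [boost, boost_denom_add hh, boost.eq_1 a, div_eq_div_iff (mul_ne_zero hq hq') hq', boost,
    Real.cosh_add, Real.sinh_add]
  field_simp
  ring

theorem hasDerivAt_boost {h : ℝ} (hh : h ∈ Set.Icc (-1 : ℝ) 1) (a : ℝ) :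
    HasDerivAt (fun a => boost a h) (1 - boost a h ^ 2) a := by
  have hq := (boost_denom_pos hh a).ne'
  have h1 : HasDerivAt (fun a => h * Real.cosh a + Real.sinh a)
      (h * Real.sinh a + Real.cosh a) a :=
    ((Real.hasDerivAt_cosh a).const_mul h).add (Real.hasDerivAt_sinh a)
  have h2 : HasDerivAt (fun a => Real.cosh a + h * Real.sinh a)
      (Real.sinh a + h * Real.cosh a) a :=
    (Real.hasDerivAt_cosh a).add ((Real.hasDerivAt_sinh a).const_mul h)
  refine (h1.div h2 hq).congr_deriv ?_
  simp only [boost]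
  field_simp
  ring

variable (γ η : ℝ)

/-- A bounded function on `[-1, 1]` whose derivative is almost singular at the end points. -/
def poleF (h : ℝ) : ℝ := (1 + η + h) ^ γ - (1 + η - h) ^ γ

/-- The derivative of the time of the flow with respect to the rapidity. -/
def poleD (h : ℝ) : ℝ :=
  γ * ((1 - h ^ 2) * ((1 + η + h) ^ (γ - 1) + (1 + η - h) ^ (γ - 1))) + η ^ γ

/-- The time that the flow needs to move the height `h` by the rapidity `a`. -/
def flowTime (h a : ℝ) : ℝ := poleF γ η (boost a h) - poleF γ η h + η ^ γ * a

/-- The rapidity by which the flow moves the height `h` in time `t`. -/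
def flowParam (t h : ℝ) : ℝ := Function.invFun (flowTime γ η h) t

variable {γ η} (hγ0 : 0 < γ) (hγ1 : γ ≤ 1) (hη : 0 < η)

include hη in
theorem hasDerivAt_poleF {h : ℝ} (hh : h ∈ Set.Icc (-1 : ℝ) 1) :
    HasDerivAt (poleF γ η) (γ * ((1 + η + h) ^ (γ - 1) + (1 + η - h) ^ (γ - 1))) h := by
  have h1 : HasDerivAt (fun h : ℝ => (1 + η + h) ^ γ) (1 * γ * (1 + η + h) ^ (γ - 1)) h :=
    ((hasDerivAt_id h).const_add (1 + η)).rpow_const (Or.inl (by simp only [id]; linarith [hh.1]))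
  have h2 : HasDerivAt (fun h : ℝ => (1 + η - h) ^ γ) (-1 * γ * (1 + η - h) ^ (γ - 1)) h :=
    ((hasDerivAt_id h).const_sub (1 + η)).rpow_const (Or.inl (by simp only [id]; linarith [hh.2]))
  refine (h1.sub h2).congr_deriv ?_
  ring

include hγ0 hγ1 hη in
-- Both bases lie in `[0, 3]` and `γ ≤ 1`, so both powers do as well. That the bound does not depend
-- on `η` is the reason why a fixed flow time suffices.
theorem abs_poleF_le (hη1 : η ≤ 1) {h : ℝ} (hh : h ∈ Set.Icc (-1 : ℝ) 1) : |poleF γ η h| ≤ 3 := by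
  have key : ∀ z : ℝ, 0 ≤ z → z ≤ 3 → 0 ≤ z ^ γ ∧ z ^ γ ≤ 3 := by
    intro z hz hz3
    refine ⟨Real.rpow_nonneg hz _, ?_⟩
    calc z ^ γ ≤ 3 ^ γ := Real.rpow_le_rpow hz hz3 hγ0.le
      _ ≤ 3 ^ (1 : ℝ) := Real.rpow_le_rpow_of_exponent_le (by norm_num) hγ1
      _ = 3 := Real.rpow_one 3
  have h1 := key (1 + η + h) (by linarith [hh.1]) (by linarith [hh.2])
  have h2 := key (1 + η - h) (by linarith [hh.2]) (by linarith [hh.1])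
  rw [poleF, abs_le]
  constructor <;> linarith

include hγ0 hη in
theorem poleD_ge {h : ℝ} (hh : h ∈ Set.Icc (-1 : ℝ) 1) : η ^ γ ≤ poleD γ η h := by
  have h1 : 0 ≤ 1 - h ^ 2 := by nlinarith [hh.1, hh.2]
  have h2 : 0 ≤ 1 + η + h := by linarith [hh.1]
  have h3 : 0 ≤ 1 + η - h := by linarith [hh.2]
  rw [poleD]
  have : 0 ≤ γ * ((1 - h ^ 2) * ((1 + η + h) ^ (γ - 1) + (1 + η - h) ^ (γ - 1))) := by positivity
  linarith

include hη in
theorem hasDerivAt_flowTime {h : ℝ} (hh : h ∈ Set.Icc (-1 : ℝ) 1) (a : ℝ) :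
    HasDerivAt (flowTime γ η h) (poleD γ η (boost a h)) a := by
  have h1 := ((hasDerivAt_poleF (γ := γ) hη (boost_mem hh a)).comp a (hasDerivAt_boost hh a)).sub_const
    (poleF γ η h)
  refine (h1.add ((hasDerivAt_id a).const_mul (η ^ γ))).congr_deriv ?_
  simp only [poleD]
  ring

include hγ0 hη in
theorem flowTime_strictMono {h : ℝ} (hh : h ∈ Set.Icc (-1 : ℝ) 1) : StrictMono (flowTime γ η h) :=
  strictMono_of_hasDerivAt_pos (hasDerivAt_flowTime hη hh) fun a =>
    (Real.rpow_pos_of_pos hη γ).trans_le (poleD_ge hγ0 hη (boost_mem hh a))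

theorem flowTime_zero (h : ℝ) : flowTime γ η h 0 = 0 := by
  simp [flowTime, boost_zero]

theorem flowTime_add {h : ℝ} (hh : h ∈ Set.Icc (-1 : ℝ) 1) (a b : ℝ) :
    flowTime γ η h (a + b) = flowTime γ η (boost b h) a + flowTime γ η h b := by
  rw [flowTime, flowTime, flowTime, boost_add hh]
  ring

include hγ0 hγ1 hη in
-- The error is a difference of two values of `poleF`. Passing from one pole to the other thus costs
-- a bounded time; any further rapidity is gained at rate `η ^ (-γ)`.
theorem abs_flowTime_sub_le (hη1 : η ≤ 1) {h : ℝ} (hh : h ∈ Set.Icc (-1 : ℝ) 1) (a : ℝ) :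
    |flowTime γ η h a - η ^ γ * a| ≤ 6 := by
  have h1 := abs_le.1 (abs_poleF_le hγ0 hγ1 hη hη1 hh)
  have h2 := abs_le.1 (abs_poleF_le hγ0 hγ1 hη hη1 (boost_mem hh a))
  rw [flowTime, abs_le]
  constructor <;> linarith [h1.1, h1.2, h2.1, h2.2]

include hγ0 hγ1 hη in
theorem flowTime_surjective (hη1 : η ≤ 1) {h : ℝ} (hh : h ∈ Set.Icc (-1 : ℝ) 1) :
    Function.Surjective (flowTime γ η h) := by
  have hc : Continuous (flowTime γ η h) :=
    continuous_iff_continuousAt.2 fun a => (hasDerivAt_flowTime hη hh a).continuousAt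
  have hpos : 0 < η ^ γ := Real.rpow_pos_of_pos hη γ
  have hb := fun a => abs_le.1 (abs_flowTime_sub_le hγ0 hγ1 hη hη1 hh a)
  refine hc.surjective ?_ ?_
  · refine Filter.tendsto_atTop_mono (f := fun a => η ^ γ * a + (-6)) (fun a => by linarith [(hb a).1]) ?_
    exact Filter.tendsto_atTop_add_const_right _ _ (Filter.tendsto_id.const_mul_atTop hpos)
  · refine Filter.tendsto_atBot_mono (f := fun a => η ^ γ * a + 6) (fun a => by linarith [(hb a).2]) ?_
    exact Filter.tendsto_atBot_add_const_right _ _ (Filter.tendsto_id.const_mul_atBot hpos)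

include hγ0 hγ1 hη in
theorem flowTime_flowParam (hη1 : η ≤ 1) {h : ℝ} (hh : h ∈ Set.Icc (-1 : ℝ) 1) (t : ℝ) :
    flowTime γ η h (flowParam γ η t h) = t :=
  Function.invFun_eq (flowTime_surjective hγ0 hγ1 hη hη1 hh t)

include hγ0 hγ1 hη in
theorem flowParam_unique (hη1 : η ≤ 1) {h : ℝ} (hh : h ∈ Set.Icc (-1 : ℝ) 1) {t a : ℝ}
    (ha : flowTime γ η h a = t) : flowParam γ η t h = a :=
  (flowTime_strictMono hγ0 hη hh).injective
    ((flowTime_flowParam hγ0 hγ1 hη hη1 hh t).trans ha.symm)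

include hγ0 hγ1 hη in
-- By the cocycle rule for `flowTime`, going back by the same rapidity takes the opposite time; this
-- inverts the flow.
theorem flowParam_neg_boost (hη1 : η ≤ 1) {h : ℝ} (hh : h ∈ Set.Icc (-1 : ℝ) 1) (t : ℝ) :
    flowParam γ η (-t) (boost (flowParam γ η t h) h) = -flowParam γ η t h := by
  refine flowParam_unique hγ0 hγ1 hη hη1 (boost_mem hh _) ?_
  have := flowTime_add (γ := γ) (η := η) hh (-flowParam γ η t h) (flowParam γ η t h)
  rw [neg_add_cancel, flowTime_zero, flowTime_flowParam hγ0 hγ1 hη hη1 hh] at this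
  linarith

theorem contDiffAt_boost {a h : ℝ} (hq : Real.cosh a + h * Real.sinh a ≠ 0) :
    ContDiffAt ℝ ∞ (fun q : ℝ × ℝ => boost q.2 q.1) (h, a) := by
  have hc : ContDiff ℝ ∞ (fun q : ℝ × ℝ => Real.cosh q.2) := Real.contDiff_cosh.comp contDiff_snd
  have hs : ContDiff ℝ ∞ (fun q : ℝ × ℝ => Real.sinh q.2) := Real.contDiff_sinh.comp contDiff_snd
  exact ((contDiff_fst.mul hc).add hs).contDiffAt.div (hc.add (contDiff_fst.mul hs)).contDiffAt hq

include hη in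
theorem contDiffAt_poleF {h : ℝ} (hh : h ∈ Set.Icc (-1 : ℝ) 1) : ContDiffAt ℝ ∞ (poleF γ η) h := by
  have h1 : ContDiffAt ℝ ∞ (fun h : ℝ => 1 + η + h) h := by fun_prop
  have h2 : ContDiffAt ℝ ∞ (fun h : ℝ => 1 + η - h) h := by fun_prop
  exact (h1.rpow_const_of_ne (by linarith [hh.1])).sub (h2.rpow_const_of_ne (by linarith [hh.2]))

include hη in
theorem contDiffAt_flowTime {h : ℝ} (hh : h ∈ Set.Icc (-1 : ℝ) 1) (a : ℝ) :
    ContDiffAt ℝ ∞ (fun q : ℝ × ℝ => flowTime γ η q.1 q.2) (h, a) := by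
  have h1 : ContDiffAt ℝ ∞ (fun q : ℝ × ℝ => poleF γ η (boost q.2 q.1)) (h, a) :=
    (contDiffAt_poleF (γ := γ) hη (boost_mem hh a)).comp (f := fun q : ℝ × ℝ => boost q.2 q.1) (h, a)
      (contDiffAt_boost (boost_denom_pos hh a).ne')
  have h2 : ContDiffAt ℝ ∞ (fun q : ℝ × ℝ => poleF γ η q.1) (h, a) :=
    (contDiffAt_poleF (γ := γ) hη hh).comp (f := Prod.fst) (h, a) contDiffAt_fst
  exact (h1.sub h2).add (contDiffAt_const.mul contDiffAt_snd)

include hγ0 hγ1 hη in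
/-- The rapidity agrees, at heights in `[-1, 1]`, with a smooth function defined near the height. -/
theorem exists_contDiffAt_flowParam (hη1 : η ≤ 1) (t : ℝ) {h : ℝ} (hh : h ∈ Set.Icc (-1 : ℝ) 1) :
    ∃ ψ : ℝ × ℝ → ℝ, ContDiffAt ℝ ∞ ψ (t, h) ∧ ψ (t, h) = flowParam γ η t h ∧
      ∀ᶠ q in nhds (t, h), q.2 ∈ Set.Icc (-1 : ℝ) 1 → flowParam γ η q.1 q.2 = ψ q := by
  set a := flowParam γ η t h with ha
  have hta : flowTime γ η h a = t := flowTime_flowParam hγ0 hγ1 hη hη1 hh t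
  set f : (ℝ × ℝ) × ℝ → ℝ := fun q => flowTime γ η q.1.2 q.2 - q.1.1 with hf
  have hcd : ContDiffAt ℝ ∞ f ((t, h), a) := by
    have h1 : ContDiffAt ℝ ∞ (fun q : (ℝ × ℝ) × ℝ => flowTime γ η q.1.2 q.2) ((t, h), a) :=
      (contDiffAt_flowTime (γ := γ) hη hh a).comp (f := fun q : (ℝ × ℝ) × ℝ => (q.1.2, q.2))
        ((t, h), a) (by fun_prop)
    exact h1.sub (by fun_prop)
  -- The partial derivative in the rapidity is `poleD ≥ η ^ γ > 0`, as the implicit function theorem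
  -- requires.
  have hinv : (fderiv ℝ f ((t, h), a) ∘L .inr ℝ (ℝ × ℝ) ℝ).IsInvertible := by
    have h1 : HasDerivAt (fun b => f ((t, h), b)) (poleD γ η (boost a h)) a :=
      (hasDerivAt_flowTime hη hh a).sub_const t
    have h2 : HasFDerivAt (fun b : ℝ => (((t, h), b) : (ℝ × ℝ) × ℝ)) (.inr ℝ (ℝ × ℝ) ℝ) a :=
      hasFDerivAt_prodMk_right _ _
    have h3 := ((hcd.differentiableAt (by simp)).hasFDerivAt).comp a h2
    have h4 := h3.unique h1.hasFDerivAt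
    have hpos := ((Real.rpow_pos_of_pos hη γ).trans_le (poleD_ge hγ0 hη (boost_mem hh a))).ne'
    rw [h4]
    refine ⟨ContinuousLinearEquiv.unitsEquivAut ℝ (Units.mk0 _ hpos), ?_⟩
    ext
    simp
  refine ⟨hcd.implicitFunction (by simp) hinv, hcd.contDiffAt_implicitFunction (by simp) hinv,
    hcd.implicitFunction_apply_self (by simp) hinv, ?_⟩
  filter_upwards [hcd.eventually_apply_implicitFunction (by simp) hinv] with q hq hq2
  refine flowParam_unique hγ0 hγ1 hη hη1 hq2 ?_
  simp only [hf, hta, sub_self] at hq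
  linarith

end HeightFlow

/-! ### Conformal dilations and the polar flow on the sphere -/

section PolarFlow

variable {n : ℕ}

/-- The conformal dilation of the sphere with rapidity `a` towards the pole `y`. -/
def dilation (y : Euc (n + 1)) (a : ℝ) (x : Euc (n + 1)) : Euc (n + 1) :=
  (Real.cosh a + inner ℝ x y * Real.sinh a)⁻¹ •
    ((inner ℝ x y * Real.cosh a + Real.sinh a) • y + (x - inner ℝ x y • y))

theorem inner_sph_mem (x y : Sph n) :
    inner ℝ (x : Euc (n + 1)) (y : Euc (n + 1)) ∈ Set.Icc (-1 : ℝ) 1 := by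
  have := abs_real_inner_le_norm (x : Euc (n + 1)) (y : Euc (n + 1))
  rw [norm_coe_sph, norm_coe_sph, one_mul] at this
  exact abs_le.1 this

theorem inner_self_sph (y : Sph n) : inner ℝ (y : Euc (n + 1)) (y : Euc (n + 1)) = 1 := by
  rw [real_inner_self_eq_norm_sq, norm_coe_sph]; norm_num

theorem inner_dilation (x y : Sph n) (a : ℝ) : inner ℝ (dilation (y : Euc (n + 1)) a x) (y : Euc (n + 1)) =
    boost a (inner ℝ (x : Euc (n + 1)) (y : Euc (n + 1))) := by
  rw [dilation, inner_smul_left, inner_add_left, inner_smul_left, inner_sub_left, inner_smul_left,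
    inner_self_sph, boost]
  simp
  ring

theorem norm_dilation (x y : Sph n) (a : ℝ) : ‖dilation (y : Euc (n + 1)) a x‖ = 1 := by
  have hq := boost_denom_pos (inner_sph_mem x y) a
  set h := inner ℝ (x : Euc (n + 1)) (y : Euc (n + 1)) with hh
  have h1 : ‖(h * Real.cosh a + Real.sinh a) • (y : Euc (n + 1)) + ((x : Euc (n + 1)) - h • (y : Euc (n + 1)))‖ ^ 2 =
      (Real.cosh a + h * Real.sinh a) ^ 2 := by
    rw [← real_inner_self_eq_norm_sq]
    have hyx : inner ℝ (y : Euc (n + 1)) (x : Euc (n + 1)) = h := by rw [real_inner_comm]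
    simp only [inner_add_left, inner_add_right, inner_sub_left, inner_sub_right, inner_smul_left,
      inner_smul_right, inner_self_sph, hyx, ← hh]
    simp
    linear_combination (h ^ 2 - 1) * Real.cosh_sq_sub_sinh_sq a
  rw [dilation, norm_smul, ← hh, norm_inv, Real.norm_of_nonneg hq.le,
    (pow_left_inj₀ (norm_nonneg _) hq.le two_ne_zero).1 h1, inv_mul_cancel₀ hq.ne']

theorem dilation_zero (x y : Euc (n + 1)) : dilation y 0 x = x := by
  simp [dilation]

theorem dilation_dilation (x y : Sph n) (a b : ℝ) :
    dilation (y : Euc (n + 1)) a (dilation (y : Euc (n + 1)) b x) = dilation (y : Euc (n + 1)) (a + b) x := by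
  have hh := inner_sph_mem x y
  have hq := (boost_denom_pos hh b).ne'
  have hq' := (boost_denom_pos (boost_mem hh b) a).ne'
  have e := inner_dilation x y b
  have eb := boost_denom_add hh a b
  have ea := boost_add hh a b
  set h := inner ℝ (x : Euc (n + 1)) (y : Euc (n + 1)) with hhd
  set β := boost b h with hβ
  have key : ∀ c : ℝ, dilation (y : Euc (n + 1)) c x = boost c h • (y : Euc (n + 1)) +
      (Real.cosh c + h * Real.sinh c)⁻¹ • ((x : Euc (n + 1)) - h • (y : Euc (n + 1))) := by
    intro c
    rw [dilation, ← hhd, smul_add, smul_smul, boost, div_eq_inv_mul]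
  rw [key (a + b), dilation, e, key b, eb, mul_inv, smul_add, smul_smul, ← div_eq_inv_mul, ea,
    add_sub_cancel_left, smul_smul, mul_comm (Real.cosh b + h * Real.sinh b)⁻¹]
  rfl

theorem hasDerivAt_dilation (x y : Sph n) (a : ℝ) :
    HasDerivAt (fun a => dilation (y : Euc (n + 1)) a x)
      ((y : Euc (n + 1)) - inner ℝ (dilation (y : Euc (n + 1)) a x) (y : Euc (n + 1)) •
        dilation (y : Euc (n + 1)) a x) a := by
  have hq := (boost_denom_pos (inner_sph_mem x y) a).ne'
  rw [inner_dilation]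
  simp only [dilation]
  set h := inner ℝ (x : Euc (n + 1)) (y : Euc (n + 1)) with hh
  have h1 : HasDerivAt (fun a => h * Real.cosh a + Real.sinh a)
      (h * Real.sinh a + Real.cosh a) a :=
    ((Real.hasDerivAt_cosh a).const_mul h).add (Real.hasDerivAt_sinh a)
  have h2 : HasDerivAt (fun a => Real.cosh a + h * Real.sinh a)
      (Real.sinh a + h * Real.cosh a) a :=
    (Real.hasDerivAt_cosh a).add ((Real.hasDerivAt_sinh a).const_mul h)
  refine ((h2.fun_inv hq).fun_smul ((h1.smul_const (y : Euc (n + 1))).add_const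
    ((x : Euc (n + 1)) - h • (y : Euc (n + 1))))).congr_deriv ?_
  have h3 := Real.cosh_sq a
  rw [boost]
  generalize Real.cosh a = c at *
  generalize Real.sinh a = d at *
  match_scalars
  · field_simp
    ring
  · field_simp
    ring

theorem contDiffAt_dilation {y : Euc (n + 1)} {a : ℝ} {x : Euc (n + 1)}
    (hq : Real.cosh a + inner ℝ x y * Real.sinh a ≠ 0) :
    ContDiffAt ℝ ∞ (fun q : ℝ × Euc (n + 1) => dilation y q.1 q.2) (a, x) := by
  have hc : ContDiff ℝ ∞ (fun q : ℝ × Euc (n + 1) => Real.cosh q.1) :=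
    Real.contDiff_cosh.comp contDiff_fst
  have hs : ContDiff ℝ ∞ (fun q : ℝ × Euc (n + 1) => Real.sinh q.1) :=
    Real.contDiff_sinh.comp contDiff_fst
  have hi : ContDiff ℝ ∞ (fun q : ℝ × Euc (n + 1) => inner ℝ q.2 y) :=
    contDiff_snd.inner ℝ contDiff_const
  refine ContDiffAt.smul ((hc.add (hi.mul hs)).contDiffAt.inv hq) ?_
  exact ((((hi.mul hc).add hs).smul contDiff_const).add
    (contDiff_snd.sub (hi.smul contDiff_const))).contDiffAt

variable {γ η : ℝ}

/-- The flow of the polar vector field with pole `y`. -/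
def polarFlow (γ η : ℝ) (y : Sph n) (t : ℝ) (x : Sph n) : Sph n :=
  ⟨dilation (y : Euc (n + 1)) (flowParam γ η t (inner ℝ (x : Euc (n + 1)) (y : Euc (n + 1)))) x, by
    rw [mem_sphere_zero_iff_norm, norm_dilation]⟩

theorem inner_polarFlow (x y : Sph n) (t : ℝ) :
    inner ℝ (polarFlow γ η y t x : Euc (n + 1)) (y : Euc (n + 1)) =
      boost (flowParam γ η t (inner ℝ (x : Euc (n + 1)) (y : Euc (n + 1))))
        (inner ℝ (x : Euc (n + 1)) (y : Euc (n + 1))) :=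
  inner_dilation x y _

variable (hγ0 : 0 < γ) (hγ1 : γ ≤ 1) (hη : 0 < η) (hη1 : η ≤ 1)

include hγ0 hγ1 hη hη1

theorem polarFlow_neg (y : Sph n) (t : ℝ) (x : Sph n) :
    polarFlow γ η y (-t) (polarFlow γ η y t x) = x := by
  apply Subtype.ext
  change dilation (y : Euc (n + 1)) (flowParam γ η (-t) (inner ℝ (polarFlow γ η y t x : Euc (n + 1))
    (y : Euc (n + 1)))) (dilation (y : Euc (n + 1)) _ x) = x
  rw [inner_polarFlow, flowParam_neg_boost hγ0 hγ1 hη hη1 (inner_sph_mem x y), dilation_dilation,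
    neg_add_cancel, dilation_zero]

theorem polarFlow_zero (y x : Sph n) : polarFlow γ η y 0 x = x := by
  apply Subtype.ext
  change dilation (y : Euc (n + 1)) (flowParam γ η 0 _) x = x
  rw [flowParam_unique hγ0 hγ1 hη hη1 (inner_sph_mem x y) (flowTime_zero _), dilation_zero]

/-- The rapidity is only controlled for heights in `[-1, 1]`. Near each point it is replaced by a
smooth function on the ambient space, which agrees with it along the sphere. -/
theorem contMDiff_polarFlow (y : Sph n) :
    ContMDiff (𝓘(ℝ, ℝ).prod (𝓡 n)) (𝓡 n) ∞ (fun q : ℝ × Sph n => polarFlow γ η y q.1 q.2) := by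
  refine contMDiff_codRestrict_sph (f := fun q : ℝ × Sph n => dilation (y : Euc (n + 1))
    (flowParam γ η q.1 (inner ℝ (q.2 : Euc (n + 1)) (y : Euc (n + 1)))) q.2) ?_ _
  rintro ⟨t, x⟩
  have hh := inner_sph_mem x y
  obtain ⟨ψ, hψ, hψe, hev⟩ := exists_contDiffAt_flowParam hγ0 hγ1 hη hη1 t hh
  have hc : ContDiff ℝ ∞ fun q : ℝ × Euc (n + 1) => (q.1, inner ℝ q.2 (y : Euc (n + 1))) :=
    contDiff_fst.prodMk (contDiff_snd.inner ℝ contDiff_const)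
  have h1 : ContDiffAt ℝ ∞ (fun q : ℝ × Euc (n + 1) =>
      dilation (y : Euc (n + 1)) (ψ (q.1, inner ℝ q.2 (y : Euc (n + 1)))) q.2) (t, (x : Euc (n + 1))) := by
    have h2 : ContDiffAt ℝ ∞ (fun q : ℝ × Euc (n + 1) =>
        (ψ (q.1, inner ℝ q.2 (y : Euc (n + 1))), q.2)) (t, (x : Euc (n + 1))) :=
      (hψ.comp (f := fun q : ℝ × Euc (n + 1) => (q.1, inner ℝ q.2 (y : Euc (n + 1))))
        (t, (x : Euc (n + 1))) hc.contDiffAt).prodMk contDiffAt_snd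
    exact (contDiffAt_dilation (y := (y : Euc (n + 1))) (boost_denom_pos hh _).ne').comp
      (f := fun q : ℝ × Euc (n + 1) => (ψ (q.1, inner ℝ q.2 (y : Euc (n + 1))), q.2))
      (t, (x : Euc (n + 1))) h2
  have h3 : ContMDiff (𝓘(ℝ, ℝ).prod (𝓡 n)) 𝓘(ℝ, ℝ × Euc (n + 1)) ∞
      (fun q : ℝ × Sph n => (q.1, (q.2 : Euc (n + 1)))) := by
    rw [modelWithCornersSelf_prod, ← chartedSpaceSelf_prod]
    exact contMDiff_fst.prodMk (contMDiff_coe_sph.comp contMDiff_snd)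
  have h4 := ContMDiffAt.comp (t, x) (f := fun q : ℝ × Sph n => (q.1, (q.2 : Euc (n + 1))))
    h1.contMDiffAt (h3 (t, x))
  refine h4.congr_of_eventuallyEq ?_
  have hcont : Filter.Tendsto (fun q : ℝ × Sph n => (q.1, inner ℝ (q.2 : Euc (n + 1)) (y : Euc (n + 1))))
      (nhds (t, x)) (nhds (t, inner ℝ (x : Euc (n + 1)) (y : Euc (n + 1)))) := by
    refine Continuous.tendsto (f := fun q : ℝ × Sph n =>
      (q.1, inner ℝ (q.2 : Euc (n + 1)) (y : Euc (n + 1)))) ?_ (t, x)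
    exact hc.continuous.comp (g := fun q : ℝ × Euc (n + 1) => (q.1, inner ℝ q.2 (y : Euc (n + 1))))
      (f := fun q : ℝ × Sph n => (q.1, (q.2 : Euc (n + 1)))) (by fun_prop)
  filter_upwards [hcont.eventually hev] with q hq
  simp only [Function.comp_apply]
  rw [hq (inner_sph_mem q.2 y)]

theorem contMDiff_polarFlow_apply (y : Sph n) (t : ℝ) :
    ContMDiff (𝓡 n) (𝓡 n) ∞ (polarFlow γ η y t) :=
  ContMDiff.comp (g := fun q : ℝ × Sph n => polarFlow γ η y q.1 q.2) (f := fun x => (t, x))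
    (contMDiff_polarFlow hγ0 hγ1 hη hη1 y) (contMDiff_const.prodMk contMDiff_id)

/-- The polar flow at a fixed time as a diffeomorphism. -/
def polarDiffeo (y : Sph n) (t : ℝ) : DiffSph n where
  toFun := polarFlow γ η y t
  invFun := polarFlow γ η y (-t)
  left_inv := polarFlow_neg hγ0 hγ1 hη hη1 y t
  right_inv x := by simpa using polarFlow_neg hγ0 hγ1 hη hη1 y (-t) x
  contMDiff_toFun := contMDiff_polarFlow_apply hγ0 hγ1 hη hη1 y t
  contMDiff_invFun := contMDiff_polarFlow_apply hγ0 hγ1 hη hη1 y (-t)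

/-- The polar vector field with pole `y`. -/
def polarField (γ η : ℝ) (y x : Euc (n + 1)) : Euc (n + 1) :=
  (poleD γ η (inner ℝ x y))⁻¹ • (y - inner ℝ x y • x)

theorem hasDerivAt_polarFlow (y x : Sph n) (t : ℝ) :
    HasDerivAt (fun t => (polarFlow γ η y t x : Euc (n + 1)))
      (polarField γ η (y : Euc (n + 1)) (polarFlow γ η y t x)) t := by
  have hh := inner_sph_mem x y
  have hinv : HasDerivAt (fun t => flowParam γ η t (inner ℝ (x : Euc (n + 1)) (y : Euc (n + 1))))
      (poleD γ η (boost (flowParam γ η t (inner ℝ (x : Euc (n + 1)) (y : Euc (n + 1))))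
        (inner ℝ (x : Euc (n + 1)) (y : Euc (n + 1)))))⁻¹ t := by
    -- The inverse function rule needs continuity of the rapidity in `t`; the smooth local
    -- representative supplies it.
    refine HasDerivAt.of_local_left_inverse (f := flowTime γ η (inner ℝ (x : Euc (n + 1)) (y : Euc (n + 1))))
      ?_ (hasDerivAt_flowTime hη hh _)
      ((Real.rpow_pos_of_pos hη γ).trans_le (poleD_ge hγ0 hη (boost_mem hh _))).ne'
      (Filter.Eventually.of_forall fun s => flowTime_flowParam hγ0 hγ1 hη hη1 hh s)
    obtain ⟨ψ, hψ, hψe, hev⟩ := exists_contDiffAt_flowParam hγ0 hγ1 hη hη1 t hh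
    have h1 : ContinuousAt (fun s => ψ (s, inner ℝ (x : Euc (n + 1)) (y : Euc (n + 1)))) t :=
      hψ.continuousAt.comp (f := fun s : ℝ => (s, inner ℝ (x : Euc (n + 1)) (y : Euc (n + 1))))
        (by fun_prop)
    refine h1.congr ?_
    have h2 : Filter.Tendsto (fun s : ℝ => (s, inner ℝ (x : Euc (n + 1)) (y : Euc (n + 1)))) (nhds t)
        (nhds (t, inner ℝ (x : Euc (n + 1)) (y : Euc (n + 1)))) :=
      Continuous.tendsto (by fun_prop) t
    filter_upwards [h2.eventually hev] with s hs
    exact (hs hh).symm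
  have h := (hasDerivAt_dilation x y _).scomp t hinv
  rw [polarField, inner_polarFlow]
  refine h.congr_deriv ?_
  rw [inner_dilation]
  rfl

end PolarFlow

/-! ### Rotations and displacing paths -/

section Rotation

variable {n : ℕ}

/-- The generator of the rotations in the oriented plane `(y, z)`. -/
def rotGen (y z x : Euc (n + 1)) : Euc (n + 1) := inner ℝ x y • z - inner ℝ x z • y

/-- The rotation by the angle `θ` in the oriented plane `(y, z)`. -/
def rotation (y z : Euc (n + 1)) (θ : ℝ) (x : Euc (n + 1)) : Euc (n + 1) :=
  x + (Real.cos θ - 1) • (inner ℝ x y • y + inner ℝ x z • z) + Real.sin θ • rotGen y z x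

theorem rotation_smul (y z x : Euc (n + 1)) (θ c : ℝ) :
    rotation y z θ (c • x) = c • rotation y z θ x := by
  simp only [rotation, rotGen, inner_smul_left, RCLike.conj_to_real]
  module

theorem rotation_sub (y z x w : Euc (n + 1)) (θ : ℝ) :
    rotation y z θ (x - w) = rotation y z θ x - rotation y z θ w := by
  simp only [rotation, rotGen, inner_sub_left]
  module

theorem contDiff_rotation (y z : Euc (n + 1)) :
    ContDiff ℝ ∞ fun q : ℝ × Euc (n + 1) => rotation y z q.1 q.2 := by
  have hc : ContDiff ℝ ∞ fun q : ℝ × Euc (n + 1) => Real.cos q.1 :=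
    Real.contDiff_cos.comp contDiff_fst
  have hs : ContDiff ℝ ∞ fun q : ℝ × Euc (n + 1) => Real.sin q.1 :=
    Real.contDiff_sin.comp contDiff_fst
  have hi : ∀ w : Euc (n + 1), ContDiff ℝ ∞ fun q : ℝ × Euc (n + 1) => inner ℝ q.2 w := fun w =>
    contDiff_snd.inner ℝ contDiff_const
  exact (contDiff_snd.add ((hc.sub contDiff_const).smul (((hi y).smul contDiff_const).add
    ((hi z).smul contDiff_const)))).add
      (hs.smul (((hi y).smul contDiff_const).sub ((hi z).smul contDiff_const)))

theorem rotation_zero (y z x : Euc (n + 1)) : rotation y z 0 x = x := by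
  simp [rotation]

variable {y z : Sph n} (hyz : inner ℝ (y : Euc (n + 1)) (z : Euc (n + 1)) = 0)

include hyz

theorem inner_rotation_left (x : Euc (n + 1)) (θ : ℝ) :
    inner ℝ (rotation (y : Euc (n + 1)) z θ x) (y : Euc (n + 1)) =
      Real.cos θ * inner ℝ x (y : Euc (n + 1)) - Real.sin θ * inner ℝ x (z : Euc (n + 1)) := by
  have hzy : inner ℝ (z : Euc (n + 1)) (y : Euc (n + 1)) = 0 := by rw [real_inner_comm, hyz]
  simp only [rotation, rotGen, inner_add_left, inner_sub_left, inner_smul_left, inner_self_sph, hzy,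
    RCLike.conj_to_real]
  ring

theorem inner_rotation_right (x : Euc (n + 1)) (θ : ℝ) :
    inner ℝ (rotation (y : Euc (n + 1)) z θ x) (z : Euc (n + 1)) =
      Real.cos θ * inner ℝ x (z : Euc (n + 1)) + Real.sin θ * inner ℝ x (y : Euc (n + 1)) := by
  simp only [rotation, rotGen, inner_add_left, inner_sub_left, inner_smul_left, inner_self_sph, hyz,
    RCLike.conj_to_real]
  ring

theorem rotation_rotation (x : Euc (n + 1)) (θ θ' : ℝ) :
    rotation (y : Euc (n + 1)) z θ (rotation (y : Euc (n + 1)) z θ' x) =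
      rotation (y : Euc (n + 1)) z (θ + θ') x := by
  rw [rotation, rotGen, inner_rotation_left hyz, inner_rotation_right hyz, rotation, rotation,
    Real.cos_add, Real.sin_add, rotGen]
  module

theorem inner_rotation_rotation (x w : Euc (n + 1)) (θ : ℝ) :
    inner ℝ (rotation (y : Euc (n + 1)) z θ x) (rotation (y : Euc (n + 1)) z θ w) = inner ℝ x w := by
  have hzw : inner ℝ (z : Euc (n + 1)) w = inner ℝ w (z : Euc (n + 1)) := real_inner_comm _ _
  have hyw : inner ℝ (y : Euc (n + 1)) w = inner ℝ w (y : Euc (n + 1)) := real_inner_comm _ _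
  conv_lhs => rw [rotation.eq_1 _ _ _ w, rotGen]
  simp only [inner_add_right, inner_sub_right, inner_smul_right, inner_rotation_left hyz,
    inner_rotation_right hyz]
  simp only [rotation, rotGen, inner_add_left, inner_sub_left, inner_smul_left, hzw, hyw,
    RCLike.conj_to_real]
  linear_combination (inner ℝ x (y : Euc (n + 1)) * inner ℝ w (y : Euc (n + 1)) +
    inner ℝ x (z : Euc (n + 1)) * inner ℝ w (z : Euc (n + 1))) * Real.sin_sq_add_cos_sq θ

theorem norm_rotation (x : Euc (n + 1)) (θ : ℝ) : ‖rotation (y : Euc (n + 1)) z θ x‖ = ‖x‖ := by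
  rw [← pow_left_inj₀ (norm_nonneg _) (norm_nonneg _) two_ne_zero, ← real_inner_self_eq_norm_sq,
    inner_rotation_rotation hyz, real_inner_self_eq_norm_sq]

/-- The polar field is built from inner products alone, so isometries only move its pole, leaving
`γ` and `η` unchanged. -/
theorem rotation_polarField (γ η θ : ℝ) (w x : Euc (n + 1)) :
    rotation (y : Euc (n + 1)) z θ (polarField γ η w x) =
      polarField γ η (rotation (y : Euc (n + 1)) z θ w) (rotation (y : Euc (n + 1)) z θ x) := by
  rw [polarField, rotation_smul, rotation_sub, rotation_smul, polarField,
    inner_rotation_rotation hyz]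

theorem hasDerivAt_rotation {θ : ℝ → ℝ} {p : ℝ → Euc (n + 1)} {θ' t : ℝ} {p' : Euc (n + 1)}
    (hθ : HasDerivAt θ θ' t) (hp : HasDerivAt p p' t) :
    HasDerivAt (fun τ => rotation (y : Euc (n + 1)) z (θ τ) (p τ))
      (θ' • rotGen (y : Euc (n + 1)) z (rotation (y : Euc (n + 1)) z (θ t) (p t)) +
        rotation (y : Euc (n + 1)) z (θ t) p') t := by
  have hi : ∀ w : Euc (n + 1), HasDerivAt (fun τ => inner ℝ (p τ) w) (inner ℝ p' w) t := fun w => by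
    simpa using hp.inner ℝ (hasDerivAt_const t w)
  refine ((hp.add ((hθ.cos.sub_const 1).fun_smul
    (((hi y).smul_const (y : Euc (n + 1))).add ((hi z).smul_const (z : Euc (n + 1)))))).add
      (hθ.sin.fun_smul (((hi y).smul_const (z : Euc (n + 1))).sub
        ((hi z).smul_const (y : Euc (n + 1)))))).congr_deriv ?_
  rw [rotGen, inner_rotation_left hyz, inner_rotation_right hyz, rotation, rotGen]
  simp only [Pi.add_apply, Pi.sub_apply]
  module

/-- The rotations as maps of the sphere. -/
def rotationSph (θ : ℝ) (x : Sph n) : Sph n :=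
  ⟨rotation (y : Euc (n + 1)) z θ x, by
    rw [mem_sphere_zero_iff_norm, norm_rotation hyz, norm_coe_sph]⟩

theorem contMDiff_rotationSph :
    ContMDiff (𝓘(ℝ, ℝ).prod (𝓡 n)) (𝓡 n) ∞ fun q : ℝ × Sph n => rotationSph hyz q.1 q.2 := by
  refine contMDiff_codRestrict_sph
    (f := fun q : ℝ × Sph n => rotation (y : Euc (n + 1)) z q.1 q.2) ?_ _
  have h3 : ContMDiff (𝓘(ℝ, ℝ).prod (𝓡 n)) 𝓘(ℝ, ℝ × Euc (n + 1)) ∞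
      (fun q : ℝ × Sph n => (q.1, (q.2 : Euc (n + 1)))) := by
    rw [modelWithCornersSelf_prod, ← chartedSpaceSelf_prod]
    exact contMDiff_fst.prodMk (contMDiff_coe_sph.comp contMDiff_snd)
  exact ContMDiff.comp (f := fun q : ℝ × Sph n => (q.1, (q.2 : Euc (n + 1))))
    (contDiff_rotation (y : Euc (n + 1)) z).contMDiff h3

theorem contMDiff_rotationSph_apply (θ : ℝ) : ContMDiff (𝓡 n) (𝓡 n) ∞ (rotationSph hyz θ) :=
  ContMDiff.comp (g := fun q : ℝ × Sph n => rotationSph hyz q.1 q.2) (f := fun x => (θ, x))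
    (contMDiff_rotationSph hyz) (contMDiff_const.prodMk contMDiff_id)

theorem rotationSph_neg (θ : ℝ) (x : Sph n) :
    rotationSph hyz (-θ) (rotationSph hyz θ x) = x := by
  apply Subtype.ext
  change rotation (y : Euc (n + 1)) z (-θ) (rotation (y : Euc (n + 1)) z θ x) = x
  rw [rotation_rotation hyz, neg_add_cancel, rotation_zero]

/-- The rotations as diffeomorphisms of the sphere. -/
def rotationDiffeo (θ : ℝ) : DiffSph n where
  toFun := rotationSph hyz θ
  invFun := rotationSph hyz (-θ)
  left_inv := rotationSph_neg hyz θ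
  right_inv x := by simpa using rotationSph_neg hyz (-θ) x
  contMDiff_toFun := contMDiff_rotationSph_apply hyz θ
  contMDiff_invFun := contMDiff_rotationSph_apply hyz (-θ)

variable {γ η : ℝ} (hγ0 : 0 < γ) (hγ1 : γ ≤ 1) (hη : 0 < η) (hη1 : η ≤ 1)

/-- The polar flow away from `y`, followed by a half turn. -/
def displacingPath (T t : ℝ) : DiffSph n :=
  (polarDiffeo hγ0 hγ1 hη hη1 y (-(T * t))).trans (rotationDiffeo hyz (Real.pi * t))

theorem displacingPath_apply (T t : ℝ) (x : Sph n) :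
    displacingPath hyz hγ0 hγ1 hη hη1 T t x =
      rotationSph hyz (Real.pi * t) (polarFlow γ η y (-(T * t)) x) :=
  rfl

theorem isSmoothPath_displacingPath (T : ℝ) :
    IsSmoothPath (Diffeomorph.refl (𝓡 n) (Sph n) ∞) (displacingPath hyz hγ0 hγ1 hη hη1 T 1)
      (displacingPath hyz hγ0 hγ1 hη hη1 T) := by
  refine ⟨ContMDiff.contMDiffOn ?_, ?_, rfl⟩
  · have ha : ∀ c : ℝ, ContMDiff (𝓘(ℝ, ℝ).prod (𝓡 n)) 𝓘(ℝ, ℝ) ∞ fun q : ℝ × Sph n => c * q.1 :=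
      fun c => (contDiff_const.mul contDiff_id : ContDiff ℝ ∞ fun t : ℝ => c * t).contMDiff.comp
        contMDiff_fst
    have hb : ContMDiff (𝓘(ℝ, ℝ).prod (𝓡 n)) 𝓘(ℝ, ℝ) ∞ fun q : ℝ × Sph n => -(T * q.1) := by
      simpa only [neg_mul] using ha (-T)
    have h1 : ContMDiff (𝓘(ℝ, ℝ).prod (𝓡 n)) (𝓡 n) ∞
        fun q : ℝ × Sph n => polarFlow γ η y (-(T * q.1)) q.2 :=
      ContMDiff.comp (g := fun q : ℝ × Sph n => polarFlow γ η y q.1 q.2)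
        (f := fun q : ℝ × Sph n => (-(T * q.1), q.2))
        (contMDiff_polarFlow hγ0 hγ1 hη hη1 y) (hb.prodMk contMDiff_snd)
    exact ContMDiff.comp (g := fun q : ℝ × Sph n => rotationSph hyz q.1 q.2)
      (f := fun q : ℝ × Sph n => (Real.pi * q.1, polarFlow γ η y (-(T * q.1)) q.2))
      (contMDiff_rotationSph hyz) ((ha Real.pi).prodMk h1)
  · apply Diffeomorph.ext
    intro x
    rw [displacingPath_apply, mul_zero, mul_zero, neg_zero, polarFlow_zero hγ0 hγ1 hη hη1]
    exact Subtype.ext (rotation_zero _ _ _)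

/-- The composition contributes the generator of the rotations at the current point and the rotated
polar velocity. By equivariance the latter is a polar field at the rotated pole, evaluated at the
current point. -/
theorem velocity_displacingPath (T : ℝ) {t : ℝ} (ht : t ∈ Set.Icc (0 : ℝ) 1) (x : Sph n) :
    velocity (displacingPath hyz hγ0 hγ1 hη hη1 T) t x =
      Real.pi • rotGen (y : Euc (n + 1)) z x -
        T • polarField γ η (rotationSph hyz (Real.pi * t) y : Euc (n + 1)) x := by
  set u := (displacingPath hyz hγ0 hγ1 hη hη1 T t).symm x with hu
  have hx : rotation (y : Euc (n + 1)) z (Real.pi * t) (polarFlow γ η y (-(T * t)) u) = x :=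
    congrArg Subtype.val ((displacingPath hyz hγ0 hγ1 hη hη1 T t).apply_symm_apply x)
  have hT : HasDerivAt (fun τ => -(T * τ)) (-T) t := by
    simpa using ((hasDerivAt_id t).const_mul T).fun_neg
  have hπ : HasDerivAt (fun τ => Real.pi * τ) Real.pi t := by
    simpa using (hasDerivAt_id t).const_mul Real.pi
  have h1 : HasDerivAt (fun τ => (polarFlow γ η y (-(T * τ)) u : Euc (n + 1)))
      (-T • polarField γ η (y : Euc (n + 1)) (polarFlow γ η y (-(T * t)) u)) t :=
    HasDerivAt.scomp (g₁ := fun τ => (polarFlow γ η y τ u : Euc (n + 1))) t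
      (hasDerivAt_polarFlow hγ0 hγ1 hη hη1 y u (-(T * t))) hT
  have h2 := hasDerivAt_rotation hyz hπ h1
  rw [velocity, ← hu]
  have h3 := h2.hasDerivWithinAt.derivWithin (uniqueDiffOn_Icc zero_lt_one t ht)
  refine h3.trans ?_
  rw [rotation_smul, rotation_polarField hyz, hx, neg_smul, sub_eq_add_neg]
  rfl

end Rotation

/-- The largest rapidity that can fail to push a height `≤ h₀` below `-h₀`. The worst case `h = h₀`
gives `(1 - h₀)² e^b ≤ (1 + h₀)² e^{-b}`, and `b ≤ e^{2b}` turns this into a bound on `b`. -/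
theorem le_of_neg_le_boost {h h₀ b : ℝ} (hh : h ∈ Set.Icc (-1 : ℝ) 1) (h1 : h₀ < 1)
    (hle : h ≤ h₀) (hb : -h₀ ≤ boost (-b) h) (hb0 : 0 ≤ b) : b ≤ ((1 + h₀) / (1 - h₀)) ^ 2 := by
  have hq := boost_denom_pos hh (-b)
  rw [boost, le_div_iff₀ hq, Real.cosh_neg, Real.sinh_neg] at hb
  rw [Real.cosh_neg, Real.sinh_neg] at hq
  have hs : 0 ≤ Real.sinh b := Real.sinh_nonneg_iff.2 hb0
  have hsc := Real.sinh_lt_cosh b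
  have h2 : (1 + h₀ ^ 2) * Real.sinh b ≤ 2 * h₀ * Real.cosh b := by
    -- Replacing `h` by `h₀` changes the inequality by `(h₀ - h) (cosh b - h₀ sinh b) ≥ 0`, in the
    -- favorable direction.
    nlinarith [mul_nonneg (sub_nonneg.2 hle) (by nlinarith : 0 ≤ Real.cosh b - h₀ * Real.sinh b)]
  rw [Real.sinh_eq, Real.cosh_eq] at h2
  have h3 : (1 - h₀) ^ 2 * Real.exp b ≤ (1 + h₀) ^ 2 * Real.exp (-b) := by nlinarith
  rw [Real.exp_neg] at h3
  have he := Real.exp_pos b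
  have hbe := Real.add_one_le_exp b
  have h4 : (1 - h₀) ^ 2 * Real.exp b ^ 2 ≤ (1 + h₀) ^ 2 := by
    have := mul_le_mul_of_nonneg_right h3 he.le
    rw [mul_assoc, mul_assoc, inv_mul_cancel₀ he.ne'] at this
    nlinarith
  rw [div_pow, le_div_iff₀ (by nlinarith)]
  have h5 : b ≤ Real.exp b ^ 2 := by nlinarith
  nlinarith [mul_le_mul_of_nonneg_right h5 (sq_nonneg (1 - h₀))]

theorem exists_inner_le_of_isClosed {n : ℕ} {A : Set (Sph n)} (hA : IsClosed A) {y : Sph n}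
    (hy : y ∉ A) : ∃ h₀ : ℝ, 0 ≤ h₀ ∧ h₀ < 1 ∧
      ∀ x ∈ A, inner ℝ (x : Euc (n + 1)) (y : Euc (n + 1)) ≤ h₀ := by
  rcases A.eq_empty_or_nonempty with rfl | hne
  · exact ⟨0, le_rfl, one_pos, by simp⟩
  have hc : Continuous fun x : Sph n => inner ℝ (x : Euc (n + 1)) (y : Euc (n + 1)) :=
    continuous_subtype_val.inner continuous_const
  obtain ⟨x₀, hx₀, hmax⟩ := hA.isCompact.exists_isMaxOn hne hc.continuousOn
  refine ⟨max (inner ℝ (x₀ : Euc (n + 1)) (y : Euc (n + 1))) 0, le_max_right _ _,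
    max_lt (lt_of_le_of_ne (inner_sph_mem x₀ y).2 fun h => hy ?_) one_pos,
    fun x hx => (hmax hx).trans (le_max_left _ _)⟩
  have := (inner_eq_one_iff_of_norm_eq_one (𝕜 := ℝ) (norm_coe_sph x₀) (norm_coe_sph y)).1 h
  rwa [← Subtype.ext this]

/-- A proper closed subset of the sphere is displaced by the time-one map of a path whose velocity
at each time is the sum of a rotation field and a multiple of a polar field. -/
theorem exists_displacing_path {n : ℕ} (hn : 1 ≤ n) {γ : ℝ} (hγ0 : 0 < γ) (hγ1 : γ ≤ 1)
    {A : Set (Sph n)} (hA : IsClosed A) (hA' : A ≠ Set.univ) :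
    ∃ (y z : Sph n) (η : ℝ) (φ : ℝ → DiffSph n), 0 < η ∧ η ≤ 1 ∧
      IsSmoothPath (Diffeomorph.refl (𝓡 n) (Sph n) ∞) (φ 1) φ ∧ (φ 1) '' A ∩ A = ∅ ∧
      ∀ t ∈ Set.Icc (0 : ℝ) 1, ∃ w : Sph n, ∀ x : Sph n, velocity φ t x =
        Real.pi • rotGen (y : Euc (n + 1)) z x - (8 : ℝ) • polarField γ η (w : Euc (n + 1)) x := by
  obtain ⟨y, hy⟩ := (Set.ne_univ_iff_exists_notMem A).1 hA'
  obtain ⟨z, hyz⟩ := exists_inner_eq_zero hn y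
  obtain ⟨h₀, h0, h1, hle⟩ := exists_inner_le_of_isClosed hA hy
  set M := ((1 + h₀) / (1 - h₀)) ^ 2 with hM
  have hM1 : 1 ≤ M := by
    rw [hM]
    exact one_le_pow₀ ((one_le_div (by linarith)).2 (by linarith))
  have hM0 : 0 < M := by linarith
  -- With `η ^ γ = M⁻¹`, flow time `8` minus the error `6` leaves rapidity at least `2 M`, beyond
  -- the threshold `M` of `le_of_neg_le_boost`.
  set η := (M⁻¹) ^ (γ⁻¹) with hη
  have hη0 : 0 < η := Real.rpow_pos_of_pos (inv_pos.2 hM0) _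
  have hη1 : η ≤ 1 := Real.rpow_le_one (inv_pos.2 hM0).le (inv_le_one_of_one_le₀ hM1)
    (inv_pos.2 hγ0).le
  have hηγ : η ^ γ = M⁻¹ := Real.rpow_inv_rpow (inv_pos.2 hM0).le hγ0.ne'
  refine ⟨y, z, η, displacingPath hyz hγ0 hγ1 hη0 hη1 8, hη0, hη1,
    isSmoothPath_displacingPath hyz hγ0 hγ1 hη0 hη1 8, ?_, fun t ht =>
      ⟨_, velocity_displacingPath hyz hγ0 hγ1 hη0 hη1 8 ht⟩⟩
  rw [Set.eq_empty_iff_forall_notMem]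
  rintro _ ⟨⟨x, hx, rfl⟩, hx'⟩
  have h2 := hle _ hx'
  rw [displacingPath_apply] at h2
  change inner ℝ (rotation (y : Euc (n + 1)) z (Real.pi * 1) (polarFlow γ η y (-(8 * 1)) x)) _ ≤ _ at h2
  -- The half turn negates the height, so an image in `A` would have had height at least `-h₀` after
  -- the flow.
  rw [inner_rotation_left hyz, mul_one, mul_one, Real.cos_pi, Real.sin_pi, zero_mul, sub_zero,
    inner_polarFlow] at h2
  have hh := inner_sph_mem x y
  have h3 := flowTime_flowParam hγ0 hγ1 hη0 hη1 hh (-8)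
  have h4 := abs_flowTime_sub_le hγ0 hγ1 hη0 hη1 hh
    (flowParam γ η (-8) (inner ℝ (x : Euc (n + 1)) (y : Euc (n + 1))))
  rw [h3, hηγ] at h4
  set b := -flowParam γ η (-8) (inner ℝ (x : Euc (n + 1)) (y : Euc (n + 1))) with hb
  rw [← neg_eq_iff_eq_neg.2 hb] at h4 h2
  have h5 : 2 ≤ M⁻¹ * b := by have := (abs_le.1 h4).1; linarith
  have h6 : 2 * M ≤ b := by
    rw [inv_mul_eq_div, le_div_iff₀ hM0] at h5
    exact h5
  have h7 := le_of_neg_le_boost hh h1 (hle x hx) (b := b) (by linarith) (by linarith)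
  linarith

/-! ### Bounds on jets at a point -/

section JetBound

variable {V W X : Type*} [NormedAddCommGroup V] [NormedSpace ℝ V] [NormedAddCommGroup W]
  [NormedSpace ℝ W] [NormedAddCommGroup X] [NormedSpace ℝ X]

/-- The smooth map `f` satisfies `‖D^j f(v)‖ ≤ S τ^j` for `j ≤ k`. -/
def JetBound (k : ℕ) (S τ : ℝ) (f : V → W) (v : V) : Prop :=
  ContDiff ℝ ∞ f ∧ ∀ j ≤ k, ‖iteratedFDeriv ℝ j f v‖ ≤ S * τ ^ j

variable {k : ℕ} {S S' τ τ' : ℝ} {f : V → W} {g : V → X} {v : V}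

theorem JetBound.norm_le (hf : JetBound k S τ f v) : ‖f v‖ ≤ S := by
  simpa using hf.2 0 (Nat.zero_le _)

theorem JetBound.nonneg (hf : JetBound k S τ f v) : 0 ≤ S := (norm_nonneg _).trans hf.norm_le

theorem JetBound.norm_fderiv_le (hf : JetBound (k + 1) S τ f v) : ‖fderiv ℝ f v‖ ≤ S * τ := by
  simpa [norm_iteratedFDeriv_one] using hf.2 1 (by omega)

theorem JetBound.of_le {m : ℕ} (hf : JetBound k S τ f v) (hm : m ≤ k) : JetBound m S τ f v :=
  ⟨hf.1, fun j hj => hf.2 j (hj.trans hm)⟩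

theorem JetBound.mono (hf : JetBound k S τ f v) (hτ : 0 ≤ τ) (hS : S ≤ S') (hτ' : τ ≤ τ') :
    JetBound k S' τ' f v :=
  ⟨hf.1, fun j hj => (hf.2 j hj).trans
    (mul_le_mul hS (pow_le_pow_left₀ hτ hτ' j) (pow_nonneg hτ j) (hf.nonneg.trans hS))⟩

theorem JetBound.add {g : V → W} (hf : JetBound k S τ f v) (hg : JetBound k S' τ g v) :
    JetBound k (S + S') τ (fun x => f x + g x) v := by
  refine ⟨hf.1.add hg.1, fun j hj => ?_⟩
  have h := iteratedFDeriv_add_apply (i := j) (x := v) (𝕜 := ℝ)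
    ((hf.1.of_le (by exact_mod_cast le_top)).contDiffAt)
    ((hg.1.of_le (by exact_mod_cast le_top)).contDiffAt)
  have h' : iteratedFDeriv ℝ j (fun x => f x + g x) v = _ := h
  rw [h', add_mul]
  exact (norm_add_le _ _).trans (add_le_add (hf.2 j hj) (hg.2 j hj))

theorem JetBound.neg (hf : JetBound k S τ f v) : JetBound k S τ (fun x => -f x) v := by
  refine ⟨hf.1.neg, fun j hj => ?_⟩
  have h' : iteratedFDeriv ℝ j (fun x => -f x) v = _ := iteratedFDeriv_neg_apply
  rw [h', norm_neg]
  exact hf.2 j hj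

theorem JetBound.sub {g : V → W} (hf : JetBound k S τ f v) (hg : JetBound k S' τ g v) :
    JetBound k (S + S') τ (fun x => f x - g x) v := by
  simpa only [sub_eq_add_neg] using hf.add hg.neg

theorem jetBound_const (hτ : 0 ≤ τ) (c : W) : JetBound k ‖c‖ τ (fun _ : V => c) v := by
  refine ⟨contDiff_const, fun j _ => ?_⟩
  rcases Nat.eq_zero_or_pos j with rfl | hj
  · simp
  · rw [iteratedFDeriv_const_of_ne hj.ne']
    simp only [Pi.zero_apply, norm_zero]
    positivity

theorem JetBound.clm_comp (L : W →L[ℝ] X) (hf : JetBound k S τ f v) :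
    JetBound k (‖L‖ * S) τ (fun x => L (f x)) v := by
  refine ⟨L.contDiff.comp hf.1, fun j hj => ?_⟩
  rw [mul_assoc]
  exact (L.norm_iteratedFDeriv_comp_left (N := ∞) hf.1.contDiffAt (by exact_mod_cast le_top)).trans
    (mul_le_mul_of_nonneg_left (hf.2 j hj) (norm_nonneg _))

/-- Leibniz rule: the geometric form of the bounds gives `τ^i τ^{j-i} = τ^j` in every term, and the
binomial coefficients add up to `2^j`. -/
theorem JetBound.bilinear {Y : Type*} [NormedAddCommGroup Y] [NormedSpace ℝ Y]
    (B : W →L[ℝ] X →L[ℝ] Y) (hB : ‖B‖ ≤ 1) (hτ : 0 ≤ τ)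
    (hf : JetBound k S τ f v) (hg : JetBound k S' τ g v) :
    JetBound k (2 ^ k * (S * S')) τ (fun x => B (f x) (g x)) v := by
  refine ⟨(B.contDiff.comp hf.1).clm_apply hg.1, fun j hj => ?_⟩
  have h := B.norm_iteratedFDeriv_le_of_bilinear_of_le_one hf.1 hg.1 v (n := j)
    (by exact_mod_cast le_top) hB
  refine h.trans ?_
  have hS := hf.nonneg
  have hS' := hg.nonneg
  calc _ ≤ ∑ i ∈ Finset.range (j + 1), (j.choose i : ℝ) * (S * S' * τ ^ j) := by
        refine Finset.sum_le_sum fun i hi => ?_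
        have hij : i ≤ j := Nat.lt_succ_iff.1 (Finset.mem_range.1 hi)
        rw [mul_assoc]
        refine mul_le_mul_of_nonneg_left ?_ (Nat.cast_nonneg _)
        calc _ ≤ (S * τ ^ i) * (S' * τ ^ (j - i)) :=
              mul_le_mul (hf.2 i (hij.trans hj)) (hg.2 (j - i) ((Nat.sub_le _ _).trans hj))
                (norm_nonneg _) (by positivity)
          _ = S * S' * τ ^ j := by
              rw [← Nat.add_sub_of_le hij, pow_add, Nat.add_sub_cancel_left]; ring
    _ = 2 ^ j * (S * S' * τ ^ j) := by
        rw [← Finset.sum_mul]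
        congr 1
        exact_mod_cast Nat.sum_range_choose j
    _ ≤ 2 ^ k * (S * S') * τ ^ j := by
        rw [mul_assoc (2 ^ k)]
        exact mul_le_mul_of_nonneg_right (pow_le_pow_right₀ one_le_two hj) (by positivity)

theorem JetBound.smul {f : V → ℝ} (hτ : 0 ≤ τ) (hf : JetBound k S τ f v)
    (hg : JetBound k S' τ g v) : JetBound k (2 ^ k * (S * S')) τ (fun x => f x • g x) v :=
  JetBound.bilinear (ContinuousLinearMap.lsmul ℝ ℝ) ContinuousLinearMap.opNorm_lsmul_le hτ hf hg

theorem JetBound.mul {f g : V → ℝ} (hτ : 0 ≤ τ) (hf : JetBound k S τ f v)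
    (hg : JetBound k S' τ g v) : JetBound k (2 ^ k * (S * S')) τ (fun x => f x * g x) v :=
  hf.smul hτ hg

theorem JetBound.clm_apply {f : V → W →L[ℝ] X} {g : V → W} (hτ : 0 ≤ τ) (hf : JetBound k S τ f v)
    (hg : JetBound k S' τ g v) : JetBound k (2 ^ k * (S * S')) τ (fun x => f x (g x)) v :=
  JetBound.bilinear (ContinuousLinearMap.id ℝ (W →L[ℝ] X)) ContinuousLinearMap.norm_id_le hτ hf hg

/-- Powers of positive functions: the relative size of the jet is preserved. -/
theorem exists_jetBound_rpow (V : Type*) [NormedAddCommGroup V] [NormedSpace ℝ V]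
    (k : ℕ) (β C : ℝ) : ∃ C' : ℝ, 0 < C' ∧ ∀ (f : V → ℝ) (v : V) (τ : ℝ),
      (∀ x, 0 < f x) → 0 ≤ τ → JetBound k (C * f v) τ f v →
        JetBound k (C' * f v ^ β) τ (fun x => f x ^ β) v := by
  set K := ∑ i ∈ Finset.range (k + 1),
    ‖iteratedFDerivWithin ℝ i (fun t : ℝ => t ^ β) (Set.Ioi 0) 1‖ with hK
  have hK0 : 0 ≤ K := Finset.sum_nonneg fun _ _ => norm_nonneg _
  have hC1 : 1 ≤ max 1 C := le_max_left _ _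
  refine ⟨(k.factorial : ℝ) * (K + 1) * max 1 C ^ k, by positivity, fun f v τ hpos hτ hf => ?_⟩
  have hg : ContDiffOn ℝ ∞ (fun t : ℝ => t ^ β) (Set.Ioi 0) := fun t ht =>
    (contDiffAt_id.rpow_const_of_ne (ne_of_gt ht)).contDiffWithinAt
  have hfv := hpos v
  -- After normalization the inner function has value `1` at `v`, so the derivatives of `t ^ β` are
  -- needed only at `1` and the constant does not depend on `f` or `v`.
  set f₁ : V → ℝ := fun x => (f v)⁻¹ * f x with hf₁
  have hf₁c : ContDiff ℝ ∞ f₁ := contDiff_const.mul hf.1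
  have hf₁v : f₁ v = 1 := inv_mul_cancel₀ hfv.ne'
  have heq : (fun x => f x ^ β) = fun x => (f v ^ β) • ((fun t : ℝ => t ^ β) ∘ f₁) x := by
    funext x
    simp only [hf₁, Function.comp_apply, smul_eq_mul]
    rw [← Real.mul_rpow hfv.le (mul_nonneg (inv_nonneg.2 hfv.le) (hpos x).le),
      mul_inv_cancel_left₀ hfv.ne']
  have hcd : ContDiff ℝ ∞ ((fun t : ℝ => t ^ β) ∘ f₁) := by
    rw [← contDiffOn_univ]
    exact hg.comp hf₁c.contDiffOn fun x _ => mul_pos (inv_pos.2 hfv) (hpos x)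
  refine ⟨by rw [heq]; exact (contDiff_const : ContDiff ℝ ∞ fun _ : V => f v ^ β).smul hcd, fun j hj => ?_⟩
  -- The composition estimate asks for `i`-th powers of a single number; for `i ≥ 1` the constant
  -- `C` is absorbed into `max 1 C ^ i`.
  have hD : ∀ i, 1 ≤ i → i ≤ j → ‖iteratedFDeriv ℝ i f₁ v‖ ≤ (max 1 C * τ) ^ i := by
    intro i hi hij
    have h1 : JetBound k (‖(f v)⁻¹‖ * (C * f v)) τ f₁ v := by
      have := hf.clm_comp ((f v)⁻¹ • ContinuousLinearMap.id ℝ ℝ)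
      refine this.mono hτ (mul_le_mul_of_nonneg_right ?_ hf.nonneg) le_rfl
      rw [norm_smul]
      exact mul_le_of_le_one_right (norm_nonneg _) ContinuousLinearMap.norm_id_le
    have h2 := h1.2 i (hij.trans hj)
    have h3 : ‖(f v)⁻¹‖ * (C * f v) = C := by
      rw [Real.norm_of_nonneg (inv_nonneg.2 hfv.le)]; field_simp
    rw [h3] at h2
    rw [mul_pow]
    refine h2.trans (mul_le_mul_of_nonneg_right ?_ (pow_nonneg hτ i))
    exact (le_max_right 1 C).trans (le_self_pow₀ hC1 (by omega))
  have hKi : ∀ i, i ≤ j →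
      ‖iteratedFDerivWithin ℝ i (fun t : ℝ => t ^ β) (Set.Ioi 0) (f₁ v)‖ ≤ K + 1 := by
    intro i hi
    rw [hf₁v]
    refine le_trans ?_ (le_add_of_nonneg_right zero_le_one)
    exact Finset.single_le_sum (f := fun i =>
      ‖iteratedFDerivWithin ℝ i (fun t : ℝ => t ^ β) (Set.Ioi 0) 1‖) (fun _ _ => norm_nonneg _)
      (Finset.mem_range.2 (by omega))
  have hmain := norm_iteratedFDeriv_comp_le' (t := Set.Ioi (0 : ℝ)) (n := j)
    (by rintro _ ⟨x, rfl⟩; exact mul_pos (inv_pos.2 hfv) (hpos x)) (uniqueDiffOn_Ioi 0) hg hf₁c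
    (by exact_mod_cast le_top) v hKi hD
  have hsm : iteratedFDeriv ℝ j (fun x => f x ^ β) v =
      (f v ^ β) • iteratedFDeriv ℝ j ((fun t : ℝ => t ^ β) ∘ f₁) v := by
    rw [heq]
    exact iteratedFDeriv_const_smul_apply (a := f v ^ β) (i := j) (x := v) ((hcd.of_le (by exact_mod_cast le_top)).contDiffAt)
  have hβ : 0 < f v ^ β := Real.rpow_pos_of_pos hfv β
  rw [hsm, norm_smul, Real.norm_of_nonneg hβ.le]
  have h4 : (j.factorial : ℝ) * (K + 1) * (max 1 C * τ) ^ j ≤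
      (k.factorial : ℝ) * (K + 1) * max 1 C ^ k * τ ^ j := by
    rw [mul_pow, ← mul_assoc]
    have h5 : (j.factorial : ℝ) ≤ k.factorial := by exact_mod_cast Nat.factorial_le hj
    have h6 : max 1 C ^ j ≤ max 1 C ^ k := pow_le_pow_right₀ hC1 hj
    gcongr
  calc _ ≤ f v ^ β * ((k.factorial : ℝ) * (K + 1) * max 1 C ^ k * τ ^ j) :=
        mul_le_mul_of_nonneg_left (hmain.trans h4) hβ.le
    _ = _ := by ring

/-- It suffices to bound the value and the first derivative, if `τ` is large. -/
theorem JetBound.of_norm_fderiv_le {M : ℝ} (hf : JetBound k M 1 f v) (hτ : 1 ≤ τ)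
    (h0 : ‖f v‖ ≤ S) (h1 : ‖fderiv ℝ f v‖ ≤ S * τ) (hM : M ≤ S * τ ^ 2) : JetBound k S τ f v := by
  have hS := (norm_nonneg _).trans h0
  refine ⟨hf.1, fun j hj => ?_⟩
  rcases Nat.lt_or_ge j 2 with h | h
  · interval_cases j
    · simpa using h0
    · simpa [norm_iteratedFDeriv_one] using h1
  · calc _ ≤ M := by simpa using hf.2 j hj
      _ ≤ S * τ ^ 2 := hM
      _ ≤ _ := mul_le_mul_of_nonneg_left (pow_le_pow_right₀ hτ h) hS

theorem JetBound.of_norm_le {M : ℝ} (hf : JetBound k M 1 f v) (hτ : 1 ≤ τ)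
    (h0 : ‖f v‖ ≤ S) (hM : M ≤ S * τ) : JetBound k S τ f v := by
  have hS := (norm_nonneg _).trans h0
  refine ⟨hf.1, fun j hj => ?_⟩
  rcases Nat.eq_zero_or_pos j with rfl | h
  · simpa using h0
  · calc _ ≤ M := by simpa using hf.2 j hj
      _ ≤ S * τ := hM
      _ ≤ _ := mul_le_mul_of_nonneg_left (le_self_pow₀ hτ h.ne') hS

theorem exists_jetBound_of_isCompact (k : ℕ) (hf : ContDiff ℝ ∞ f) {s : Set V} (hs : IsCompact s) :
    ∃ M : ℝ, 1 ≤ M ∧ ∀ v ∈ s, JetBound k M 1 f v := by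
  have hb : ∀ j : ℕ, ∃ M : ℝ, ∀ v ∈ s, ‖iteratedFDeriv ℝ j f v‖ ≤ M := fun j =>
    hs.exists_bound_of_continuousOn
      (hf.continuous_iteratedFDeriv (m := j) (by exact_mod_cast le_top)).continuousOn
  choose M hM using hb
  refine ⟨1 + ∑ j ∈ Finset.range (k + 1), |M j|,
    le_add_of_nonneg_right (Finset.sum_nonneg fun _ _ => abs_nonneg _), fun v hv =>
    ⟨hf, fun j hj => ?_⟩⟩
  rw [one_pow, mul_one]
  refine (hM j v hv).trans ((le_abs_self _).trans ?_)
  refine le_trans ?_ (le_add_of_nonneg_left zero_le_one)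
  exact Finset.single_le_sum (f := fun j => |M j|) (fun _ _ => abs_nonneg _)
    (Finset.mem_range.2 (by omega))

end JetBound

/-! ### Jets of the polar vector field -/

/-- The factor `1 - h²` vanishes at the poles, so its jets cannot be measured against its own value.
Replacing it by `(1 + η)² - h²` adds at most `3η`; since `η z^{γ-1} ≤ η^γ` for `z ≥ η`, this costs
at most `6 η^γ`, which the last term of `poleD` absorbs. -/
theorem poleD_relative_bound {γ η h : ℝ} (hγ0 : 0 < γ) (hγ1 : γ ≤ 1) (hη : 0 < η) (hη1 : η ≤ 1)
    (hh : h ∈ Set.Icc (-1 : ℝ) 1) :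
    ((1 + η) ^ 2 - h ^ 2) * ((1 + η + h) ^ (γ - 1) + (1 + η - h) ^ (γ - 1)) + η ^ γ ≤
      (γ⁻¹ + 7) * poleD γ η h := by
  have hN : 0 ≤ 1 - h ^ 2 := by nlinarith [hh.1, hh.2]
  have hpow : ∀ z : ℝ, η ≤ z → 0 < z ^ (γ - 1) ∧ η * z ^ (γ - 1) ≤ η ^ γ := by
    intro z hz
    refine ⟨Real.rpow_pos_of_pos (hη.trans_le hz) _, ?_⟩
    calc η * z ^ (γ - 1) ≤ η * η ^ (γ - 1) := mul_le_mul_of_nonneg_left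
          (Real.rpow_le_rpow_of_nonpos hη hz (by linarith)) hη.le
      _ = η ^ γ := by rw [Real.rpow_sub_one hη.ne']; field_simp
  obtain ⟨hb0, hb⟩ := hpow (1 + η + h) (by linarith [hh.1])
  obtain ⟨ha0, ha⟩ := hpow (1 + η - h) (by linarith [hh.2])
  have hD := poleD_ge hγ0 hη hh
  have hD' : (1 - h ^ 2) * ((1 + η + h) ^ (γ - 1) + (1 + η - h) ^ (γ - 1)) ≤
      γ⁻¹ * poleD γ η h := by
    rw [inv_mul_eq_div, le_div_iff₀ hγ0, poleD]
    linarith [Real.rpow_pos_of_pos hη γ]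
  generalize (1 + η + h) ^ (γ - 1) = b at *
  generalize (1 + η - h) ^ (γ - 1) = a at *
  nlinarith [mul_nonneg (sub_nonneg.2 hη1) (mul_nonneg hη.le (add_pos hb0 ha0).le)]

/-- By symmetry let `b ≥ 1`. Then `b ≤ 3` and `a b τ² = 4` force `a ≥ τ^{-2}`, and the term `a b
a^{γ-1} ≥ a^γ` alone suffices. -/
theorem rpow_neg_le_poleD {γ a b τ : ℝ} (hγ0 : 0 < γ) (ha : 0 < a) (hb : 0 < b)
    (ha3 : a ≤ 3) (hb3 : b ≤ 3) (hab : 2 ≤ a + b) (hτ : 0 < τ) (habτ : a * b * τ ^ 2 = 4) :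
    τ ^ (-(2 * γ)) ≤ a * b * (b ^ (γ - 1) + a ^ (γ - 1)) := by
  have key : ∀ a b : ℝ, 0 < a → 0 < b → b ≤ 3 → 1 ≤ b → a * b * τ ^ 2 = 4 →
      τ ^ (-(2 * γ)) ≤ a * b * (b ^ (γ - 1) + a ^ (γ - 1)) := by
    intro a b ha hb hb3 hb1 habτ
    have h1 : (τ ^ 2)⁻¹ ≤ a := by
      rw [inv_le_iff_one_le_mul₀ (by positivity)]
      nlinarith [mul_pos ha (pow_pos hτ 2)]
    calc τ ^ (-(2 * γ)) = ((τ ^ 2)⁻¹) ^ γ := by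
          rw [← Real.rpow_natCast τ 2, ← Real.rpow_neg hτ.le, ← Real.rpow_mul hτ.le]
          norm_num
      _ ≤ a ^ γ := Real.rpow_le_rpow (by positivity) h1 hγ0.le
      _ = a * 1 * (0 + a ^ (γ - 1)) := by
          rw [Real.rpow_sub_one ha.ne']; field_simp; ring
      _ ≤ a * b * (b ^ (γ - 1) + a ^ (γ - 1)) := by
          have := Real.rpow_nonneg hb.le (γ - 1)
          gcongr
  rcases le_total 1 b with h | h
  · exact key a b ha hb hb3 h habτ
  · have := key b a hb ha ha3 (by linarith) (by linarith)
    linarith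

/-! ### Relative jet bounds for functions of the height and for the polar field -/

section

variable {V : Type*} [NormedAddCommGroup V] [NormedSpace ℝ V] {n : ℕ}

theorem JetBound.inner_right {k : ℕ} {S τ : ℝ} {e : V → Euc (n + 1)} {v : V}
    (he : JetBound k S τ e v) {y : Euc (n + 1)} (hy : ‖y‖ = 1) :
    JetBound k S τ (fun x => inner ℝ (e x) y) v := by
  have h := he.clm_comp (innerSL ℝ y)
  rw [innerSL_apply_norm, hy, one_mul] at h
  simpa only [innerSL_apply_apply, real_inner_comm] using h

/-- Used for the factors `1 + η ± h`, whose jets are measured against their value. The first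
derivative is of order `1 / τ`, and from order two on the lower bound on `(c + g v) τ²` is enough.
-/
theorem JetBound.const_add {k : ℕ} {M τ c : ℝ} {g : V → ℝ} {v : V} (hg : JetBound k M 1 g v)
    (hdg : ‖fderiv ℝ g v‖ * τ ≤ 2 * M) (hM : 1 ≤ M) (hτ : 1 ≤ τ) (hc : ‖c‖ ≤ 2)
    (hpos : 0 < c + g v) (h4 : 4 ≤ 3 * ((c + g v) * τ ^ 2)) :
    JetBound k (3 * M * (c + g v)) τ (fun x => c + g x) v := by
  have hτ0 : 0 < τ := by linarith
  have h1 := ((jetBound_const (k := k) (v := v) zero_le_one c).add hg).mono zero_le_one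
    (S' := 3 * M) (by linarith) le_rfl
  have h5 := mul_le_mul_of_nonneg_left h4 (by linarith : 0 ≤ M)
  refine h1.of_norm_fderiv_le hτ ?_ ?_ (by linarith)
  · rw [Real.norm_of_nonneg hpos.le]
    exact le_mul_of_one_le_left hpos.le (by linarith)
  · rw [fderiv_const_add]
    refine le_of_mul_le_mul_right ?_ hτ0
    linarith

theorem JetBound.one_sub_sq {k : ℕ} {M τ w : ℝ} {g : V → ℝ} {v : V} (hg : JetBound k M 1 g v)
    (hdg : ‖fderiv ℝ g v‖ * τ ≤ 2 * M) (hM : 1 ≤ M) (hτ : 1 ≤ τ) (hg1 : |g v| ≤ 1)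
    (hw : 1 - g v ^ 2 ≤ w) (hwτ : w * τ ^ 2 = 4) :
    JetBound k ((1 + 2 ^ k * (M * M) + M) * w) τ (fun x => 1 - g x ^ 2) v := by
  have hτ0 : 0 < τ := by linarith
  have hN : 0 ≤ 1 - g v ^ 2 := by
    have := (sq_le_one_iff_abs_le_one _).2 hg1
    linarith
  have hK : 0 ≤ 2 ^ k * (M * M) := by positivity
  have h1 : JetBound k (1 + 2 ^ k * (M * M)) 1 (fun x => 1 - g x ^ 2) v := by
    have := (jetBound_const (k := k) (v := v) zero_le_one (1 : ℝ)).sub (hg.mul zero_le_one hg)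
    simpa only [norm_one, pow_two] using this
  have h4 : (1 + 2 ^ k * (M * M) + M) * w * τ ^ 2 = 4 * (1 + 2 ^ k * (M * M) + M) := by
    linear_combination (1 + 2 ^ k * (M * M) + M) * hwτ
  refine h1.of_norm_fderiv_le hτ ?_ ?_ (by linarith)
  · rw [Real.norm_of_nonneg hN]
    exact hw.trans (le_mul_of_one_le_left (hN.trans hw) (by linarith))
  · have h2 : fderiv ℝ (fun x => 1 - g x ^ 2) v = -((2 * g v) • fderiv ℝ g v) := by
      rw [fderiv_const_sub, ((hg.1.differentiable (by simp) v).hasFDerivAt.pow 2).fderiv]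
      simp
    rw [h2, norm_neg, norm_smul]
    have h3 : ‖2 * g v‖ ≤ 2 := by
      rw [norm_mul, Real.norm_eq_abs, Real.norm_eq_abs, abs_two]
      linarith
    refine le_of_mul_le_mul_right ?_ hτ0
    rw [mul_assoc _ τ, ← pow_two τ, h4, mul_assoc]
    calc _ ≤ 2 * (2 * M) := mul_le_mul h3 hdg (by positivity) (by norm_num)
      _ ≤ _ := by linarith

/-- The derivative of `e` is tangent to the sphere, so only the tangential part of `y` matters; its
length `√(1 - h²)` is small near the poles. -/
theorem norm_fderiv_inner_le {e : V → Euc (n + 1)} (he : ContDiff ℝ ∞ e) (hn : ∀ x, ‖e x‖ = 1)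
    {v : V} {M : ℝ} (hM : ‖fderiv ℝ e v‖ ≤ M) {y : Euc (n + 1)} :
    ‖fderiv ℝ (fun x => inner ℝ (e x) y) v‖ ≤ M * ‖y - inner ℝ (e v) y • e v‖ := by
  have hd : HasFDerivAt e (fderiv ℝ e v) v := (he.differentiable (by simp) v).hasFDerivAt
  have h1 : HasFDerivAt (fun x => inner ℝ (e x) y) ((innerSL ℝ y).comp (fderiv ℝ e v)) v := by
    have := (innerSL ℝ y).hasFDerivAt.comp v hd
    refine this.congr_of_eventuallyEq (Filter.Eventually.of_forall fun x => ?_)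
    simp [real_inner_comm]
  have h2 : (innerSL ℝ (e v)).comp (fderiv ℝ e v) = 0 := by
    have h3 := hd.norm_sq
    simp only [hn, one_pow] at h3
    have h4 := h3.unique (hasFDerivAt_const _ _)
    ext ζ
    have h5 := congrArg (fun L : V →L[ℝ] ℝ => L ζ) h4
    simpa using h5
  have h6 : (innerSL ℝ y).comp (fderiv ℝ e v) =
      (innerSL ℝ (y - inner ℝ (e v) y • e v)).comp (fderiv ℝ e v) := by
    ext ζ
    have h5 := congrArg (fun L : V →L[ℝ] ℝ => L ζ) h2
    simp only [ContinuousLinearMap.comp_apply, innerSL_apply_apply, _root_.zero_apply] at h5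
    simp [h5]
  rw [h1.fderiv, h6]
  refine (ContinuousLinearMap.opNorm_comp_le _ _).trans ?_
  rw [innerSL_apply_norm, mul_comm]
  exact mul_le_mul_of_nonneg_right hM (norm_nonneg _)

theorem norm_sub_inner_smul_sq {x y : Euc (n + 1)} (hx : ‖x‖ = 1) (hy : ‖y‖ = 1) :
    ‖y - inner ℝ x y • x‖ ^ 2 = 1 - inner ℝ x y ^ 2 := by
  rw [norm_sub_sq_real, inner_smul_right, norm_smul, hx, hy, real_inner_comm]
  simp
  ring

set_option maxHeartbeats 800000 in
/-- The jets of the polar field along a map into the sphere, uniformly in the regularization `η`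
and in the pole `y`. -/
theorem exists_jetBound_polarField (V : Type*) [NormedAddCommGroup V] [NormedSpace ℝ V] (n : ℕ)
    (k : ℕ) {γ : ℝ} (hγ0 : 0 < γ) (hγ1 : γ ≤ 1) {M : ℝ} (hM : 1 ≤ M) :
    ∃ C : ℝ, 0 < C ∧ ∀ (e : V → Euc (n + 1)) (v : V) (y : Euc (n + 1)) (η τ : ℝ),
      (∀ x, ‖e x‖ = 1) → JetBound (k + 1) M 1 e v → ‖y‖ = 1 → 0 < η → η ≤ 1 → 0 < τ →
      ((1 + η) ^ 2 - inner ℝ (e v) y ^ 2) * τ ^ 2 = 4 →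
        JetBound k (C * τ ^ (2 * γ - 1)) τ (fun x => polarField γ η y (e x)) v := by
  -- `C₁` serves the powers of `1 + η ± h`, `C₂` the factor `1 - h²`, `C₃` the function `poleD` and
  -- `C₄` its reciprocal; `M₂` bounds the projected pole. None depends on `η` or `y`.
  obtain ⟨C₁, hC₁, hp₁⟩ := exists_jetBound_rpow V k (γ - 1) (3 * M)
  set M₂ : ℝ := 1 + 2 ^ k * (M * M) with hM₂
  set C₂ : ℝ := M₂ + M with hC₂
  have hM₂1 : 1 ≤ M₂ := le_add_of_nonneg_right (by positivity)
  set C₃ : ℝ := (γ * (2 ^ k * (C₂ * C₁)) + 1) * (γ⁻¹ + 7) with hC₃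
  obtain ⟨C₄, hC₄, hp₄⟩ := exists_jetBound_rpow V k (-1) C₃
  refine ⟨2 ^ k * (C₄ * (2 * M₂) * (γ⁻¹ + 7)), by positivity,
    fun e v y η τ hn he hy hη hη1 hτ hτ4 => ?_⟩
  have hk : k ≤ k + 1 := Nat.le_succ k
  have hmem : ∀ x, inner ℝ (e x) y ∈ Set.Icc (-1 : ℝ) 1 := fun x => by
    have := abs_real_inner_le_norm (e x) y
    rw [hn, hy, one_mul] at this
    exact abs_le.1 this
  have hj := he.inner_right hy
  have hP := norm_sub_inner_smul_sq (hn v) hy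
  set h := inner ℝ (e v) y with hh
  have hhm := hmem v
  rw [← hh] at hhm
  have hh2 : 0 ≤ 1 - h ^ 2 := by nlinarith [hhm.1, hhm.2]
  have hτ1 : 1 ≤ τ := by
    by_contra hlt
    have h1 : τ ^ 2 < 1 := pow_lt_one₀ hτ.le (not_le.1 hlt) two_ne_zero
    have h2 : (1 + η) ^ 2 - h ^ 2 ≤ 4 := by nlinarith [sq_nonneg h]
    have h3 := mul_le_mul_of_nonneg_right h2 (sq_nonneg τ)
    linarith
  have hab : (1 + η - h) * (1 + η + h) * τ ^ 2 = 4 := by rw [← hτ4]; ring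
  have ha0 : 0 < 1 + η - h := by linarith [hhm.2]
  have hb0 : 0 < 1 + η + h := by linarith [hhm.1]
  have ha3 : 1 + η - h ≤ 3 := by linarith [hhm.1]
  have hb3 : 1 + η + h ≤ 3 := by linarith [hhm.2]
  have hτ2 : 0 < τ ^ 2 := by positivity
  have haτ : 4 ≤ 3 * ((1 + η - h) * τ ^ 2) := by nlinarith [mul_pos ha0 hτ2]
  have hbτ : 4 ≤ 3 * ((1 + η + h) * τ ^ 2) := by nlinarith [mul_pos hb0 hτ2]
  -- The squared norm is `1 - h² ≤ (1 + η)² - h² = 4 / τ²`.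
  have hPτ : ‖y - h • e v‖ * τ ≤ 2 := by
    rw [← pow_le_pow_iff_left₀ (by positivity) (by norm_num) two_ne_zero, mul_pow, hP]
    nlinarith
  have hdh : ‖fderiv ℝ (fun x => inner ℝ (e x) y) v‖ * τ ≤ 2 * M := by
    have h1 := norm_fderiv_inner_le he.1 hn (M := M) (by simpa using he.norm_fderiv_le) (y := y)
    calc _ ≤ M * ‖y - h • e v‖ * τ := mul_le_mul_of_nonneg_right h1 hτ.le
      _ = M * (‖y - h • e v‖ * τ) := mul_assoc _ _ _
      _ ≤ M * 2 := mul_le_mul_of_nonneg_left hPτ (by linarith)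
      _ = 2 * M := mul_comm _ _
  have hη2 : ‖(1 + η : ℝ)‖ ≤ 2 := by rw [Real.norm_of_nonneg (by linarith)]; linarith
  -- the two factors of `(1 + η)² - h²`
  have hB : JetBound k (3 * M * (1 + η + h)) τ (fun x => 1 + η + inner ℝ (e x) y) v :=
    (hj.of_le hk).const_add hdh hM hτ1 hη2 hb0 hbτ
  have hA : JetBound k (3 * M * (1 + η - h)) τ (fun x => 1 + η - inner ℝ (e x) y) v := by
    simp only [sub_eq_add_neg]
    refine (hj.of_le hk).neg.const_add ?_ hM hτ1 hη2 (by linarith) (by linarith)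
    rw [fderiv_fun_neg, norm_neg]
    exact hdh
  have hBp := hp₁ _ v τ (fun x => by linarith [(hmem x).1]) hτ.le hB
  have hAp := hp₁ _ v τ (fun x => by linarith [(hmem x).2]) hτ.le hA
  have hN : JetBound k (C₂ * ((1 + η) ^ 2 - h ^ 2)) τ (fun x => 1 - inner ℝ (e x) y ^ 2) v :=
    (hj.of_le hk).one_sub_sq hdh hM hτ1 (abs_le.2 hhm) (by nlinarith) hτ4
  have hDv := poleD_relative_bound hγ0 hγ1 hη hη1 hhm
  have hDpos : ∀ x, 0 < poleD γ η (inner ℝ (e x) y) := fun x =>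
    (Real.rpow_pos_of_pos hη γ).trans_le (poleD_ge hγ0 hη (hmem x))
  have hBr : 0 < (1 + η + h) ^ (γ - 1) := Real.rpow_pos_of_pos hb0 _
  have hAr : 0 < (1 + η - h) ^ (γ - 1) := Real.rpow_pos_of_pos ha0 _
  have hηr : 0 < η ^ γ := Real.rpow_pos_of_pos hη _
  have hw : 0 < (1 + η) ^ 2 - h ^ 2 := by nlinarith
  have hD : JetBound k (C₃ * poleD γ η h) τ (fun x => poleD γ η (inner ℝ (e x) y)) v := by
    have h1 := ((hN.mul hτ.le (hBp.add hAp)).clm_comp (γ • ContinuousLinearMap.id ℝ ℝ)).add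
      (jetBound_const (k := k) (v := v) hτ.le (η ^ γ))
    refine h1.mono hτ.le ?_ le_rfl
    have hL : ‖γ • ContinuousLinearMap.id ℝ ℝ‖ ≤ γ := by
      rw [norm_smul, Real.norm_of_nonneg hγ0.le]
      exact mul_le_of_le_one_right hγ0.le ContinuousLinearMap.norm_id_le
    rw [Real.norm_of_nonneg hηr.le, hC₃, mul_assoc (γ * (2 ^ k * (C₂ * C₁)) + 1)]
    set W := ((1 + η) ^ 2 - h ^ 2) * ((1 + η + h) ^ (γ - 1) + (1 + η - h) ^ (γ - 1)) with hW
    have hW0 : 0 < W := by positivity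
    refine le_trans ?_ (mul_le_mul_of_nonneg_left hDv (by positivity))
    have h5 : 2 ^ k * (C₂ * ((1 + η) ^ 2 - h ^ 2) * (C₁ * (1 + η + h) ^ (γ - 1) +
        C₁ * (1 + η - h) ^ (γ - 1))) = 2 ^ k * (C₂ * C₁) * W := by rw [hW]; ring
    rw [h5]
    have h6 : 0 ≤ 2 ^ k * (C₂ * C₁) * W := by positivity
    have h10 : 0 ≤ γ * (2 ^ k * (C₂ * C₁)) * η ^ γ := by positivity
    calc _ ≤ γ * (2 ^ k * (C₂ * C₁) * W) + η ^ γ :=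
          add_le_add_left (mul_le_mul_of_nonneg_right hL h6) _
      _ ≤ γ * (2 ^ k * (C₂ * C₁) * W) + η ^ γ + (W + γ * (2 ^ k * (C₂ * C₁)) * η ^ γ) :=
          le_add_of_nonneg_right (add_nonneg hW0.le h10)
      _ = _ := by ring
  have hDi := hp₄ _ v τ hDpos hτ.le hD
  have hPj : JetBound k (2 * M₂ * τ⁻¹) τ (fun x => y - inner ℝ (e x) y • e x) v := by
    have h1 : JetBound k M₂ 1 (fun x => y - inner ℝ (e x) y • e x) v := by
      have := (jetBound_const (k := k) (v := v) zero_le_one y).sub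
        ((hj.of_le hk).smul zero_le_one (he.of_le hk))
      rwa [hy] at this
    refine h1.of_norm_le hτ1 ?_ ?_
    · rw [← div_eq_mul_inv, le_div_iff₀ hτ]
      exact hPτ.trans (by linarith)
    · rw [mul_assoc, inv_mul_cancel₀ hτ.ne']; linarith
  have hfin := hDi.smul hτ.le hPj
  simp only [Real.rpow_neg_one] at hfin
  refine hfin.mono hτ.le ?_ le_rfl
  -- So `1 / poleD` is at most of order `τ^{2γ}`; together with the projected pole, of order `1 /
  -- τ`, this gives the exponent `2γ - 1`.
  have hlow : τ ^ (-(2 * γ)) ≤ (γ⁻¹ + 7) * poleD γ η h := by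
    have := rpow_neg_le_poleD hγ0 ha0 hb0 ha3 hb3 (by linarith) hτ hab
    have h2 : (1 + η - h) * (1 + η + h) = (1 + η) ^ 2 - h ^ 2 := by ring
    rw [h2] at this
    linarith
  have hDinv : (poleD γ η h)⁻¹ ≤ (γ⁻¹ + 7) * τ ^ (2 * γ) := by
    rw [inv_le_iff_one_le_mul₀ (hDpos v)]
    have h3 := mul_le_mul_of_nonneg_right hlow (Real.rpow_nonneg hτ.le (2 * γ))
    rw [← Real.rpow_add hτ, neg_add_cancel, Real.rpow_zero] at h3
    linarith
  rw [Real.rpow_sub_one hτ.ne', div_eq_mul_inv]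
  have h4 : 0 ≤ C₄ * (2 * M₂) * τ⁻¹ := by positivity
  have h5 := mul_le_mul_of_nonneg_left hDinv h4
  have h6 : (0 : ℝ) ≤ 2 ^ k := by positivity
  have h7 := mul_le_mul_of_nonneg_left h5 h6
  calc _ = 2 ^ k * (C₄ * (2 * M₂) * τ⁻¹ * (poleD γ η h)⁻¹) := by ring
    _ ≤ _ := h7
    _ = _ := by ring

end

/-! ### Sobolev norms of the velocities of the displacing paths -/

section PowerWeight

variable {n : ℕ}

theorem memLp_norm_rpow_neg (hn : 1 ≤ n) {p θ : ℝ} (hp : 1 ≤ p) (hθ : θ * p < n) (R : ℝ) :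
    MemLp (fun v : Euc n => ‖v‖ ^ (-θ)) (ENNReal.ofReal p)
      (volume.restrict (Metric.ball (0 : Euc n) R)) := by
  have hne : Nonempty (Fin n) := ⟨⟨0, hn⟩⟩
  have hp0 : 0 < p := by linarith
  have hmeas : Measurable fun v : Euc n => ‖v‖ ^ (-θ) := measurable_norm.pow_const _
  rw [← integrable_norm_rpow_iff hmeas.aestronglyMeasurable (by simpa using hp0)
    ENNReal.ofReal_ne_top, ENNReal.toReal_ofReal hp0.le]
  have h1 : (fun v : Euc n => ‖‖v‖ ^ (-θ)‖ ^ p) = fun v : Euc n => ‖v‖ ^ (-(θ * p)) := by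
    funext v
    rw [Real.norm_of_nonneg (Real.rpow_nonneg (norm_nonneg _) _), ← Real.rpow_mul (norm_nonneg _),
      neg_mul]
  rw [h1]
  refine (integrableOn_fun_norm_addHaar (volume : Measure (Euc n))
    (f := fun t : ℝ => t ^ (-(θ * p)))).2 ?_
  rw [finrank_euclideanSpace_fin]
  rcases le_or_gt R 0 with hR | hR
  · rw [Set.Ioo_eq_empty (not_lt.2 hR)]
    exact integrableOn_empty
  have h2 : IntegrableOn (fun t : ℝ => t ^ ((n - 1 : ℕ) - θ * p : ℝ)) (Set.Ioo 0 R) volume := by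
    rw [intervalIntegral.integrableOn_Ioo_rpow_iff hR, Nat.cast_sub hn, Nat.cast_one]
    linarith
  refine h2.congr_fun (fun t ht => ?_) measurableSet_Ioo
  simp only [smul_eq_mul]
  rw [← Real.rpow_natCast t (n - 1), ← Real.rpow_add ht.1, sub_eq_add_neg]

/-- After translation the singularity sits at the origin and the domain lies in a fixed ball, hence
the uniformity in the center. -/
theorem exists_eLpNorm_norm_sub_rpow_neg_le (hn : 1 ≤ n) {p θ : ℝ} (hp : 1 ≤ p) (hθ : θ * p < n)
    (r : ℝ) : ∃ K : ℝ≥0∞, K < ⊤ ∧ ∀ v₀ : Euc n, ‖v₀‖ ≤ r →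
      eLpNorm (fun v : Euc n => ‖v - v₀‖ ^ (-θ)) (ENNReal.ofReal p)
        (volume.restrict (Metric.closedBall (0 : Euc n) r)) ≤ K := by
  have hm := memLp_norm_rpow_neg hn hp hθ (2 * r + 1)
  refine ⟨_, hm.2, fun v₀ hv₀ => ?_⟩
  have h1 := (measurePreserving_sub_right (volume : Measure (Euc n)) v₀).restrict_preimage
    (s := Metric.ball (0 : Euc n) (2 * r + 1)) measurableSet_ball
  rw [← eLpNorm_comp_measurePreserving hm.1 h1]
  refine eLpNorm_mono_measure _ (Measure.restrict_mono (fun v hv => ?_) le_rfl)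
  rw [mem_closedBall_zero_iff] at hv
  rw [Set.mem_preimage, mem_ball_zero_iff]
  have := norm_sub_le v v₀
  linarith

end PowerWeight

/-! ### Distance to the poles in normal coordinates -/

section Distance

variable {n : ℕ} (x : Sph n) (F : Euc n ≃ₗᵢ[ℝ] (Submodule.span ℝ {(x : Euc (n + 1))})ᗮ)

/-- Here `v₀` is a point of the closed ball whose image is nearest to `y`. The triangle inequality
costs a factor `2`, and `y` may lie outside the image of the chart. -/
theorem exists_le_norm_expAmbient_sub_point {r : ℝ} (hr0 : 0 ≤ r) (hr : r < Real.pi) :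
    ∃ c : ℝ, 0 < c ∧ ∀ y : Euc (n + 1), ∃ v₀ : Euc n, ‖v₀‖ ≤ r ∧ ∀ v : Euc n, ‖v‖ ≤ r →
      c * ‖v - v₀‖ ≤ ‖expAmbient x F v - y‖ := by
  obtain ⟨c, hc, hcE⟩ := exists_le_norm_expAmbient_sub x F hr
  refine ⟨c / 2, half_pos hc, fun y => ?_⟩
  have hcont : Continuous fun v => ‖expAmbient x F v - y‖ :=
    ((contDiff_expAmbient x F).continuous.sub continuous_const).norm
  obtain ⟨v₀, hv₀, hmin⟩ := (isCompact_closedBall (0 : Euc n) r).exists_isMinOn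
    ⟨0, by simpa using hr0⟩ hcont.continuousOn
  rw [mem_closedBall_zero_iff] at hv₀
  refine ⟨v₀, hv₀, fun v hv => ?_⟩
  have h1 : ‖expAmbient x F v₀ - y‖ ≤ ‖expAmbient x F v - y‖ :=
    hmin (mem_closedBall_zero_iff.2 hv)
  have h2 := hcE v v₀ hv hv₀
  have h3 := norm_sub_le (expAmbient x F v - y) (expAmbient x F v₀ - y)
  rw [sub_sub_sub_cancel_right] at h3
  linarith

/-- The inverse distance of a point of the sphere to a pair of antipodal points, in normal
coordinates. -/
theorem exists_rpow_le_norm_sub_rpow_neg {r θ : ℝ} (hr0 : 0 ≤ r) (hr : r < Real.pi) (hθ : 0 ≤ θ) :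
    ∃ C : ℝ, 0 < C ∧ ∀ w : Sph n, ∃ v₀ v₁ : Euc n, ‖v₀‖ ≤ r ∧ ‖v₁‖ ≤ r ∧
      ∀ (v : Euc n) (η τ : ℝ), ‖v‖ ≤ r → v ≠ v₀ → v ≠ v₁ → 0 < η → 0 < τ →
        ((1 + η) ^ 2 - inner ℝ (expAmbient x F v) (w : Euc (n + 1)) ^ 2) * τ ^ 2 = 4 →
        τ ^ θ ≤ C * (‖v - v₀‖ ^ (-θ) + ‖v - v₁‖ ^ (-θ)) := by
  obtain ⟨c, hc, hcE⟩ := exists_le_norm_expAmbient_sub_point x F hr0 hr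
  refine ⟨(3 / c) ^ θ, Real.rpow_pos_of_pos (by positivity) _, fun w => ?_⟩
  obtain ⟨v₀, hv₀, h₀⟩ := hcE w
  obtain ⟨v₁, hv₁, h₁⟩ := hcE (-(w : Euc (n + 1)))
  refine ⟨v₀, v₁, hv₀, hv₁, fun v η τ hv hne₀ hne₁ hη hτ hτ4 => ?_⟩
  have hn0 : 0 ≤ ‖v - v₀‖ ^ (-θ) := Real.rpow_nonneg (norm_nonneg _) _
  have hn1 : 0 ≤ ‖v - v₁‖ ^ (-θ) := Real.rpow_nonneg (norm_nonneg _) _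
  have hC : 0 < (3 / c) ^ θ := Real.rpow_pos_of_pos (by positivity) _
  have key : ∀ (d : Euc n) (q : ℝ), v ≠ d → c * ‖v - d‖ ≤ q →
      q ^ 2 ≤ 2 * ((1 + η) ^ 2 - inner ℝ (expAmbient x F v) (w : Euc (n + 1)) ^ 2) →
      τ ^ θ ≤ (3 / c) ^ θ * ‖v - d‖ ^ (-θ) := by
    intro d q hd hq hq2
    have hd0 : 0 < ‖v - d‖ := norm_pos_iff.2 (sub_ne_zero.2 hd)
    have h3 : (c * ‖v - d‖ * τ) ^ 2 ≤ 3 ^ 2 := by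
      have h4 : (c * ‖v - d‖) ^ 2 ≤ q ^ 2 := pow_le_pow_left₀ (by positivity) hq 2
      have h5 := mul_le_mul_of_nonneg_right (h4.trans hq2) (sq_nonneg τ)
      rw [mul_pow]
      linarith
    have h6 : c * ‖v - d‖ * τ ≤ 3 :=
      (pow_le_pow_iff_left₀ (by positivity) (by norm_num) two_ne_zero).1 h3
    have h7 : τ ≤ 3 / c * ‖v - d‖⁻¹ := by
      rw [← div_eq_mul_inv, le_div_iff₀ hd0, le_div_iff₀ hc]
      linarith
    calc τ ^ θ ≤ (3 / c * ‖v - d‖⁻¹) ^ θ := Real.rpow_le_rpow hτ.le h7 hθ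
      _ = _ := by
        rw [Real.mul_rpow (by positivity) (by positivity), Real.inv_rpow hd0.le, Real.rpow_neg hd0.le]
  have hE := norm_expAmbient x F v
  have hw := norm_coe_sph w
  have hs : ‖expAmbient x F v - w‖ ^ 2 =
      2 - 2 * inner ℝ (expAmbient x F v) (w : Euc (n + 1)) := by
    rw [norm_sub_sq_real, hE, hw]; ring
  have ha : ‖expAmbient x F v - -(w : Euc (n + 1))‖ ^ 2 =
      2 + 2 * inner ℝ (expAmbient x F v) (w : Euc (n + 1)) := by
    rw [sub_neg_eq_add, norm_add_sq_real, hE, hw]; ring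
  have hin := inner_sph_mem (expSph x F v) w
  change inner ℝ (expAmbient x F v) (w : Euc (n + 1)) ∈ _ at hin
  rw [mul_add]
  -- Only the pole in the same hemisphere matters: if `h` is the height, the squared distance to it
  -- is `2 - 2|h| ≤ 2 ((1 + η)² - h²)`.
  rcases le_total 0 (inner ℝ (expAmbient x F v) (w : Euc (n + 1))) with h | h
  · refine (key v₀ _ hne₀ (h₀ v hv) ?_).trans (le_add_of_nonneg_right (mul_nonneg hC.le hn1))
    rw [hs]
    nlinarith [hin.1, hin.2]
  · refine (key v₁ _ hne₁ (h₁ v hv) ?_).trans (le_add_of_nonneg_left (mul_nonneg hC.le hn0))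
    rw [ha]
    nlinarith [hin.1, hin.2]

end Distance

/-! ### Jets of the velocities in normal coordinates -/

section Velocity

variable {n : ℕ} (𝒰 : NormalCover n) (a : Fin 𝒰.m)

theorem exists_jetBound_rotGen (V : Type*) [NormedAddCommGroup V] [NormedSpace ℝ V] (n k : ℕ)
    (M : ℝ) : ∃ C : ℝ, 0 ≤ C ∧ ∀ (e : V → Euc (n + 1)) (v : V) (y z : Sph n),
      JetBound k M 1 e v → JetBound k C 1 (fun x => rotGen (y : Euc (n + 1)) z (e x)) v := by
  refine ⟨2 ^ k * (|M| * 1) + 2 ^ k * (|M| * 1), by positivity, fun e v y z he => ?_⟩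
  have h : ∀ y z : Sph n, JetBound k (2 ^ k * (|M| * 1)) 1
      (fun x => inner ℝ (e x) (y : Euc (n + 1)) • (z : Euc (n + 1))) v := fun y z => by
    have := (he.inner_right (norm_coe_sph y)).smul zero_le_one
      (jetBound_const (k := k) (v := v) zero_le_one (z : Euc (n + 1)))
    rwa [norm_coe_sph, ← abs_of_nonneg he.nonneg] at this
  exact (h y z).sub (h z y)

/-- The jets in normal coordinates of the velocities of the displacing paths. -/
theorem NormalCover.exists_norm_iteratedFDeriv_localRep_le (k : ℕ) {γ θ r : ℝ} (hγ0 : 0 < γ)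
    (hγ1 : γ ≤ 1) (hθ : 0 ≤ θ) (hθ' : 2 * γ - 1 + k ≤ θ) :
    ∃ C : ℝ, 0 < C ∧ ∀ (y z w : Sph n) (η : ℝ) (u : Sph n → Euc (n + 1)), 0 < η → η ≤ 1 →
      (∀ x : Sph n, inner ℝ (x : Euc (n + 1)) (u x) = 0) →
      (∀ x : Sph n, u x = Real.pi • rotGen (y : Euc (n + 1)) z x -
        (8 : ℝ) • polarField γ η (w : Euc (n + 1)) x) →
      ∀ (v : Euc n) (τ : ℝ), ‖v‖ ≤ r → 0 < τ →
        ((1 + η) ^ 2 -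
          inner ℝ (expAmbient (𝒰.center a) (𝒰.frame a) v) (w : Euc (n + 1)) ^ 2) * τ ^ 2 = 4 →
        ∀ j ≤ k, ‖iteratedFDeriv ℝ j (𝒰.localRep u a) v‖ ≤ C * τ ^ θ := by
  set e := expAmbient (𝒰.center a) (𝒰.frame a) with he
  have hec : ContDiff ℝ ∞ e := contDiff_expAmbient _ _
  obtain ⟨M, hM, hMe⟩ := exists_jetBound_of_isCompact (k + 1) hec
    (isCompact_closedBall (0 : Euc n) r)
  obtain ⟨M', hM', hMc⟩ := exists_jetBound_of_isCompact k (𝒰.contDiff_chartMap a)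
    (isCompact_closedBall (0 : Euc n) r)
  obtain ⟨C₁, hC₁, hrot⟩ := exists_jetBound_rotGen (Euc n) n k M
  obtain ⟨C₂, hC₂, hpol⟩ := exists_jetBound_polarField (Euc n) n k hγ0 hγ1 hM
  set S₁ := 2 ^ k * (M' * (2 ^ k * (‖Real.pi‖ * C₁))) with hS₁
  set S₂ := 2 ^ k * (M' * (2 ^ k * (‖(8 : ℝ)‖ * C₂))) with hS₂
  have hS₁0 : 0 ≤ S₁ := by positivity
  have hM'0 : 0 < M' := by linarith
  have h8 : 0 < ‖(8 : ℝ)‖ := by norm_num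
  have hS₂0 : 0 < S₂ := by positivity
  refine ⟨S₁ + S₂, by positivity, fun y z w η u hη hη1 hu hu' v τ hv hτ hτ4 j hj => ?_⟩
  have hvm : v ∈ Metric.closedBall (0 : Euc n) r := mem_closedBall_zero_iff.2 hv
  have hev := hMe v hvm
  have hchart := hMc v hvm
  have hτ1 : 1 ≤ τ := by
    by_contra hlt
    have h1 : τ ^ 2 < 1 := pow_lt_one₀ hτ.le (not_le.1 hlt) two_ne_zero
    have h2 : (1 + η) ^ 2 - inner ℝ (e v) (w : Euc (n + 1)) ^ 2 ≤ 4 := by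
      nlinarith [sq_nonneg (inner ℝ (e v) (w : Euc (n + 1)))]
    have h3 := mul_le_mul_of_nonneg_right h2 (sq_nonneg τ)
    linarith
  have h1 : JetBound k S₁ 1
      (fun x => 𝒰.chartMap a x (Real.pi • rotGen (y : Euc (n + 1)) z (e x))) v :=
    hchart.clm_apply zero_le_one ((jetBound_const zero_le_one Real.pi).smul zero_le_one
      (hrot e v y z (hev.of_le (Nat.le_succ k))))
  have h2 : JetBound k (S₂ * τ ^ (2 * γ - 1)) τ
      (fun x => 𝒰.chartMap a x ((8 : ℝ) • polarField γ η (w : Euc (n + 1)) (e x))) v := by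
    have := (hchart.mono zero_le_one le_rfl hτ1).clm_apply hτ.le
      ((jetBound_const hτ.le (8 : ℝ)).smul hτ.le
        (hpol e v w η τ (norm_expAmbient _ _) hev (norm_coe_sph w) hη hη1 hτ hτ4))
    refine this.mono hτ.le (le_of_eq ?_) le_rfl
    rw [hS₂]; ring
  have heq : 𝒰.localRep u a =
      fun x => 𝒰.chartMap a x (Real.pi • rotGen (y : Euc (n + 1)) z (e x)) +
        -𝒰.chartMap a x ((8 : ℝ) • polarField γ η (w : Euc (n + 1)) (e x)) := by
    funext x
    rw [localRep_eq_chartMap hu, hu', map_sub, sub_eq_add_neg]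
    rfl
  have hjk : ∀ {S τ : ℝ} {f : Euc n → Euc n}, JetBound k S τ f v → ContDiffAt ℝ j f v := fun hf =>
    (hf.1.of_le (by exact_mod_cast le_top)).contDiffAt
  have hadd := iteratedFDeriv_add_apply (hjk h1) (hjk h2.neg)
  rw [heq]
  refine (congrArg norm hadd).trans_le ((norm_add_le _ _).trans ?_)
  have h3 := h1.2 j hj
  have h4 := h2.neg.2 j hj
  rw [one_pow, mul_one] at h3
  have h5 : (1 : ℝ) ≤ τ ^ θ := Real.one_le_rpow hτ1 hθ
  have h6 : τ ^ (2 * γ - 1) * τ ^ j ≤ τ ^ θ := by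
    rw [← Real.rpow_natCast τ j, ← Real.rpow_add hτ]
    refine Real.rpow_le_rpow_of_exponent_le hτ1 (le_trans ?_ hθ')
    have : (j : ℝ) ≤ k := by exact_mod_cast hj
    linarith
  rw [add_mul]
  refine add_le_add (h3.trans (le_mul_of_one_le_right hS₁0 h5)) (h4.trans ?_)
  rw [mul_assoc]
  exact mul_le_mul_of_nonneg_left h6 hS₂0.le

variable {𝒰 a}

theorem NormalCover.iteratedFDeriv_localRep_eq_zero {r : ℝ}
    (hρ : ∀ y : Sph n, 𝒰.ρ a y ≠ 0 →
      InnerProductGeometry.angle (𝒰.center a : Euc (n + 1)) (y : Euc (n + 1)) ≤ r)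
    {u : Sph n → Euc (n + 1)} (hu : ∀ y : Sph n, inner ℝ (y : Euc (n + 1)) (u y) = 0)
    {v : Euc n} (hv : r < ‖v‖) (j : ℕ) : iteratedFDeriv ℝ j (𝒰.localRep u a) v = 0 := by
  have he : 𝒰.localRep u a =ᶠ[nhds v] fun _ => 0 := by
    filter_upwards [(continuous_norm.tendsto v).eventually (lt_mem_nhds hv)] with x hx
    rw [localRep_eq_chartMap hu, 𝒰.chartMap_eq_zero a hρ hx]
    rfl
  rw [(Filter.EventuallyEq.iteratedFDeriv ℝ he j).eq_of_nhds]
  rcases Nat.eq_zero_or_pos j with rfl | hj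
  · ext; simp
  · rw [iteratedFDeriv_const_of_ne hj.ne']; rfl

end Velocity

/-! ### Uniform Sobolev bounds and the upper estimate -/

section DisplacementBound

variable {n : ℕ}

theorem sobolevNorm_natCast (k : ℕ) (p : ℝ) (f : Euc n → Euc n) :
    sobolevNorm (k : ℝ) p f = intSobolevNorm k p f := by
  rw [sobolevNorm, if_pos (by rw [Nat.floor_natCast]), Nat.floor_natCast]

/-- The Sobolev norms of the velocities of the displacing paths are uniformly bounded. -/
theorem NormalCover.exists_sobolevNorm_localRep_le (𝒰 : NormalCover n) (a : Fin 𝒰.m) (hn : 1 ≤ n)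
    {p : ℝ} (hp : 1 ≤ p) (k : ℕ) {γ : ℝ} (hγ0 : 0 < γ) (hγ1 : γ ≤ 1)
    (hγ : (2 * γ - 1 + k) * p < n) :
    ∃ K : ℝ≥0∞, K < ⊤ ∧ ∀ (y z w : Sph n) (η : ℝ) (u : Sph n → Euc (n + 1)), 0 < η → η ≤ 1 →
      (∀ x : Sph n, inner ℝ (x : Euc (n + 1)) (u x) = 0) →
      (∀ x : Sph n, u x = Real.pi • rotGen (y : Euc (n + 1)) z x -
        (8 : ℝ) • polarField γ η (w : Euc (n + 1)) x) →
      sobolevNorm (k : ℝ) p (𝒰.localRep u a) ≤ K := by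
  have hne : Nonempty (Fin n) := ⟨⟨0, hn⟩⟩
  -- The rotation part is merely bounded, so the exponent must be nonnegative; exponent `0` is
  -- integrable because `n ≥ 1`.
  set θ := max (2 * γ - 1 + k) 0 with hθ
  have hθp : θ * p < n := by
    rcases max_choice (2 * γ - 1 + k : ℝ) 0 with h | h
    · rw [hθ, h]; exact hγ
    · rw [hθ, h, zero_mul]; exact_mod_cast hn
  have hθ0 : 0 ≤ θ := le_max_right _ _
  obtain ⟨r, hr0, hr, hρ⟩ := 𝒰.exists_supportRadius a
  obtain ⟨C₁, hC₁, h₁⟩ := 𝒰.exists_norm_iteratedFDeriv_localRep_le a k (r := r) hγ0 hγ1 hθ0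
    (le_max_left _ _)
  obtain ⟨C₂, hC₂, h₂⟩ := exists_rpow_le_norm_sub_rpow_neg (𝒰.center a) (𝒰.frame a) hr0
    (hr.trans_le (𝒰.radius_le a)) hθ0
  obtain ⟨K, hK, hKle⟩ := exists_eLpNorm_norm_sub_rpow_neg_le hn hp hθp r
  refine ⟨∑ j ∈ Finset.range (k + 1), ‖C₁ * C₂‖ₑ * (K + K), ?_,
    fun y z w η u hη hη1 hu hu' => ?_⟩
  · exact ENNReal.sum_lt_top.2 fun j _ =>
      ENNReal.mul_lt_top enorm_lt_top (ENNReal.add_lt_top.2 ⟨hK, hK⟩)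
  obtain ⟨v₀, v₁, hv₀, hv₁, hτ⟩ := h₂ w
  rw [sobolevNorm_natCast, intSobolevNorm]
  refine Finset.sum_le_sum fun j hj => ?_
  have hjk : j ≤ k := Nat.lt_succ_iff.1 (Finset.mem_range.1 hj)
  set f := iteratedFDeriv ℝ j (𝒰.localRep u a) with hf
  set B := Metric.closedBall (0 : Euc n) r with hB
  have hind : B.indicator f = f := by
    refine Set.indicator_eq_self.2 fun v hv => ?_
    by_contra hvB
    rw [hB, mem_closedBall_zero_iff, not_le] at hvB
    exact hv (iteratedFDeriv_localRep_eq_zero hρ hu hvB j)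
  rw [← hind, eLpNorm_indicator_eq_eLpNorm_restrict measurableSet_closedBall]
  set g : Euc n → Euc n → ℝ := fun d v => ‖v - d‖ ^ (-θ) with hg
  have hgm : ∀ d, AEStronglyMeasurable (g d) (volume.restrict B) := fun d =>
    ((measurable_id.sub_const d).norm.pow_const (-θ)).aestronglyMeasurable
  have hle : ∀ᵐ v ∂volume.restrict B, ‖f v‖ ≤ ‖((C₁ * C₂) • (g v₀ + g v₁)) v‖ := by
    -- At the centers the real power `‖0‖ ^ (-θ)` has a default value that bounds nothing; these two
    -- points form a null set.
    have hne0 : ∀ d : Euc n, ∀ᵐ v ∂volume.restrict B, v ≠ d := fun d =>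
      ae_restrict_of_ae (Measure.ae_ne volume d)
    filter_upwards [hne0 v₀, hne0 v₁, ae_restrict_mem measurableSet_closedBall] with v h0 h1 hv
    rw [hB, mem_closedBall_zero_iff] at hv
    have hin := inner_sph_mem (expSph (𝒰.center a) (𝒰.frame a) v) w
    change inner ℝ (expAmbient (𝒰.center a) (𝒰.frame a) v) (w : Euc (n + 1)) ∈ _ at hin
    set h := inner ℝ (expAmbient (𝒰.center a) (𝒰.frame a) v) (w : Euc (n + 1)) with hh
    have hpos : 0 < (1 + η) ^ 2 - h ^ 2 := by nlinarith [hin.1, hin.2]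
    have hτ0 : 0 < 2 / Real.sqrt ((1 + η) ^ 2 - h ^ 2) := div_pos two_pos (Real.sqrt_pos.2 hpos)
    have hτ4 : ((1 + η) ^ 2 - h ^ 2) * (2 / Real.sqrt ((1 + η) ^ 2 - h ^ 2)) ^ 2 = 4 := by
      rw [div_pow, Real.sq_sqrt hpos.le, mul_div_cancel₀ _ hpos.ne']
      norm_num
    have h3 := h₁ y z w η u hη hη1 hu hu' v _ hv hτ0 hτ4 j hjk
    have h4 := hτ v η _ hv h0 h1 hη hτ0 hτ4
    refine h3.trans ((mul_le_mul_of_nonneg_left h4 hC₁.le).trans ?_)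
    rw [← mul_assoc]
    exact Real.le_norm_self _
  refine (eLpNorm_mono_ae hle).trans ?_
  rw [eLpNorm_const_smul]
  refine mul_le_mul_right ((eLpNorm_add_le (hgm v₀) (hgm v₁) ?_).trans
    (add_le_add (hKle v₀ hv₀) (hKle v₁ hv₁))) _
  simpa using hp

/-- This is where the critical exponent enters: as `γ → 0` the condition tends to `(k - 1) p < n`,
and a quarter of the gap leaves enough room. -/
theorem exists_exponent {p : ℝ} (hp : 1 ≤ p) {k : ℕ} (hk : (k : ℝ) < 1 + (n : ℝ) / p) :
    ∃ γ : ℝ, 0 < γ ∧ γ ≤ 1 ∧ (2 * γ - 1 + k) * p < n := by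
  have hp0 : 0 < p := by linarith
  refine ⟨min 1 ((1 + n / p - k) / 4), lt_min one_pos (by linarith), min_le_left _ _, ?_⟩
  rw [← lt_div_iff₀ hp0]
  have := min_le_right 1 ((1 + n / p - k) / 4)
  linarith

/-- Below the critical exponent, the displacement energy of proper closed sets is bounded. -/
theorem NormalCover.exists_displacementEnergy_lt (𝒰 : NormalCover n) (hn : 1 ≤ n) {p : ℝ}
    (hp : 1 ≤ p) {k : ℕ} (hk : (k : ℝ) < 1 + (n : ℝ) / p) :
    ∃ C : ℝ, 0 < C ∧ ∀ A : Set (Sph n), IsClosed A → A ≠ Set.univ →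
      𝒰.displacementEnergy (k : ℝ) p A < ENNReal.ofReal C := by
  obtain ⟨γ, hγ0, hγ1, hγ⟩ := exists_exponent hp hk
  choose K hK hKle using fun a => 𝒰.exists_sobolevNorm_localRep_le a hn hp k hγ0 hγ1 hγ
  set L : ℝ≥0∞ := (∑ a, K a ^ 2) ^ (1 / 2 : ℝ) with hL
  have hLtop : L < ⊤ := ENNReal.rpow_lt_top_of_nonneg (by norm_num)
    (ENNReal.sum_lt_top.2 fun a _ => ENNReal.pow_lt_top (hK a)).ne
  refine ⟨L.toReal + 1, by positivity, fun A hA hA' => ?_⟩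
  obtain ⟨y, z, η, φ, hη, hη1, hφ, hdis, hv⟩ := exists_displacing_path hn hγ0 hγ1 hA hA'
  have hlen : 𝒰.pathLength (k : ℝ) p φ ≤ L := by
    calc 𝒰.pathLength (k : ℝ) p φ ≤ ∫⁻ _ in Set.Icc (0 : ℝ) 1, L := by
          refine setLIntegral_mono' measurableSet_Icc fun t ht => ?_
          obtain ⟨w, hw⟩ := hv t ht
          refine ENNReal.rpow_le_rpow (Finset.sum_le_sum fun a _ => ?_) (by norm_num)
          exact pow_le_pow_left' (hKle a y z w η _ hη hη1 (hφ.inner_velocity ht) hw) 2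
      _ = L := by simp
  have hE : 𝒰.displacementEnergy (k : ℝ) p A ≤ L :=
    (iInf₂_le (φ 1) hdis).trans ((iInf₂_le φ hφ).trans hlen)
  refine hE.trans_lt ?_
  rw [← ENNReal.ofReal_toReal hLtop.ne, ENNReal.toReal_ofReal ENNReal.toReal_nonneg,
    ENNReal.ofReal_lt_ofReal_iff (by positivity)]
  exact lt_add_one _

end DisplacementBound

end SphereDiff

end

theorem mainTheorem8 (n : ℕ) (hn : 1 ≤ n) (p : ℝ) (hp : 1 ≤ p) (𝒰 : SphereDiff.NormalCover n) :
    (∀ s : ℝ, 1 + (n : ℝ) / p < s →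
      ∃ c : ℝ, 0 < c ∧ ∀ (x : SphereDiff.Sph n) (δ : ℝ), 0 < δ → δ < 1 →
        ENNReal.ofReal (c * |Real.log δ|) <
          𝒰.displacementEnergy s p (SphereDiff.geoBall x δ)ᶜ) ∧
    (∀ k : ℕ, (k : ℝ) < 1 + (n : ℝ) / p →
      ∃ C : ℝ, 0 < C ∧ ∀ A : Set (SphereDiff.Sph n), IsClosed A → A ≠ Set.univ →
        𝒰.displacementEnergy (k : ℝ) p A < ENNReal.ofReal C) := by
  exact ⟨fun s hs => 𝒰.exists_lt_displacementEnergy hn hp hs,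
    fun k hk => 𝒰.exists_displacementEnergy_lt hn hp hk⟩
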